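/- Let $E\cong\mathbb{P}^1$ be the exceptional divisor of the blow-up of the origin of $\mathbb{C}^2$. For $n\ge 0$, let $\mathcal{D}(n)$ be the set of germs at $0\in\mathbb{C}^2$ of holomorphic foliations $\mathcal{F}$ (given by a germ of holomorphic one-form $\omega$ with at most an isolated zero, up to multiplication by units) such that $\omega$ vanishes to order exactly $n+1$ at $0$ and such that the saturated pull-back $\widetilde{\mathcal{F}}$ of $\mathcal{F}$ by the blow-up is regular at every point of $E$. The elements of $\mathcal{D}(0)$ are the radial foliations, i.e. those defined by a germ of holomorphic vector field with linear part $x\partial_x+y\partial_y$. Let $\mathcal{F}\in\mathcal{D}(n)$. At a point $p\in E$ at which $\widetilde{\mathcal{F}}$ is tangent to $E$ to order $r\ge1$, write the restriction to $E$ of a local primitive first integral of $\widetilde{\mathcal{F}}$ vanishing at $p$ as $\psi^{r+1}$, with $\psi$ a local coordinate of $E$ at $p$, and set $H(\mathcal{F},p)=\psi^{-1}\circ\theta\circ\psi$, where $\theta$ is the rotation of angle $2\pi/(r+1)$. The holonomy $H(\mathcal{F})$ is the disjoint union over all such $p$ of the germs $H(\mathcal{F},p)$. Say that $\mathcal{F}$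 is homogeneous with respect to a radial foliation $\mathcal{G}\neq\mathcal{F}$ if the tangency divisor $\mathrm{Tang}(\mathcal{F},\mathcal{G})=\{\omega(X)=0\}$ ($X$ a vector field defining $\mathcal{G}$) is invariant by $\mathcal{F}$. Let $\mathcal{D}^{h}(n)$ be the set of those $\mathcal{F}\in\mathcal{D}(n)$ that are homogeneous with respect to some radial foliation. Let $\mathrm{div}^h(\mathcal{F})$ be the set of divisors on $E$ of the form $\mathrm{Tang}(\mathcal{F},\mathcal{G})|_E$ with $\mathcal{G}$ radial and $\mathcal{F}$ homogeneous with respect to $\mathcal{G}$; here $\mathrm{Tang}(\mathcal{F},\mathcal{G})|_E$ is the restriction to $E$ of the tangency divisor of the blown-up foliations $\widetilde{\mathcal{F}},\widetilde{\mathcal{G}}$, required not to contain $E$. **Theorem.** Let $\mathcal{F}_1\in\mathcal{D}^{h}(n)$ and let $\mathcal{F}_2$ be any germ of holomorphic foliation of $(\mathbb{C}^2,0)$. There exists a germ of biholomorphism $\varphi\in\mathrm{Aut}(\mathbb{C}^2,0)$ with $\varphi_*\mathcal{F}_1=\mathcal{F}_2$ if and only if $\mathcal{F}_2\in\mathcal{D}(n)$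 and there exists a holomorphic automorphism $\phi\in\mathrm{Aut}(E)$ such that 1. $H(\mathcal{F}_2)=\phi\circ H(\mathcal{F}_1)\circ\phi^{-1}$; 2. for some $D\in\mathrm{div}^h(\mathcal{F}_1)$, $\phi_*D\in\mathrm{div}^h(\mathcal{F}_2)$. More precisely, a given $\phi\in\mathrm{Aut}(E)$ is the map $\varphi|_E$ induced on $E$ by some $\varphi\in\mathrm{Aut}(\mathbb{C}^2,0)$ with $\varphi_*\mathcal{F}_1=\mathcal{F}_2$ if and only if $\mathcal{F}_2\in\mathcal{D}(n)$ and $\phi$ satisfies 1 and 2; and in that case $\phi_*D\in\mathrm{div}^h(\mathcal{F}_2)$ for every $D\in\mathrm{div}^h(\mathcal{F}_1)$. -/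

import Mathlib

open Filter Topology

noncomputable section

namespace Dicritical

/-! ### Germs of foliations and of biholomorphisms of `(ℂ², 0)` -/

/-- A germ at `0 ∈ ℂ²` of (possibly singular) holomorphic foliation, presented by a germ of
holomorphic one-form whose zeros are isolated. Two such forms define the same foliation when they
differ by a holomorphic unit; all notions below depend on the form only up to units. -/
structure FoliationGerm where
  /-- the one-form -/
  form : ℂ × ℂ → (ℂ × ℂ →L[ℂ] ℂ)
  analyticAt : AnalyticAt ℂ form 0
  saturated : ∀ᶠ p in 𝓝[≠] (0 : ℂ × ℂ), form p ≠ 0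

/-- A germ of biholomorphism of `(ℂ², 0)`. -/
structure BiholGerm where
  toFun : ℂ × ℂ → ℂ × ℂ
  analyticAt : AnalyticAt ℂ toFun 0
  map_zero : toFun 0 = 0
  /-- the derivative at the origin, which is invertible -/
  linearPart : (ℂ × ℂ) ≃L[ℂ] (ℂ × ℂ)
  hasFDerivAt : HasFDerivAt toFun (linearPart : ℂ × ℂ →L[ℂ] ℂ × ℂ) 0

/-- `Φ_* F₁ = F₂`: the pull-back of a form defining `F₂` is a unit times the form defining `F₁`. -/
def BiholGerm.MapsTo (Φ : BiholGerm) (F₁ F₂ : FoliationGerm) : Prop :=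
  ∃ u : ℂ × ℂ → ℂ, AnalyticAt ℂ u 0 ∧ u 0 ≠ 0 ∧
    ∀ᶠ p in 𝓝 (0 : ℂ × ℂ),
      (F₂.form (Φ.toFun p)).comp (fderiv ℂ Φ.toFun p) = u p • F₁.form p

/-- The multiplicity at the origin is `m`: the form vanishes to order exactly `m` at `0`. -/
def FoliationGerm.HasMultiplicity (F : FoliationGerm) (m : ℕ) : Prop :=
  (∀ j < m, iteratedFDeriv ℂ j F.form 0 = 0) ∧ iteratedFDeriv ℂ m F.form 0 ≠ 0

/-! ### The exceptional divisor and the blow-up of the origin -/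

/-- The exceptional divisor of the blow-up of `0 ∈ ℂ²`: the set of lines through `0`. -/
abbrev ExcDiv : Type := Projectivization ℂ (ℂ × ℂ)

/-- Direction vectors in the two standard charts: `(1, t)` and `(t, 1)`. -/
def dir (i : Fin 2) (t : ℂ) : ℂ × ℂ := if i = 0 then (1, t) else (t, 1)

theorem dir_ne_zero (i : Fin 2) (t : ℂ) : dir i t ≠ 0 := by
  unfold dir
  split_ifs <;> simp [Prod.ext_iff]

/-- The two standard affine charts `ℂ → E` of the exceptional divisor. -/
def pt (i : Fin 2) (t : ℂ) : ExcDiv := Projectivization.mk ℂ (dir i t) (dir_ne_zero i t)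

/-- The blow-down map in the two standard charts of the blow-up: `(x, t) ↦ (x, x t)` and
`(x, t) ↦ (x t, x)`. In both charts `E` is `{x = 0}`, and `(0, t)` is the point `pt i t`. -/
def blowDown (i : Fin 2) (q : ℂ × ℂ) : ℂ × ℂ := q.1 • dir i q.2

/-- A map `E → E` is holomorphic: locally it is given by a nowhere zero holomorphic vector of
homogeneous coordinates. -/
def IsHolomorphicOnE (f : ExcDiv → ExcDiv) : Prop :=
  ∀ (i : Fin 2) (t₀ : ℂ), ∃ v : ℂ → ℂ × ℂ, AnalyticAt ℂ v t₀ ∧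
    ∀ᶠ t in 𝓝 t₀, ∃ hv : v t ≠ 0, f (pt i t) = Projectivization.mk ℂ (v t) hv

/-- `Aut(E)`: the biholomorphic maps of the exceptional divisor onto itself. -/
structure AutE where
  toEquiv : ExcDiv ≃ ExcDiv
  holomorphic : IsHolomorphicOnE toEquiv
  holomorphic_symm : IsHolomorphicOnE toEquiv.symm

/-- The map `Φ|_E : E → E` induced on the exceptional divisor by the lift of `Φ` to the blow-up:
it sends the line spanned by `v` to the line spanned by `DΦ(0) v`. -/
def BiholGerm.onE (Φ : BiholGerm) : ExcDiv → ExcDiv :=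
  Projectivization.map (Φ.linearPart.toLinearEquiv : ℂ × ℂ →ₗ[ℂ] ℂ × ℂ) Φ.linearPart.injective

/-- `η` is a nonvanishing one-form generating, near the point `(0, t₀)` of chart `i`, the
saturation of the pull-back of `F` by the blow-down map (so the latter is regular there). -/
def FoliationGerm.IsLocalGenerator (F : FoliationGerm) (i : Fin 2) (t₀ : ℂ)
    (η : ℂ × ℂ → (ℂ × ℂ →L[ℂ] ℂ)) : Prop :=
  AnalyticAt ℂ η (0, t₀) ∧ η (0, t₀) ≠ 0 ∧
    ∃ k : ℂ × ℂ → ℂ, AnalyticAt ℂ k (0, t₀) ∧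
      ∀ᶠ q in 𝓝 ((0 : ℂ), t₀),
        (F.form (blowDown i q)).comp (fderiv ℂ (blowDown i) q) = k q • η q

/-- The set `𝒟`: the blown-up foliation is regular at every point of `E`. -/
def FoliationGerm.InD (F : FoliationGerm) : Prop :=
  ∀ (i : Fin 2) (t₀ : ℂ), ∃ η, F.IsLocalGenerator i t₀ η

/-- The set `𝒟(n)`: elements of `𝒟` of multiplicity `n + 1` at the origin. -/
def FoliationGerm.InDn (F : FoliationGerm) (n : ℕ) : Prop :=
  F.InD ∧ F.HasMultiplicity (n + 1)

/-! ### Tangency with the exceptional divisor and holonomy -/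

/-- The blown-up foliation is tangent to `E` to order `r` at the point `(0, t₀)` of chart `i`. -/
def FoliationGerm.HasTangencyOrder (F : FoliationGerm) (i : Fin 2) (t₀ : ℂ) (r : ℕ) : Prop :=
  ∃ η, F.IsLocalGenerator i t₀ η ∧
    analyticOrderAt (fun t : ℂ => η (0, t) (0, 1)) t₀ = (r : ℕ∞)

/-- `f` is a local primitive first integral of the blown-up foliation at the point `(0, t₀)` of
chart `i`: its differential generates the (regular) foliation. -/
def FoliationGerm.IsFirstIntegral (F : FoliationGerm) (i : Fin 2) (t₀ : ℂ)
    (f : ℂ × ℂ → ℂ) : Prop :=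
  AnalyticAt ℂ f (0, t₀) ∧ F.IsLocalGenerator i t₀ (fderiv ℂ f)

/-- The map `h : E → E` represents, near `p`, the germ `H(F, p) = ψ⁻¹ ∘ θ ∘ ψ`, where `p` is a
point of tangency of the blown-up foliation with `E`, of order `r ≥ 1`, `ψ ^ (r + 1)` is the
restriction to `E` of a local primitive first integral, and `θ` is the rotation of angle
`2π / (r + 1)`. In the coordinate `t` of chart `i`, the germ is `g`. -/
def FoliationGerm.IsHolonomyAt (F : FoliationGerm) (p : ExcDiv) (h : ExcDiv → ExcDiv) : Prop :=
  ∃ (i : Fin 2) (t₀ : ℂ) (r : ℕ) (f : ℂ × ℂ → ℂ) (ψ g : ℂ → ℂ),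
    p = pt i t₀ ∧ 1 ≤ r ∧ F.HasTangencyOrder i t₀ r ∧ F.IsFirstIntegral i t₀ f ∧
    AnalyticAt ℂ ψ t₀ ∧ ψ t₀ = 0 ∧ deriv ψ t₀ ≠ 0 ∧
    (∀ᶠ t in 𝓝 t₀, f (0, t) = ψ t ^ (r + 1)) ∧
    AnalyticAt ℂ g t₀ ∧ g t₀ = t₀ ∧
    (∀ᶠ t in 𝓝 t₀, ψ (g t) = Complex.exp (2 * Real.pi * Complex.I / ((r : ℂ) + 1)) * ψ t) ∧
    ∀ᶠ t in 𝓝 t₀, h (pt i t) = pt i (g t)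

/-- The holonomy `H(F)`: the disjoint union over the points `p` of tangency with `E` of the germs
`H(F, p)`, a germ being identified with the set of maps that represent it. -/
def FoliationGerm.holonomy (F : FoliationGerm) : Set (ExcDiv × (ExcDiv → ExcDiv)) :=
  {a | F.IsHolonomyAt a.1 a.2}

/-- `φ ∘ H ∘ φ⁻¹`, for a family `H` of germs of self-maps of `E`. -/
def AutE.conj (φ : AutE) (H : Set (ExcDiv × (ExcDiv → ExcDiv))) :
    Set (ExcDiv × (ExcDiv → ExcDiv)) :=
  (fun a => (φ.toEquiv a.1, φ.toEquiv ∘ a.2 ∘ φ.toEquiv.symm)) '' H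

/-! ### Radial foliations, tangency divisors and homogeneity -/

/-- A germ of holomorphic vector field with linear part `x ∂_x + y ∂_y`; it defines a radial
foliation, and these are the elements of `𝒟(0)`. -/
structure RadialField where
  toFun : ℂ × ℂ → ℂ × ℂ
  analyticAt : AnalyticAt ℂ toFun 0
  map_zero : toFun 0 = 0
  hasFDerivAt : HasFDerivAt toFun (ContinuousLinearMap.id ℂ (ℂ × ℂ)) 0

/-- `Y` is a nonvanishing vector field generating, near the point `(0, t₀)` of chart `i`, the
blow-up of the foliation defined by `X`: some multiple of `Y` projects onto `X`. -/
def RadialField.IsLocalGenerator (X : RadialField) (i : Fin 2) (t₀ : ℂ)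
    (Y : ℂ × ℂ → ℂ × ℂ) : Prop :=
  AnalyticAt ℂ Y (0, t₀) ∧ Y (0, t₀) ≠ 0 ∧
    ∃ k : ℂ × ℂ → ℂ, AnalyticAt ℂ k (0, t₀) ∧
      ∀ᶠ q in 𝓝 ((0 : ℂ), t₀),
        fderiv ℂ (blowDown i) q (k q • Y q) = X.toFun (blowDown i q)

/-- The equation `ω(X)` of `Tang(F, G)`, where `ω` defines `F` and `X` defines `G`. -/
def FoliationGerm.tang (F : FoliationGerm) (X : RadialField) (p : ℂ × ℂ) : ℂ :=
  F.form p (X.toFun p)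

/-- A vector field `b ∂_x - a ∂_y` tangent to the foliation defined by `a dx + b dy`. -/
def FoliationGerm.tangentField (F : FoliationGerm) (p : ℂ × ℂ) : ℂ × ℂ :=
  (F.form p (0, 1), -F.form p (1, 0))

/-- The divisor `{g = 0}` is invariant by `F`: the derivative of `g` along `F` is divisible by `g`
in the ring of germs of holomorphic functions at `0`. -/
def FoliationGerm.IsInvariant (F : FoliationGerm) (g : ℂ × ℂ → ℂ) : Prop :=
  ∃ k : ℂ × ℂ → ℂ, AnalyticAt ℂ k 0 ∧
    ∀ᶠ p in 𝓝 (0 : ℂ × ℂ), fderiv ℂ g p (F.tangentField p) = k p * g p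

/-- `F` is homogeneous with respect to the radial foliation `G` defined by `X`: `Tang(F, G)` is a
curve (`F ≠ G`) and it is invariant by `F`. -/
def FoliationGerm.IsHomogeneousWrt (F : FoliationGerm) (X : RadialField) : Prop :=
  (¬ ∀ᶠ p in 𝓝 (0 : ℂ × ℂ), F.tang X p = 0) ∧ F.IsInvariant (F.tang X)

/-- The set `𝒟ʰ(n)` of homogeneous dicritical foliations of multiplicity `n + 1`. -/
def FoliationGerm.InDhn (F : FoliationGerm) (n : ℕ) : Prop :=
  F.InDn n ∧ ∃ X : RadialField, F.IsHomogeneousWrt X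

/-- The divisor `D` of `E` is `Tang(F, G)|_E`, where `X` defines `G`: its coefficient at each point
of `E` is the order of vanishing, at that point, of the restriction to `E` of the local equation
`η(Y)` of the tangency divisor of the two blown-up foliations. -/
def FoliationGerm.IsTangRestrict (F : FoliationGerm) (X : RadialField) (D : ExcDiv →₀ ℕ) : Prop :=
  ∀ (i : Fin 2) (t₀ : ℂ), ∃ η Y, F.IsLocalGenerator i t₀ η ∧ X.IsLocalGenerator i t₀ Y ∧
    analyticOrderAt (fun t : ℂ => η (0, t) (Y (0, t))) t₀ = (D (pt i t₀) : ℕ∞)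

/-- The set `divʰ(F)` of the divisors `Tang(F, G)|_E`, where `G` runs through the radial foliations
with respect to which `F` is homogeneous. -/
def FoliationGerm.divh (F : FoliationGerm) : Set (ExcDiv →₀ ℕ) :=
  {D | ∃ X : RadialField, F.IsHomogeneousWrt X ∧ F.IsTangRestrict X D}

/-- The push-forward `φ_* D` of a divisor of `E`. -/
def AutE.push (φ : AutE) (D : ExcDiv →₀ ℕ) : ExcDiv →₀ ℕ := D.mapDomain φ.toEquiv

end Dicritical

end

/-! Everything happens in the blow-up, near the exceptional divisor `E = {x = 0}`, where `t` is the
coordinate on the divisor and the lines through the origin are the fibres `t = const`.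

Necessity is functoriality. A germ of biholomorphism lifts to the blow-up
(`BiholGerm.exists_isLift`), and the lift carries generators, first integrals, radial fields and
tangency equations from one foliation to the other; hence holonomy, multiplicity and divisors
correspond. The one point that is not formal is that `div^h` is not empty, since the tangency
divisor may contain `E`. In that case the foliation is transverse to `E` everywhere, so it is itself
radial, and an explicit second radial field produces a divisor (`FoliationGerm.InD.divh_nonempty`).

Sufficiency. Poincaré linearization turns the two radial fields into the Euler field, and every
automorphism of `E` is induced by a linear map. So one may assume that `φ` is the identity and that
both foliations are homogeneous with respect to the pencil of lines through the origin. The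
conjugacy is then sought in the form `(x, t) ↦ (x ℓ(x, t), t)` with `ℓ` a unit, that is `p ↦ Λ(p) p`
downstairs.

Local existence (`exists_fiberMap_wedge_eq_zero`): it suffices to find first integrals `f₁`, `f₂`
that agree on `E` and have the same contact with the fibres, because `f₂(xℓ, t) = f₁(x, t)` is then
solved by the implicit function theorem (`exists_fibered_conjugacy`). At a tangency point with `E`
the foliations are transverse to the fibres, and equality of the holonomy germs makes the
restrictions to `E` of the first integrals functions of each other. At a point transverse to `E`,
first integrals are normalized by `z(0, t) = t`. Homogeneity forces the tangency curve with the
fibration through that point to be the fibre itself, so `z = t + x (t - t₀)^m v` with `v` a unit and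
`m` the coefficient of the common divisor.

Uniqueness (`eventually_eq_of_fiberMap_wedge_eq_zero`): near a generic point of `E` a normalized
first integral and `t` are coordinates, so `ℓ` is determined there, and the identity theorem spreads
this. The local solutions therefore agree and define `Λ` around all of `E`. By Hartogs' theorem `Λ`
extends to a unit at the origin, which gives the biholomorphism. -/

noncomputable section

namespace Dicritical

/-! ### Superposition operators on spaces of continuous functions -/

section Superposition

variable {K E F : Type*} [TopologicalSpace K] [CompactSpace K]
  [NormedAddCommGroup E] [NormedSpace ℂ E] [NormedAddCommGroup F] [NormedSpace ℂ F]

/-- A continuous multilinear map acts pointwise on continuous functions. -/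
def pointwiseMultilinear (K : Type*) [TopologicalSpace K] [CompactSpace K] {n : ℕ}
    (p : ContinuousMultilinearMap ℂ (fun _ : Fin n => E) F) :
    ContinuousMultilinearMap ℂ (fun _ : Fin n => C(K, E)) C(K, F) :=
  MultilinearMap.mkContinuous
    { toFun := fun m => ⟨fun k => p fun i => m i k, by fun_prop⟩
      map_update_add' := by
        intro _ m i x y
        ext k
        have h : ∀ z : C(K, E), (fun j => Function.update m i z j k)
            = Function.update (fun j => m j k) i (z k) := by
          intro z; ext j
          by_cases hj : j = i
          · subst hj; simp
          · simp [hj]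
        simp only [ContinuousMap.coe_mk, ContinuousMap.add_apply, h]
        convert p.map_update_add (fun j => m j k) i (x k) (y k)
      map_update_smul' := by
        intro _ m i c x
        ext k
        have h : ∀ z : C(K, E), (fun j => Function.update m i z j k)
            = Function.update (fun j => m j k) i (z k) := by
          intro z; ext j
          by_cases hj : j = i
          · subst hj; simp
          · simp [hj]
        simp only [ContinuousMap.coe_mk, ContinuousMap.smul_apply, h]
        convert p.map_update_smul (fun j => m j k) i c (x k) }
    ‖p‖ (by
      intro m
      refine (ContinuousMap.norm_le _ (by positivity)).2 fun k => ?_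
      refine (p.le_opNorm _).trans ?_
      gcongr with i
      exact (m i).norm_coe_le_norm k)

open Classical in
/-- The superposition operator `γ ↦ f ∘ γ`. -/
def superposition (K : Type*) [TopologicalSpace K] (f : E → F) (γ : C(K, E)) : C(K, F) :=
  if h : Continuous (f ∘ γ) then ⟨f ∘ γ, h⟩ else 0

/-- The Taylor coefficients of `f` at `e`, acting pointwise, have norms bounded by the original
ones, so the operator series converges on a ball of the same radius. Evaluation at a point is
continuous and linear and identifies the sum with `f ∘ γ`. In particular `f ∘ γ` is continuous for
`γ` near the constant, so the default value `0` in `superposition` plays no role there. -/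
theorem analyticAt_superposition [CompleteSpace F] {f : E → F} {e : E} (hf : AnalyticAt ℂ f e) :
    AnalyticAt ℂ (superposition K f) (ContinuousMap.const K e) ∧
      ∀ᶠ γ in 𝓝 (ContinuousMap.const K e), ∀ k, superposition K f γ k = f (γ k) := by
  obtain ⟨p, r, hp⟩ := hf
  set P : FormalMultilinearSeries ℂ C(K, E) C(K, F) := fun n => pointwiseMultilinear K (p n)
  have hP : ∀ n, ‖P n‖ ≤ ‖p n‖ := fun n => MultilinearMap.mkContinuous_norm_le _ (norm_nonneg _) _
  have hr : r ≤ P.radius := by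
    refine hp.r_le.trans ?_
    refine ENNReal.le_of_forall_nnreal_lt fun s hs => ?_
    obtain ⟨C, -, hC⟩ := p.norm_mul_pow_le_of_lt_radius hs
    refine P.le_radius_of_bound C fun n => le_trans ?_ (hC n)
    gcongr
    exact hP n
  have key : ∀ y ∈ Metric.eball (0 : C(K, E)) r,
      HasSum (fun n => P n fun _ => y) (superposition K f (ContinuousMap.const K e + y)) ∧
      ∀ k, superposition K f (ContinuousMap.const K e + y) k = f (e + y k) := by
    intro y hy
    have hs : Summable fun n => P n fun _ => y :=
      (P.summable_norm_apply (Metric.eball_subset_eball hr hy)).of_norm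
    obtain ⟨S, hS⟩ := hs
    have hSk : ∀ k, S k = f (e + y k) := by
      intro k
      have h1 : HasSum (fun n => p n fun _ => y k) (S k) :=
        hS.mapL (ContinuousMap.evalCLM ℂ k : C(K, F) →L[ℂ] F)
      have hyk : y k ∈ Metric.eball (0 : E) r := by
        rw [Metric.mem_eball, edist_zero_right] at hy ⊢
        refine lt_of_le_of_lt ?_ hy
        exact enorm_le_iff_norm_le.2 (y.norm_coe_le_norm k)
      exact h1.unique (hp.hasSum hyk)
    have hc : f ∘ (ContinuousMap.const K e + y) = S := by
      ext k; simp [hSk]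
    have : superposition K f (ContinuousMap.const K e + y) = S := by
      unfold superposition
      have h2 : Continuous (f ∘ (ContinuousMap.const K e + y)) := by rw [hc]; exact S.continuous
      rw [dif_pos h2]
      ext k; simp [hSk]
    rw [this]
    exact ⟨hS, hSk⟩
  refine ⟨⟨P, r, hr, hp.r_pos, fun hy => (key _ hy).1⟩, ?_⟩
  filter_upwards [Metric.eball_mem_nhds _ hp.r_pos] with γ hγ k
  have := (key (γ - ContinuousMap.const K e) (by
    rw [Metric.mem_eball, edist_zero_right]
    rwa [Metric.mem_eball, edist_eq_enorm_sub] at hγ)).2 k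
  simpa using this

end Superposition

/-! ### Integrals along segments: analytic dependence, Taylor and Hadamard formulas -/

theorem continuous_comp_projIcc {G : Type*} [TopologicalSpace G] (γ : C(unitInterval, G)) :
    Continuous fun σ : ℝ => γ (Set.projIcc 0 1 zero_le_one σ) :=
  γ.continuous.comp continuous_projIcc

section Integral

variable {V E F : Type*} [NormedAddCommGroup V] [NormedSpace ℂ V]
  [NormedAddCommGroup E] [NormedSpace ℂ E] [NormedAddCommGroup F] [NormedSpace ℂ F]

theorem norm_integral_projIcc_le (γ : C(unitInterval, F)) (s : unitInterval) :
    ‖∫ σ in (0 : ℝ)..s, γ (Set.projIcc 0 1 zero_le_one σ)‖ ≤ ‖γ‖ := by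
  refine (intervalIntegral.norm_integral_le_of_norm_le_const (C := ‖γ‖)
    fun σ _ => γ.norm_coe_le_norm _).trans ?_
  have h0 := s.2.1
  have h1 := s.2.2
  rw [sub_zero, abs_of_nonneg h0]
  exact mul_le_of_le_one_right (norm_nonneg _) h1

/-- The primitive vanishing at `0`, as an operator on `C([0, 1], F)`. -/
def volterra (F : Type*) [NormedAddCommGroup F] [NormedSpace ℂ F] :
    C(unitInterval, F) →L[ℂ] C(unitInterval, F) :=
  LinearMap.mkContinuous
    { toFun := fun γ => ⟨fun s => ∫ σ in (0 : ℝ)..s, γ (Set.projIcc 0 1 zero_le_one σ),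
        (intervalIntegral.continuous_primitive
          (fun _ _ => (continuous_comp_projIcc γ).intervalIntegrable _ _) 0).comp
            continuous_subtype_val⟩
      map_add' := by
        intro x y
        ext s
        exact intervalIntegral.integral_add
          ((continuous_comp_projIcc x).intervalIntegrable _ _)
          ((continuous_comp_projIcc y).intervalIntegrable _ _)
      map_smul' := by
        intro c x
        ext s
        exact intervalIntegral.integral_smul c _ }
    1 (by
      intro γ
      rw [one_mul]
      exact (ContinuousMap.norm_le _ (norm_nonneg _)).2 fun s => norm_integral_projIcc_le γ s)

theorem volterra_apply (γ : C(unitInterval, F)) (s : unitInterval) :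
    volterra F γ s = ∫ σ in (0 : ℝ)..s, γ (Set.projIcc 0 1 zero_le_one σ) := rfl

/-- `v ↦ (s ↦ T₀ v + s T₁ v)` as an operator into `C([0, 1], E)`. -/
def segmentCLM (T₀ T₁ : V →L[ℂ] E) : V →L[ℂ] C(unitInterval, E) :=
  LinearMap.mkContinuous
    { toFun := fun v => ⟨fun s => T₀ v + ((s : ℝ) : ℂ) • T₁ v, by fun_prop⟩
      map_add' := by intro x y; ext s; simp; abel
      map_smul' := by
        intro c x
        ext s
        simp only [map_smul, ContinuousMap.coe_mk, ContinuousMap.smul_apply, smul_add,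
          RingHom.id_apply]
        rw [smul_comm] }
    (‖T₀‖ + ‖T₁‖) (by
      intro v
      refine (ContinuousMap.norm_le _ (by positivity)).2 fun s => ?_
      refine (norm_add_le _ _).trans ?_
      rw [add_mul]
      refine add_le_add (T₀.le_opNorm v) ?_
      rw [norm_smul, Complex.norm_real, Real.norm_of_nonneg s.2.1]
      exact (mul_le_of_le_one_left (norm_nonneg _) s.2.2).trans (T₁.le_opNorm v))

theorem segmentCLM_apply (T₀ T₁ : V →L[ℂ] E) (v : V) (s : unitInterval) :
    segmentCLM T₀ T₁ v s = T₀ v + ((s : ℝ) : ℂ) • T₁ v := rfl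

/-- The map is a composition of analytic maps: the linear map sending `v` to its segment,
superposition with `g`, the primitive, and evaluation at `1`. Since `T₁ v₀ = 0` the segment at `v₀`
is constant, so analyticity of `g` at the single point `T₀ v₀` is enough. -/
theorem analyticAt_integral_segment [CompleteSpace F] {g : E → F} (T₀ T₁ : V →L[ℂ] E) {v₀ : V}
    (h₁ : T₁ v₀ = 0) (hg : AnalyticAt ℂ g (T₀ v₀)) :
    AnalyticAt ℂ (fun v => ∫ s in (0 : ℝ)..1, g (T₀ v + (s : ℂ) • T₁ v)) v₀ := by
  have hbase : segmentCLM T₀ T₁ v₀ = ContinuousMap.const unitInterval (T₀ v₀) := by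
    ext s; simp [segmentCLM_apply, h₁]
  obtain ⟨ha, hev⟩ := analyticAt_superposition (K := unitInterval) hg
  rw [← hbase] at ha hev
  have hc := (segmentCLM T₀ T₁).analyticAt v₀
  have h2 : AnalyticAt ℂ (fun v => (ContinuousMap.evalCLM ℂ (1 : unitInterval) :
      C(unitInterval, F) →L[ℂ] F) (volterra F (superposition unitInterval g
        (segmentCLM T₀ T₁ v)))) v₀ := by
    refine (ContinuousLinearMap.analyticAt _ _).comp ?_
    refine (ContinuousLinearMap.analyticAt _ _).comp ?_
    exact ha.comp hc
  refine h2.congr ?_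
  filter_upwards [(segmentCLM T₀ T₁).continuous.continuousAt.eventually hev] with v hv
  change volterra F _ 1 = _
  rw [volterra_apply]
  refine intervalIntegral.integral_congr fun s hs => ?_
  rw [Set.Icc.coe_one, Set.uIcc_of_le zero_le_one] at hs
  simp only [hv, segmentCLM_apply, Set.projIcc_of_mem zero_le_one hs]

/-- Taylor's formula of order one along segments. -/
theorem eventually_sub_eq_integral_segment [CompleteSpace F] {f : E → F} (T₀ T₁ : V →L[ℂ] E)
    {v₀ : V} (h₁ : T₁ v₀ = 0) (hf : AnalyticAt ℂ f (T₀ v₀)) :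
    ∀ᶠ v in 𝓝 v₀, f (T₀ v + T₁ v) - f (T₀ v) =
      (∫ s in (0 : ℝ)..1, fderiv ℂ f (T₀ v + (s : ℂ) • T₁ v)) (T₁ v) := by
  have hbase : segmentCLM T₀ T₁ v₀ = ContinuousMap.const unitInterval (T₀ v₀) := by
    ext s; simp [segmentCLM_apply, h₁]
  obtain ⟨r, hr, hball⟩ := Metric.eventually_nhds_iff_ball.1 hf.eventually_analyticAt
  have hnear : ∀ᶠ v in 𝓝 v₀, segmentCLM T₀ T₁ v ∈ Metric.ball (segmentCLM T₀ T₁ v₀) r :=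
    (segmentCLM T₀ T₁).continuous.continuousAt.eventually (Metric.ball_mem_nhds _ hr)
  filter_upwards [hnear] with v hv
  have han : ∀ s ∈ Set.Icc (0 : ℝ) 1, AnalyticAt ℂ f (T₀ v + (s : ℂ) • T₁ v) := by
    intro s hs
    apply hball
    rw [hbase] at hv
    exact lt_of_le_of_lt (ContinuousMap.dist_apply_le_dist (⟨s, hs⟩ : unitInterval)) hv
  have hpath : ∀ s : ℝ, HasDerivAt (fun s : ℝ => T₀ v + (s : ℂ) • T₁ v) (T₁ v) s := by
    intro s
    have := (Complex.ofRealCLM.hasDerivAt (x := s)).smul_const (T₁ v)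
    simpa using this.const_add (T₀ v)
  have hcont : ContinuousOn (fun s : ℝ => fderiv ℂ f (T₀ v + (s : ℂ) • T₁ v)) (Set.Icc 0 1) := by
    intro s hs
    exact (ContinuousAt.comp (f := fun s : ℝ => T₀ v + (s : ℂ) • T₁ v)
      (han s hs).fderiv.continuousAt (hpath s).continuousAt).continuousWithinAt
  have hint : IntervalIntegrable (fun s : ℝ => fderiv ℂ f (T₀ v + (s : ℂ) • T₁ v))
      MeasureTheory.volume 0 1 := by
    apply ContinuousOn.intervalIntegrable
    rwa [Set.uIcc_of_le zero_le_one]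
  have hd : ∀ s ∈ Set.uIcc (0 : ℝ) 1, HasDerivAt (fun s : ℝ => f (T₀ v + (s : ℂ) • T₁ v))
      (fderiv ℂ f (T₀ v + (s : ℂ) • T₁ v) (T₁ v)) s := by
    intro s hs
    rw [Set.uIcc_of_le zero_le_one] at hs
    have h1 := (han s hs).differentiableAt.hasFDerivAt.restrictScalars ℝ
    exact h1.comp_hasDerivAt s (hpath s)
  have := intervalIntegral.integral_eq_sub_of_hasDerivAt hd (by
    apply ContinuousOn.intervalIntegrable
    rw [Set.uIcc_of_le zero_le_one]
    exact hcont.clm_apply continuousOn_const)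
  rw [ContinuousLinearMap.intervalIntegral_apply hint, this]
  simp

/-- Hadamard's lemma. -/
theorem exists_hadamard [CompleteSpace F] {f : E → F} (hf : AnalyticAt ℂ f 0) :
    ∃ L : E → E →L[ℂ] F, AnalyticAt ℂ L 0 ∧ L 0 = fderiv ℂ f 0 ∧
      ∀ᶠ v in 𝓝 0, f v = f 0 + L v v := by
  refine ⟨fun v => ∫ s in (0 : ℝ)..1, fderiv ℂ f ((0 : E →L[ℂ] E) v +
    (s : ℂ) • (ContinuousLinearMap.id ℂ E) v), ?_, ?_, ?_⟩
  · refine analyticAt_integral_segment _ _ (by simp) ?_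
    simpa using hf.fderiv
  · simp
  · filter_upwards [eventually_sub_eq_integral_segment (0 : E →L[ℂ] E)
      (ContinuousLinearMap.id ℂ E) (v₀ := 0) (by simp) (by simpa using hf)] with v hv
    rw [ContinuousLinearMap.id_apply] at hv
    simp only [ContinuousLinearMap.id_apply]
    rw [← hv]; simp

/-- An analytic function vanishing on the hypersurface `x = 0` is divisible by `x`. -/
theorem exists_eq_smul_of_eq_zero [CompleteSpace F] {f : ℂ × E → F} {e : E}
    (hf : AnalyticAt ℂ f (0, e)) (h0 : ∀ᶠ t in 𝓝 e, f (0, t) = 0) :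
    ∃ f₁ : ℂ × E → F, AnalyticAt ℂ f₁ (0, e) ∧ (∀ᶠ q in 𝓝 ((0 : ℂ), e), f q = q.1 • f₁ q) ∧
      f₁ (0, e) = fderiv ℂ f (0, e) (1, 0) := by
  set T₀ : ℂ × E →L[ℂ] ℂ × E := (ContinuousLinearMap.inr ℂ ℂ E).comp (ContinuousLinearMap.snd ℂ ℂ E)
  set T₁ : ℂ × E →L[ℂ] ℂ × E := (ContinuousLinearMap.inl ℂ ℂ E).comp (ContinuousLinearMap.fst ℂ ℂ E)
  refine ⟨fun v => (∫ s in (0 : ℝ)..1, fderiv ℂ f (T₀ v + (s : ℂ) • T₁ v)) (1, 0), ?_, ?_, ?_⟩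
  · have := analyticAt_integral_segment (g := fderiv ℂ f) T₀ T₁ (v₀ := (0, e)) (by simp [T₁])
      (by simpa [T₀] using hf.fderiv)
    exact ((ContinuousLinearMap.apply ℂ F ((1 : ℂ), (0 : E))).analyticAt _).comp this
  · have h0' : ∀ᶠ q : ℂ × E in 𝓝 (0, e), f (0, q.2) = 0 :=
      (continuous_snd.tendsto ((0 : ℂ), e)).eventually h0
    filter_upwards [eventually_sub_eq_integral_segment T₀ T₁ (v₀ := (0, e)) (by simp [T₁])
      (by simpa [T₀] using hf), h0'] with q hq hq0
    have e1 : T₀ q + T₁ q = q := by simp [T₀, T₁]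
    have e2 : T₀ q = (0, q.2) := by simp [T₀]
    have e3 : T₁ q = q.1 • ((1 : ℂ), (0 : E)) := by simp [T₁]
    rw [e1] at hq
    rw [← map_smul, ← e3, ← hq, e2, hq0, sub_zero]
  · simp [T₀, T₁]

end Integral

/-! ### Normal form of vector fields homogeneous under dilations -/

section Straightening

variable {E : Type*} [NormedAddCommGroup E] [NormedSpace ℂ E]

/-- For an idempotent `Λ`, the operator `s ^ Λ`. -/
def dilation (Λ : E →L[ℂ] E) (s : ℂ) : E →L[ℂ] E := ContinuousLinearMap.id ℂ E + (s - 1) • Λ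

theorem dilation_apply (Λ : E →L[ℂ] E) (s : ℂ) (v : E) : dilation Λ s v = v + (s - 1) • Λ v := rfl

theorem dilation_dilation {Λ : E →L[ℂ] E} (hΛ : ∀ v, Λ (Λ v) = Λ v) (s s' : ℂ) (v : E) :
    dilation Λ s (dilation Λ s' v) = dilation Λ (s * s') v := by
  simp only [dilation_apply, map_add, map_smul, hΛ]
  module

theorem norm_dilation_apply_le (Λ : E →L[ℂ] E) (s : unitInterval) (v : E) :
    ‖dilation Λ ((s : ℝ) : ℂ) v‖ ≤ (1 + ‖Λ‖) * ‖v‖ := by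
  rw [dilation_apply, add_mul, one_mul]
  refine (norm_add_le _ _).trans (add_le_add le_rfl ?_)
  rw [norm_smul]
  refine (mul_le_of_le_one_left (norm_nonneg _) ?_).trans (Λ.le_opNorm v)
  rw [← Complex.ofReal_one, ← Complex.ofReal_sub, Complex.norm_real, Real.norm_eq_abs, abs_le]
  constructor <;> linarith [s.2.1, s.2.2]

/-- `γ ↦ (s ↦ (s ^ Λ γ(s), γ(s)))`. -/
def dilationPair (Λ : E →L[ℂ] E) : C(unitInterval, E) →L[ℂ] C(unitInterval, E × E) :=
  LinearMap.mkContinuous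
    { toFun := fun γ => ⟨fun s => (γ s + (((s : ℝ) : ℂ) - 1) • Λ (γ s), γ s), by fun_prop⟩
      map_add' := by
        intro x y
        ext s
        · simp only [ContinuousMap.coe_mk, ContinuousMap.add_apply, map_add, Prod.fst_add]; module
        · simp
      map_smul' := by
        intro c x
        ext s
        · simp only [ContinuousMap.coe_mk, ContinuousMap.smul_apply, map_smul, Prod.smul_fst,
            RingHom.id_apply]
          module
        · simp }
    (1 + ‖Λ‖) (by
      intro γ
      refine (ContinuousMap.norm_le _ (by positivity)).2 fun s => ?_
      refine max_le ?_ ?_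
      · refine (norm_dilation_apply_le Λ s (γ s)).trans ?_
        gcongr
        exact γ.norm_coe_le_norm s
      · refine (γ.norm_coe_le_norm s).trans ?_
        nlinarith [norm_nonneg Λ, norm_nonneg γ])

theorem dilationPair_apply (Λ : E →L[ℂ] E) (γ : C(unitInterval, E)) (s : unitInterval) :
    dilationPair Λ γ s = (dilation Λ ((s : ℝ) : ℂ) (γ s), γ s) := rfl

/-- The bound `‖q(v)‖ ≤ c ‖v‖` near `0` holds at every `γ k` at once, since `‖γ k‖ ≤ ‖γ‖`. -/
theorem hasFDerivAt_superposition_zero {K E F : Type*} [TopologicalSpace K] [CompactSpace K]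
    [NormedAddCommGroup E] [NormedSpace ℂ E] [NormedAddCommGroup F] [NormedSpace ℂ F]
    [CompleteSpace F] {q : E → F} (hq : AnalyticAt ℂ q 0) (h0 : q 0 = 0)
    (h1 : fderiv ℂ q 0 = 0) :
    HasFDerivAt (superposition K q) (0 : C(K, E) →L[ℂ] C(K, F)) 0 := by
  have hev := (analyticAt_superposition (K := K) hq).2
  have hc : ContinuousMap.const K (0 : E) = 0 := rfl
  rw [hc] at hev
  have hz : superposition K q 0 = 0 := by
    ext k; rw [hev.self_of_nhds k]; simpa using h0
  rw [hasFDerivAt_iff_isLittleO_nhds_zero, Asymptotics.isLittleO_iff]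
  intro c hc
  have hd := hq.differentiableAt.hasFDerivAt
  rw [h1, hasFDerivAt_iff_isLittleO_nhds_zero, Asymptotics.isLittleO_iff] at hd
  obtain ⟨δ, hδ, hball⟩ := Metric.eventually_nhds_iff_ball.1 (hd hc)
  filter_upwards [hev, Metric.ball_mem_nhds _ hδ] with γ hγ hγδ
  simp only [zero_add, hz, sub_zero, zero_apply]
  refine (ContinuousMap.norm_le _ (by positivity)).2 fun k => ?_
  rw [hγ k]
  have hk : γ k ∈ Metric.ball (0 : E) δ := by
    rw [mem_ball_zero_iff] at hγδ ⊢
    exact (γ.norm_coe_le_norm k).trans_lt hγδ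
  have := hball _ hk
  simp only [zero_add, h0, sub_zero, zero_apply] at this
  refine this.trans ?_
  gcongr
  exact γ.norm_coe_le_norm k

/-- The curve solving the integral equation `γ(s) = p + ∫₀ˢ q(σ ^ Λ γ(σ), γ(σ)) dσ`. -/
theorem exists_analytic_integral_curve [CompleteSpace E] (Λ : E →L[ℂ] E) {q : E × E → E}
    (hq : AnalyticAt ℂ q 0) (h0 : q 0 = 0) (h1 : fderiv ℂ q 0 = 0) :
    ∃ G : E → C(unitInterval, E), AnalyticAt ℂ G 0 ∧ G 0 = 0 ∧
      (∀ᶠ z : E × C(unitInterval, E) in 𝓝 0,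
        ((∀ s, z.2 s = z.1 + ∫ σ in (0 : ℝ)..s, q (dilationPair Λ z.2
          (Set.projIcc 0 1 zero_le_one σ))) ↔ G z.1 = z.2)) ∧
      HasFDerivAt (fun p => G p 1) (ContinuousLinearMap.id ℂ E) 0 := by
  set N : C(unitInterval, E) → C(unitInterval, E) := fun γ => superposition unitInterval q (dilationPair Λ γ)
  have hconst : ContinuousMap.const unitInterval (0 : E × E) = 0 := rfl
  obtain ⟨hsa, hsev⟩ := analyticAt_superposition (K := unitInterval) hq
  rw [hconst] at hsa hsev
  have hpair0 : dilationPair Λ 0 = 0 := map_zero _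
  have hNa : AnalyticAt ℂ N 0 := by
    refine AnalyticAt.comp (g := superposition unitInterval q) ?_ ((dilationPair Λ).analyticAt 0)
    rw [hpair0]; exact hsa
  have hNev : ∀ᶠ γ in 𝓝 (0 : C(unitInterval, E)), ∀ s, N γ s = q (dilationPair Λ γ s) := by
    have : Tendsto (dilationPair Λ) (𝓝 0) (𝓝 0) := by
      simpa using (dilationPair Λ).continuous.tendsto 0
    exact this.eventually hsev
  have hN0 : N 0 = 0 := by
    ext s
    have := hNev.self_of_nhds s
    rw [this, hpair0]
    exact h0
  have hNd : HasFDerivAt N (0 : C(unitInterval, E) →L[ℂ] C(unitInterval, E)) 0 := by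
    have := hasFDerivAt_superposition_zero (K := unitInterval) hq h0 h1
    rw [← hpair0] at this
    have h2 := HasFDerivAt.comp (g := superposition unitInterval q) 0 this
      (dilationPair Λ).hasFDerivAt
    rw [ContinuousLinearMap.zero_comp] at h2
    exact h2
  -- The integral equation is `Ψ (p, γ) = 0`. As `q` has no linear part, the partial derivative of
  -- `Ψ` in `γ` at the origin is the identity, and the implicit function theorem provides `G`.
  set Ψ : E × C(unitInterval, E) → C(unitInterval, E) := fun z => z.2 - segmentCLM (ContinuousLinearMap.id ℂ E) 0 z.1
    - volterra E (N z.2)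
  have hΨa : AnalyticAt ℂ Ψ 0 := by
    refine (analyticAt_snd.sub ((ContinuousLinearMap.analyticAt
      (segmentCLM (ContinuousLinearMap.id ℂ E) (0 : E →L[ℂ] E)) _).comp analyticAt_fst)).sub ?_
    exact ((volterra E).analyticAt _).comp (AnalyticAt.comp (g := N) hNa analyticAt_snd)
  have hΨd : HasFDerivAt Ψ (ContinuousLinearMap.snd ℂ E C(unitInterval, E) -
      (segmentCLM (ContinuousLinearMap.id ℂ E) 0).comp (ContinuousLinearMap.fst ℂ E C(unitInterval, E))) 0 := by
    have e1 : HasFDerivAt (fun z : E × C(unitInterval, E) => volterra E (N z.2)) (0 : E × C(unitInterval, E) →L[ℂ] C(unitInterval, E)) 0 := by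
      have := ((volterra E).hasFDerivAt).comp (0 : E × C(unitInterval, E))
        (HasFDerivAt.comp (g := N) (0 : E × C(unitInterval, E)) hNd hasFDerivAt_snd)
      rw [ContinuousLinearMap.zero_comp, ContinuousLinearMap.comp_zero] at this
      exact this
    have e2 := (hasFDerivAt_snd (𝕜 := ℂ) (p := (0 : E × C(unitInterval, E)))).sub
      (((segmentCLM (ContinuousLinearMap.id ℂ E) 0).hasFDerivAt).comp (0 : E × C(unitInterval, E))
      (hasFDerivAt_fst (𝕜 := ℂ)))
    have := e2.sub e1
    rw [sub_zero] at this
    exact this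
  have hcd : ContDiffAt ℂ ⊤ Ψ ((0 : E), (0 : C(unitInterval, E))) := hΨa.contDiffAt
  have hinv : (fderiv ℂ Ψ ((0 : E), (0 : C(unitInterval, E))) ∘L .inr ℂ E C(unitInterval, E)).IsInvertible := by
    have : fderiv ℂ Ψ ((0 : E), (0 : C(unitInterval, E))) ∘L .inr ℂ E C(unitInterval, E) = ContinuousLinearMap.id ℂ C(unitInterval, E) := by
      have h := hΨd.fderiv
      rw [Prod.zero_eq_mk] at h
      rw [h]
      ext γ s
      simp
    rw [this]
    exact ⟨ContinuousLinearEquiv.refl ℂ C(unitInterval, E), rfl⟩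
  have hne : (⊤ : WithTop ℕ∞) ≠ 0 := by simp
  have hΨ0 : Ψ (0, 0) = 0 := by
    simp [Ψ, hN0]
  set G := hcd.implicitFunction hne hinv
  have hG0 : G 0 = 0 := hcd.implicitFunction_apply_self hne hinv
  have hGa : AnalyticAt ℂ G 0 := (hcd.contDiffAt_implicitFunction hne hinv).analyticAt
  have hiff := hcd.eventually_apply_eq_iff_implicitFunction hne hinv
  rw [hΨ0] at hiff
  have hNev' : ∀ᶠ z : E × C(unitInterval, E) in 𝓝 0, ∀ s, N z.2 s = q (dilationPair Λ z.2 s) :=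
    (continuous_snd.tendsto (0 : E × C(unitInterval, E))).eventually hNev
  have hmain : ∀ᶠ z : E × C(unitInterval, E) in 𝓝 0,
        ((∀ s, z.2 s = z.1 + ∫ σ in (0 : ℝ)..s, q (dilationPair Λ z.2
          (Set.projIcc 0 1 zero_le_one σ))) ↔ G z.1 = z.2) := by
    rw [Prod.zero_eq_mk]
    rw [Prod.zero_eq_mk] at hNev'
    filter_upwards [hiff, hNev'] with z hz hN
    rw [← hz, ContinuousMap.ext_iff]
    refine forall_congr' fun s => ?_
    have : Ψ z s = z.2 s - z.1 - ∫ σ in (0 : ℝ)..s, q (dilationPair Λ z.2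
          (Set.projIcc 0 1 zero_le_one σ)) := by
      simp only [Ψ, ContinuousMap.sub_apply, segmentCLM_apply, volterra_apply, hN]
      simp
    rw [this, ContinuousMap.zero_apply, sub_sub, sub_eq_zero]
  refine ⟨G, hGa, hG0, hmain, ?_⟩
  have hev : ∀ᶠ p in 𝓝 (0 : E), Ψ (p, G p) = 0 := by
    have := hcd.eventually_apply_implicitFunction hne hinv
    rwa [hΨ0] at this
  -- The integral term has zero derivative at `0`, so the endpoint map `p ↦ G p 1` is tangent to the
  -- identity.
  have hNG : HasFDerivAt (fun p => volterra E (N (G p))) (0 : E →L[ℂ] C(unitInterval, E)) 0 := by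
    have h2 : HasFDerivAt N (0 : C(unitInterval, E) →L[ℂ] C(unitInterval, E)) (G 0) := by rw [hG0]; exact hNd
    have := ((volterra E).hasFDerivAt).comp (0 : E)
        (HasFDerivAt.comp (g := N) (0 : E) h2 hGa.differentiableAt.hasFDerivAt)
    rw [ContinuousLinearMap.zero_comp, ContinuousLinearMap.comp_zero] at this
    exact this
  have hNG1 := ((ContinuousMap.evalCLM ℂ (1 : unitInterval) : C(unitInterval, E) →L[ℂ] E).hasFDerivAt).comp
    (0 : E) hNG
  have hsum := (hasFDerivAt_id (𝕜 := ℂ) (0 : E)).add hNG1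
  rw [ContinuousLinearMap.comp_zero, add_zero] at hsum
  refine hsum.congr_of_eventuallyEq ?_
  filter_upwards [hev] with p hp
  have := congrArg (fun γ : C(unitInterval, E) => γ 1) hp
  simp only [Ψ, ContinuousMap.sub_apply, ContinuousMap.zero_apply,
    sub_sub, sub_eq_zero, ContinuousMap.add_apply] at this
  rw [segmentCLM_apply] at this
  simpa using this

/-- Normal form of the vector field `Λ + q` when `q` is homogeneous under the dilations `s ^ Λ`:
an analytic change of coordinates tangent to the identity sends `Λ` to it. -/
theorem exists_straightening [CompleteSpace E] {Λ : E →L[ℂ] E} (hΛ : ∀ v, Λ (Λ v) = Λ v)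
    {q : E × E → E} (hq : AnalyticAt ℂ q 0) (h0 : q 0 = 0) (h1 : fderiv ℂ q 0 = 0)
    (hom : ∀ (s : ℂ) (w v : E), q (w, dilation Λ s v) = s • dilation Λ s (q (w, v))) :
    ∃ χ : E → E, AnalyticAt ℂ χ 0 ∧ χ 0 = 0 ∧
      HasFDerivAt χ (ContinuousLinearMap.id ℂ E) 0 ∧
      (∀ᶠ p in 𝓝 0, fderiv ℂ χ p (Λ p) = Λ (χ p) + q (χ p, χ p)) ∧
      ∀ᶠ p in 𝓝 0, Λ p = 0 → χ p = p := by
  obtain ⟨G, hGa, hG0, hG, hGd⟩ := exists_analytic_integral_curve Λ hq h0 h1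
  have hχa : AnalyticAt ℂ (fun p => G p 1) 0 :=
    (ContinuousLinearMap.analyticAt (ContinuousMap.evalCLM ℂ (1 : unitInterval) :
      C(unitInterval, E) →L[ℂ] E) _).comp hGa
  refine ⟨fun p => G p 1, hχa, by simp [hG0], hGd, ?_, ?_⟩
  · obtain ⟨ε, hε, hball⟩ := Metric.eventually_nhds_iff_ball.1 hG
    obtain ⟨δ, hδ, hqball⟩ := Metric.eventually_nhds_iff_ball.1 hq.eventually_analyticAt
    have hmem : ∀ (p : E) (γ : C(unitInterval, E)), ‖p‖ < ε → ‖γ‖ < ε →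
        (p, γ) ∈ Metric.ball (0 : E × C(unitInterval, E)) ε := by
      intro p γ hp hγ
      rw [mem_ball_zero_iff, Prod.norm_def]
      exact max_lt hp hγ
    set M := 1 + ‖Λ‖
    have hM : 1 ≤ M := by simp [M]
    have hMpos : 0 < M := by linarith
    have hGsmall : ∀ᶠ p in 𝓝 (0 : E), ‖G p‖ < min ε δ / M := by
      have : Tendsto (fun p => ‖G p‖) (𝓝 0) (𝓝 0) := by
        simpa [hG0] using hGa.continuousAt.norm.tendsto
      exact this.eventually (gt_mem_nhds (by positivity))
    have hpsmall : ∀ᶠ p in 𝓝 (0 : E), ‖p‖ < ε / M := by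
      have : Tendsto (fun p : E => ‖p‖) (𝓝 0) (𝓝 0) := by
        simpa using continuous_norm.tendsto (0 : E)
      exact this.eventually (gt_mem_nhds (by positivity))
    filter_upwards [hGsmall, hpsmall, hχa.eventually_analyticAt] with p hGp hp hχp
    have hGpε : M * ‖G p‖ < ε := by
      have := (lt_div_iff₀ hMpos).1 (hGp.trans_le (div_le_div_of_nonneg_right (min_le_left _ _) hMpos.le))
      linarith
    have hGpδ : M * ‖G p‖ < δ := by
      have := (lt_div_iff₀ hMpos).1 (hGp.trans_le (div_le_div_of_nonneg_right (min_le_right _ _) hMpos.le))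
      linarith
    have hpε : M * ‖p‖ < ε := by
      have := (lt_div_iff₀ hMpos).1 hp
      linarith
    have hGp' : ‖G p‖ < ε := by nlinarith [norm_nonneg (G p)]
    have hp' : ‖p‖ < ε := by nlinarith [norm_nonneg p]
    set γ := G p
    set r : ℝ → E := fun σ => q (dilationPair Λ γ (Set.projIcc 0 1 zero_le_one σ))
    have hγ : ∀ s : unitInterval, γ s = p + ∫ σ in (0 : ℝ)..s, r σ :=
      (hball (p, γ) (hmem _ _ hp' hGp')).2 rfl
    have hrc : Continuous r := by
      rw [continuous_iff_continuousAt]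
      intro σ
      have hc : Continuous fun σ : ℝ => dilationPair Λ γ (Set.projIcc 0 1 zero_le_one σ) :=
        continuous_comp_projIcc _
      refine ContinuousAt.comp (f := fun σ : ℝ => dilationPair Λ γ
        (Set.projIcc 0 1 zero_le_one σ)) (hqball _ ?_).continuousAt hc.continuousAt
      rw [mem_ball_zero_iff, dilationPair_apply, Prod.norm_def]
      have h2 : ‖γ (Set.projIcc 0 1 zero_le_one σ)‖ ≤ ‖γ‖ := γ.norm_coe_le_norm _
      refine max_lt ((norm_dilation_apply_le _ _ _).trans_lt ?_) ?_
      · exact (mul_le_mul_of_nonneg_left h2 hMpos.le).trans_lt hGpδ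
      · nlinarith [norm_nonneg γ]
    -- By the homogeneity of `q`, the curve `s' ↦ s^Λ γ(s s')` solves the integral equation with
    -- initial point `s^Λ p`. Uniqueness gives `χ(s^Λ p) = s^Λ γ(s)`; the derivative of this
    -- identity at `s = 1` is the claim.
    have hscale : ∀ s : unitInterval, G (dilation Λ ((s : ℝ) : ℂ) p) 1
        = dilation Λ ((s : ℝ) : ℂ) (γ s) := by
      intro s
      set β : C(unitInterval, E) := ⟨fun s' => dilation Λ ((s : ℝ) : ℂ) (γ (s * s')), by fun_prop⟩
      have hβ : ‖β‖ < ε := by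
        refine lt_of_le_of_lt ((ContinuousMap.norm_le _ (by positivity)).2 fun s' => ?_) hGpε
        refine (norm_dilation_apply_le _ _ _).trans ?_
        gcongr
        exact γ.norm_coe_le_norm _
      have hsp : ‖dilation Λ ((s : ℝ) : ℂ) p‖ < ε :=
        (norm_dilation_apply_le _ _ _).trans_lt hpε
      have hβG := (hball _ (hmem _ β hsp hβ)).1 (by
        intro s'
        have hint : ∀ σ ∈ Set.uIcc (0 : ℝ) s', q (dilationPair Λ β (Set.projIcc 0 1 zero_le_one σ))
            = dilation Λ ((s : ℝ) : ℂ) (((s : ℝ) : ℂ) • r (s * σ)) := by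
          intro σ hσ
          rw [Set.uIcc_of_le s'.2.1] at hσ
          have hσ1 : σ ∈ Set.Icc (0 : ℝ) 1 := ⟨hσ.1, hσ.2.trans s'.2.2⟩
          have hsσ1 : (s : ℝ) * σ ∈ Set.Icc (0 : ℝ) 1 :=
            (s * (⟨σ, hσ1⟩ : unitInterval)).2
          have e1 : Set.projIcc 0 1 zero_le_one ((s : ℝ) * σ) = s * (⟨σ, hσ1⟩ : unitInterval) := by
            rw [Set.projIcc_of_mem zero_le_one hsσ1]; rfl
          simp only [r]
          rw [Set.projIcc_of_mem zero_le_one hσ1, e1, dilationPair_apply, dilationPair_apply]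
          simp only [β, ContinuousMap.coe_mk]
          rw [dilation_dilation hΛ, hom, map_smul, mul_comm (σ : ℂ)]
          congr 4
          push_cast
          rfl
        rw [intervalIntegral.integral_congr hint]
        rw [ContinuousLinearMap.intervalIntegral_comp_comm]
        · simp only [β, ContinuousMap.coe_mk]
          rw [hγ, map_add]
          congr 2
          rw [intervalIntegral.integral_smul, Complex.coe_smul,
            intervalIntegral.smul_integral_comp_mul_left (f := r)]
          simp
        · apply Continuous.intervalIntegrable
          fun_prop)
      rw [hβG]
      simp [β]
    have hd1 : HasDerivAt (fun s : ℝ => G (dilation Λ (s : ℂ) p) 1)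
        (fderiv ℂ (fun p => G p 1) p (Λ p)) 1 := by
      have hpath : HasDerivAt (fun s : ℝ => dilation Λ (s : ℂ) p) (Λ p) 1 := by
        have := ((Complex.ofRealCLM.hasDerivAt (x := (1 : ℝ))).sub_const 1).smul_const (Λ p)
        simpa [dilation_apply] using this.const_add p
      have h2 : HasFDerivAt (fun p => G p 1) (fderiv ℂ (fun p => G p 1) p)
          (dilation Λ ((1 : ℝ) : ℂ) p) := by
        have : dilation Λ ((1 : ℝ) : ℂ) p = p := by simp [dilation_apply]
        rw [this]
        exact hχp.differentiableAt.hasFDerivAt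
      exact (h2.restrictScalars ℝ).comp_hasDerivAt 1 hpath
    have hd2 : HasDerivAt (fun s : ℝ => dilation Λ (s : ℂ) (p + ∫ σ in (0 : ℝ)..s, r σ))
        (Λ (γ 1) + r 1) 1 := by
      have hint : HasDerivAt (fun s : ℝ => p + ∫ σ in (0 : ℝ)..s, r σ) (r 1) 1 :=
        (intervalIntegral.integral_hasDerivAt_right (hrc.intervalIntegrable _ _)
          (hrc.stronglyMeasurableAtFilter _ _) hrc.continuousAt).const_add p
      have hΛint : HasDerivAt (fun s : ℝ => Λ (p + ∫ σ in (0 : ℝ)..s, r σ)) (Λ (r 1)) 1 :=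
        (Λ.hasFDerivAt.restrictScalars ℝ).comp_hasDerivAt 1 hint
      have hs := ((Complex.ofRealCLM.hasDerivAt (x := (1 : ℝ))).sub_const 1).smul hΛint
      have := hint.add hs
      have h1 := hγ 1
      simp only [Set.Icc.coe_one] at h1
      rw [h1]
      exact this.congr_deriv (by simp [-map_add, add_comm])
    -- The scaling identity is known only for `s` in `[0, 1]`, so the two derivatives are compared
    -- as derivatives within this interval at its endpoint `1`.
    have hu : UniqueDiffWithinAt ℝ (Set.Icc (0 : ℝ) 1) 1 :=
      uniqueDiffOn_Icc zero_lt_one 1 (by simp)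
    have heq : ∀ s ∈ Set.Icc (0 : ℝ) 1, G (dilation Λ (s : ℂ) p) 1
        = dilation Λ (s : ℂ) (p + ∫ σ in (0 : ℝ)..s, r σ) := by
      intro s hs
      have := hscale ⟨s, hs⟩
      rw [hγ] at this
      exact this
    have hd := hd1.hasDerivWithinAt (s := Set.Icc (0 : ℝ) 1)
    have hd' := hd2.hasDerivWithinAt (s := Set.Icc (0 : ℝ) 1)
    have := hu.eq_deriv _ hd (hd'.congr heq (heq 1 (by simp)))
    rw [this]
    congr 1
    simp only [r]
    rw [Set.projIcc_of_mem zero_le_one (by simp : (1 : ℝ) ∈ Set.Icc (0 : ℝ) 1), dilationPair_apply]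
    congr 2
    simp [dilation_apply, γ]
  · have hcz : Tendsto (fun p : E => (p, ContinuousMap.const unitInterval p)) (𝓝 0)
        (𝓝 (0 : E × C(unitInterval, E))) := by
      have hc : Continuous fun p : E => (p, ContinuousMap.const unitInterval p) :=
        continuous_id.prodMk ContinuousMap.continuous_const'
      exact hc.tendsto 0
    filter_upwards [hcz.eventually hG] with p hp hΛp
    have := hp.1 (by
      intro s
      -- When `Λ p = 0` the dilation with `s = 0` fixes `p`, and homogeneity makes `q (·, p)`
      -- vanish. The constant curve is then the solution.
      have hq0 : ∀ w, q (w, p) = 0 := by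
        intro w
        have := hom 0 w p
        rw [zero_smul] at this
        rwa [dilation_apply, hΛp, smul_zero, add_zero] at this
      simp [dilationPair_apply, hq0])
    rw [this]
    rfl

end Straightening

/-! ### Local inverses, agreement off `{x = 0}`, and Poincaré linearization -/

theorem exists_analytic_local_inverse {E F : Type*} [NormedAddCommGroup E] [NormedSpace ℂ E]
    [NormedAddCommGroup F] [NormedSpace ℂ F] [CompleteSpace E] [CompleteSpace F] {χ : E → F} {a : E}
    {L : E ≃L[ℂ] F} (hχ : AnalyticAt ℂ χ a) (hL : HasFDerivAt χ (L : E →L[ℂ] F) a) :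
    ∃ ζ : F → E, AnalyticAt ℂ ζ (χ a) ∧ ζ (χ a) = a ∧ (∀ᶠ p in 𝓝 a, ζ (χ p) = p) ∧
      ∀ᶠ p in 𝓝 (χ a), χ (ζ p) = p := by
  have hs : HasStrictFDerivAt χ (L : E →L[ℂ] F) a := by
    have := hχ.hasStrictFDerivAt
    rwa [hL.fderiv] at this
  have hcd : ContDiffAt ℂ ⊤ χ a := hχ.contDiffAt
  have hne : (⊤ : WithTop ℕ∞) ≠ 0 := by simp
  exact ⟨hs.localInverse χ L a, (hcd.to_localInverse hL hne).analyticAt,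
    hs.localInverse_apply_image, hs.eventually_left_inverse, hs.eventually_right_inverse⟩

theorem eq_of_eventually_fst_ne_zero {E F : Type*} [TopologicalSpace E] [TopologicalSpace F]
    [T2Space F] {q : ℂ × E} {f g : ℂ × E → F} (hf : ContinuousAt f q) (hg : ContinuousAt g q)
    (h : ∀ᶠ p in 𝓝 q, p.1 ≠ 0 → f p = g p) : f q = g q := by
  have hc : Tendsto (fun x : ℂ => (x, q.2)) (𝓝[≠] q.1) (𝓝 q) := by
    have : Continuous fun x : ℂ => (x, q.2) := by fun_prop
    exact (this.tendsto q.1).mono_left nhdsWithin_le_nhds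
  have hne : ∀ᶠ x : ℂ in 𝓝[≠] q.1, x ≠ 0 := by
    by_cases h0 : q.1 = 0
    · rw [h0]; exact eventually_mem_nhdsWithin
    · exact nhdsWithin_le_nhds (isOpen_ne.mem_nhds h0)
  have heq : (fun x : ℂ => f (x, q.2)) =ᶠ[𝓝[≠] q.1] fun x => g (x, q.2) := by
    filter_upwards [hc.eventually h, hne] with x hx hx0 using hx hx0
  exact tendsto_nhds_unique_of_eventuallyEq (hf.tendsto.comp hc) (hg.tendsto.comp hc) heq

/-- Functions which are continuous near a point of `{x = 0}` and agree off `{x = 0}` agree. -/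
theorem eventually_eq_of_fst_ne_zero {E F : Type*} [TopologicalSpace E] [TopologicalSpace F]
    [T2Space F] {e : E} {f g : ℂ × E → F}
    (hf : ∀ᶠ q in 𝓝 ((0 : ℂ), e), ContinuousAt f q)
    (hg : ∀ᶠ q in 𝓝 ((0 : ℂ), e), ContinuousAt g q)
    (h : ∀ᶠ q in 𝓝 ((0 : ℂ), e), q.1 ≠ 0 → f q = g q) : ∀ᶠ q in 𝓝 ((0 : ℂ), e), f q = g q := by
  filter_upwards [hf, hg, h.eventually_nhds] with q hfq hgq hq
  exact eq_of_eventually_fst_ne_zero hfq hgq hq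

theorem AnalyticAt.eventually_continuousAt {E F : Type*} [NormedAddCommGroup E] [NormedSpace ℂ E]
    [NormedAddCommGroup F] [NormedSpace ℂ F] [CompleteSpace F] {f : E → F} {a : E}
    (hf : AnalyticAt ℂ f a) : ∀ᶠ q in 𝓝 a, ContinuousAt f q :=
  hf.eventually_analyticAt.mono fun _ h => h.continuousAt

theorem analyticAt_clm_apply {V E F : Type*} [NormedAddCommGroup V] [NormedSpace ℂ V]
    [NormedAddCommGroup E] [NormedSpace ℂ E] [NormedAddCommGroup F] [NormedSpace ℂ F]
    {c : V → E →L[ℂ] F} {u : V → E} {x : V} (hc : AnalyticAt ℂ c x) (hu : AnalyticAt ℂ u x) :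
    AnalyticAt ℂ (fun y => c y (u y)) x :=
  AnalyticAt.comp (g := fun p : (E →L[ℂ] F) × E => p.1 p.2)
    (isBoundedBilinearMap_apply.contDiff (n := ⊤)).contDiffAt.analyticAt (hc.prod hu)

theorem analyticAt_clm_comp {V D E F : Type*} [NormedAddCommGroup V] [NormedSpace ℂ V]
    [NormedAddCommGroup D] [NormedSpace ℂ D]
    [NormedAddCommGroup E] [NormedSpace ℂ E] [NormedAddCommGroup F] [NormedSpace ℂ F]
    {c : V → E →L[ℂ] F} {u : V → D →L[ℂ] E} {x : V} (hc : AnalyticAt ℂ c x)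
    (hu : AnalyticAt ℂ u x) : AnalyticAt ℂ (fun y => (c y).comp (u y)) x :=
  AnalyticAt.comp (g := fun p : (E →L[ℂ] F) × (D →L[ℂ] E) => p.1.comp p.2)
    (isBoundedBilinearMap_comp.contDiff (n := ⊤)).contDiffAt.analyticAt (hc.prod hu)

/-- Poincaré linearization of a radial vector field. -/
theorem RadialField.exists_linearization (X : RadialField) :
    ∃ χ : ℂ × ℂ → ℂ × ℂ, AnalyticAt ℂ χ 0 ∧ χ 0 = 0 ∧
      HasFDerivAt χ (ContinuousLinearMap.id ℂ (ℂ × ℂ)) 0 ∧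
      ∀ᶠ p in 𝓝 0, fderiv ℂ χ p p = X.toFun (χ p) := by
  have hNa : AnalyticAt ℂ (fun v => X.toFun v - v) 0 := X.analyticAt.sub analyticAt_id
  have hNd : fderiv ℂ (fun v => X.toFun v - v) 0 = 0 := by
    have := (X.hasFDerivAt.sub (hasFDerivAt_id (𝕜 := ℂ) (0 : ℂ × ℂ))).fderiv
    rw [sub_self] at this
    exact this
  -- Hadamard's lemma applied twice writes `X(v) = v + Q(v)(v)(v)`. With `w` frozen, `Q(w)(v)(v)` is
  -- quadratic in `v`, which is the homogeneity required by `exists_straightening` when `Λ` is the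
  -- identity and `s^Λ = s`.
  obtain ⟨L, hLa, hL0, hL⟩ := exists_hadamard hNa
  obtain ⟨Q, hQa, -, hQ⟩ := exists_hadamard hLa
  have hqa : AnalyticAt ℂ (fun z : (ℂ × ℂ) × (ℂ × ℂ) => Q z.1 z.2 z.2) 0 := by
    have h1 : AnalyticAt ℂ (fun z : (ℂ × ℂ) × (ℂ × ℂ) => Q z.1) 0 :=
      AnalyticAt.comp (g := Q) hQa analyticAt_fst
    exact analyticAt_clm_apply (analyticAt_clm_apply h1 analyticAt_snd) analyticAt_snd
  have hqd : fderiv ℂ (fun z : (ℂ × ℂ) × (ℂ × ℂ) => Q z.1 z.2 z.2) 0 = 0 := by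
    have h1 : AnalyticAt ℂ (fun z : (ℂ × ℂ) × (ℂ × ℂ) => Q z.1) 0 :=
      AnalyticAt.comp (g := Q) hQa analyticAt_fst
    have h2 := (h1.differentiableAt.hasFDerivAt.clm_apply (hasFDerivAt_snd (𝕜 := ℂ))).clm_apply
      (hasFDerivAt_snd (𝕜 := ℂ))
    rw [h2.fderiv]
    ext <;> simp
  obtain ⟨χ, hχa, hχ0, hχd, hχ, -⟩ := exists_straightening
    (Λ := ContinuousLinearMap.id ℂ (ℂ × ℂ)) (fun _ => rfl) hqa (by simp) hqd (by
      intro s w v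
      have e : dilation (ContinuousLinearMap.id ℂ (ℂ × ℂ)) s = s • ContinuousLinearMap.id ℂ _ := by
        ext <;> simp [dilation_apply]
      simp [e])
  refine ⟨χ, hχa, hχ0, hχd, ?_⟩
  have ht : Tendsto χ (𝓝 0) (𝓝 0) := by simpa [hχ0] using hχa.continuousAt.tendsto
  filter_upwards [hχ, ht.eventually hL, ht.eventually hQ] with p hp h1 h2
  have h3 : fderiv ℂ χ p p = χ p + Q (χ p) (χ p) (χ p) := hp
  rw [h2, hL0, hNd, X.map_zero] at h1
  simp only [sub_zero, zero_add] at h1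
  rw [h3, ← h1]
  abel

/-! ### Covectors, collinearity and local first integrals -/

/-- The exterior product of two covectors of `ℂ²`. -/
def wedge (a b : ℂ × ℂ →L[ℂ] ℂ) : ℂ := a (1, 0) * b (0, 1) - a (0, 1) * b (1, 0)

theorem covector_apply (a : ℂ × ℂ →L[ℂ] ℂ) (v : ℂ × ℂ) :
    a v = v.1 * a (1, 0) + v.2 * a (0, 1) := by
  have : v = v.1 • ((1 : ℂ), (0 : ℂ)) + v.2 • ((0 : ℂ), (1 : ℂ)) := by simp
  conv_lhs => rw [this]
  rw [map_add, map_smul, map_smul, smul_eq_mul, smul_eq_mul]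

theorem covector_ext {a b : ℂ × ℂ →L[ℂ] ℂ} (h₁ : a (1, 0) = b (1, 0)) (h₂ : a (0, 1) = b (0, 1)) :
    a = b := by
  ext
  · simpa using h₁
  · simpa using h₂

theorem analyticAt_covector_apply {E : Type*} [NormedAddCommGroup E] [NormedSpace ℂ E]
    {α : E → (ℂ × ℂ →L[ℂ] ℂ)} {q : E} (h : AnalyticAt ℂ α q) (v : ℂ × ℂ) :
    AnalyticAt ℂ (fun p => α p v) q :=
  analyticAt_clm_apply h analyticAt_const

theorem analyticAt_wedge {E : Type*} [NormedAddCommGroup E] [NormedSpace ℂ E]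
    {α β : E → (ℂ × ℂ →L[ℂ] ℂ)} {q : E} (hα : AnalyticAt ℂ α q) (hβ : AnalyticAt ℂ β q) :
    AnalyticAt ℂ (fun p => wedge (α p) (β p)) q :=
  ((analyticAt_covector_apply hα _).mul (analyticAt_covector_apply hβ _)).sub
    ((analyticAt_covector_apply hα _).mul (analyticAt_covector_apply hβ _))

theorem wedge_eq_zero_iff {a b : ℂ × ℂ →L[ℂ] ℂ} (hb : b ≠ 0) :
    wedge a b = 0 ↔ ∃ c : ℂ, a = c • b := by
  constructor
  · intro h
    unfold wedge at h
    by_cases h1 : b (1, 0) = 0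
    · have h2 : b (0, 1) ≠ 0 := fun h2 => hb (covector_ext (by simpa using h1) (by simpa using h2))
      refine ⟨a (0, 1) / b (0, 1), covector_ext ?_ ?_⟩
      · simp only [smul_apply, smul_eq_mul, h1, mul_zero]
        rw [h1, mul_zero, sub_zero] at h
        exact (mul_eq_zero.1 h).resolve_right h2
      · simp [div_mul_cancel₀ _ h2]
    · refine ⟨a (1, 0) / b (1, 0), covector_ext ?_ ?_⟩
      · simp [div_mul_cancel₀ _ h1]
      · simp only [smul_apply, smul_eq_mul]
        field_simp
        linear_combination -h
  · rintro ⟨c, rfl⟩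
    simp [wedge]; ring

/-- Collinear analytic covector fields differ by an analytic factor where the second one does not
vanish. -/
theorem exists_eq_smul_of_wedge_eq_zero {E : Type*} [NormedAddCommGroup E] [NormedSpace ℂ E]
    {α β : E → (ℂ × ℂ →L[ℂ] ℂ)} {q : E} (hα : AnalyticAt ℂ α q) (hβ : AnalyticAt ℂ β q)
    (hq : β q ≠ 0) (h : ∀ᶠ p in 𝓝 q, wedge (α p) (β p) = 0) :
    ∃ u : E → ℂ, AnalyticAt ℂ u q ∧ ∀ᶠ p in 𝓝 q, α p = u p • β p := by
  obtain ⟨v, hv⟩ : ∃ v, β q v ≠ 0 := by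
    by_contra hcon
    push Not at hcon
    exact hq (ContinuousLinearMap.ext hcon)
  have hβv := analyticAt_covector_apply hβ v
  refine ⟨fun p => α p v / β p v, (analyticAt_covector_apply hα v).div hβv hv, ?_⟩
  filter_upwards [h, hβv.continuousAt.eventually_ne hv] with p hp hpv
  have hb : β p ≠ 0 := fun h0 => hpv (by simp [h0])
  obtain ⟨c, hc⟩ := (wedge_eq_zero_iff hb).1 hp
  rw [hc]
  simp [mul_div_cancel_right₀ _ hpv]

/-- The last factor is the determinant of `M`; this is the pull-back rule for two-forms. -/
theorem wedge_comp (a b : ℂ × ℂ →L[ℂ] ℂ) (M : ℂ × ℂ →L[ℂ] ℂ × ℂ) :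
    wedge (a.comp M) (b.comp M) = wedge a b *
      ((M (1, 0)).1 * (M (0, 1)).2 - (M (0, 1)).1 * (M (1, 0)).2) := by
  unfold wedge
  simp only [ContinuousLinearMap.comp_apply]
  rw [covector_apply a (M (1, 0)), covector_apply a (M (0, 1)), covector_apply b (M (1, 0)),
    covector_apply b (M (0, 1))]
  ring

/-- Flow box: a first integral normalized on the transversal `{x = 0}`. -/
theorem exists_first_integral_of_transverse {η : ℂ × ℂ → (ℂ × ℂ →L[ℂ] ℂ)} {t₀ : ℂ}
    (hη : AnalyticAt ℂ η (0, t₀)) (hB : η (0, t₀) (0, 1) ≠ 0) :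
    ∃ z : ℂ × ℂ → ℂ, AnalyticAt ℂ z (0, t₀) ∧ (∀ᶠ t in 𝓝 t₀, z (0, t) = t) ∧
      ∀ᶠ q in 𝓝 ((0 : ℂ), t₀), wedge (fderiv ℂ z q) (η q) = 0 := by
  have hAa := analyticAt_covector_apply hη (1, 0)
  have hBa := analyticAt_covector_apply hη (0, 1)
  -- `G` is the slope `dt/dx` of the leaves. The map `T` recentres at `(0, t₀)` and shears by the
  -- slope `g` there, so that the new slope `H` vanishes at the origin.
  set G : ℂ × ℂ → ℂ := fun q => -(η q (1, 0)) / η q (0, 1)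
  have hGa : AnalyticAt ℂ G (0, t₀) := hAa.neg.div hBa hB
  set g := G (0, t₀)
  set T : ℂ × ℂ → ℂ × ℂ := fun w => (w.1, t₀ + w.2 + g * w.1)
  have hT0 : T 0 = (0, t₀) := by simp [T]
  have hTa : AnalyticAt ℂ T 0 := by
    have : AnalyticAt ℂ (fun w : ℂ × ℂ => t₀ + w.2 + g * w.1) 0 :=
        ContDiffAt.analyticAt (by fun_prop)
    exact analyticAt_fst.prod this
  set H : ℂ × ℂ → ℂ := fun w => G (T w) - g
  have hHa : AnalyticAt ℂ H 0 := by
    refine AnalyticAt.sub (AnalyticAt.comp (g := G) ?_ hTa) analyticAt_const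
    rwa [hT0]
  have hH0 : H 0 = 0 := by simp [H, hT0, g]
  set Λ : ℂ × ℂ →L[ℂ] ℂ × ℂ := (ContinuousLinearMap.inl ℂ ℂ ℂ).comp (ContinuousLinearMap.fst ℂ ℂ ℂ)
  have hΛ : ∀ v, Λ v = (v.1, 0) := fun v => by simp [Λ]
  have hH' : AnalyticAt ℂ (fun z : (ℂ × ℂ) × (ℂ × ℂ) => H z.1) 0 :=
    AnalyticAt.comp (g := H) hHa analyticAt_fst
  have hsnd : AnalyticAt ℂ (fun z : (ℂ × ℂ) × (ℂ × ℂ) => z.2.1) 0 :=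
    ContDiffAt.analyticAt (by fun_prop)
  -- The field `∂_x + H ∂_y` is multiplied by `x` and becomes `Λ + q` with `Λ` the projection on the
  -- first axis and `q(w, v) = (0, v₁ H(w))`. This `q` is homogeneous under `(v₁, v₂) ↦ (s v₁, v₂)`,
  -- so `exists_straightening` applies.
  have hqa : AnalyticAt ℂ (fun z : (ℂ × ℂ) × (ℂ × ℂ) => ((0 : ℂ), z.2.1 * H z.1)) 0 :=
    analyticAt_const.prod (hsnd.mul hH')
  have hqd : fderiv ℂ (fun z : (ℂ × ℂ) × (ℂ × ℂ) => ((0 : ℂ), z.2.1 * H z.1)) 0 = 0 := by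
    have h2 : HasFDerivAt (fun z : (ℂ × ℂ) × (ℂ × ℂ) => z.2.1 * H z.1)
        (0 : (ℂ × ℂ) × (ℂ × ℂ) →L[ℂ] ℂ) 0 := by
      have := hsnd.differentiableAt.hasFDerivAt.mul hH'.differentiableAt.hasFDerivAt
      refine this.congr_fderiv (ContinuousLinearMap.ext fun v => ?_)
      simp [hH0]
    exact ((hasFDerivAt_const (0 : ℂ) _).prodMk h2).fderiv
  obtain ⟨χ, hχa, hχ0, hχd, hχ, hχfix⟩ := exists_straightening (Λ := Λ)
    (fun v => by simp [hΛ]) hqa (by simp) hqd (by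
      intro s w v
      simp only [dilation_apply, hΛ]
      simp
      ring)
  obtain ⟨ζ, hζa, hζ0, hζχ, hχζ⟩ := exists_analytic_local_inverse
    (L := ContinuousLinearEquiv.refl ℂ (ℂ × ℂ)) hχa hχd
  rw [hχ0] at hζa hζ0 hχζ
  set y : ℂ × ℂ → ℂ := fun p => (ζ p).2
  have hya : AnalyticAt ℂ y 0 := AnalyticAt.comp (g := Prod.snd) analyticAt_snd hζa
  have hζt : Tendsto ζ (𝓝 0) (𝓝 0) := by simpa [hζ0] using hζa.continuousAt.tendsto
  have hχt : Tendsto χ (𝓝 0) (𝓝 0) := by simpa [hχ0] using hχa.continuousAt.tendsto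
  -- The straightened field `Λ` annihilates the second coordinate, so `y`, the second component of
  -- the inverse of `χ`, is killed by `x (∂_x + H ∂_y)`. The factor `x` is then removed by
  -- continuity.
  have hyD : ∀ᶠ p in 𝓝 (0 : ℂ × ℂ), p.1 * (fderiv ℂ y p (1, 0) + H p * fderiv ℂ y p (0, 1)) = 0 := by
    have h1 : ∀ᶠ p in 𝓝 (0 : ℂ × ℂ), fderiv ℂ y (χ p) (fderiv ℂ χ p (Λ p)) = 0 := by
      filter_upwards [hχa.eventually_analyticAt, hχt.eventually hya.eventually_analyticAt,
        hζχ.eventually_nhds] with p h1 h2 h3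
      have h4 : HasFDerivAt (fun p => y (χ p)) ((fderiv ℂ y (χ p)).comp (fderiv ℂ χ p)) p :=
        h2.differentiableAt.hasFDerivAt.comp p h1.differentiableAt.hasFDerivAt
      have h5 : HasFDerivAt (fun p => y (χ p)) (ContinuousLinearMap.snd ℂ ℂ ℂ) p := by
        refine (hasFDerivAt_snd (𝕜 := ℂ)).congr_of_eventuallyEq ?_
        filter_upwards [h3] with p' hp'
        simp only [y, hp']
      have h6 := congrArg (fun M : ℂ × ℂ →L[ℂ] ℂ => M (Λ p)) (h4.unique h5)
      simpa [hΛ] using h6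
    filter_upwards [hζt.eventually h1, hζt.eventually hχ, hχζ] with p h1 h2 h3
    rw [h2, h3, covector_apply] at h1
    simp only [hΛ] at h1
    simp at h1
    linear_combination h1
  have hyD' : ∀ᶠ p in 𝓝 (0 : ℂ × ℂ), fderiv ℂ y p (1, 0) + H p * fderiv ℂ y p (0, 1) = 0 := by
    have ha : AnalyticAt ℂ (fun p => fderiv ℂ y p (1, 0) + H p * fderiv ℂ y p (0, 1)) 0 :=
      (analyticAt_covector_apply hya.fderiv _).add
        (hHa.mul (analyticAt_covector_apply hya.fderiv _))
    rw [Prod.zero_eq_mk] at ha hyD ⊢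
    refine eventually_eq_of_fst_ne_zero (AnalyticAt.eventually_continuousAt ha)
      (.of_forall fun _ => continuousAt_const) ?_
    filter_upwards [hyD] with p hp h0
    exact (mul_eq_zero.1 hp).resolve_left h0
  set S : ℂ × ℂ → ℂ × ℂ := fun q => (q.1, q.2 - t₀ - g * q.1)
  have hSa : ∀ q, AnalyticAt ℂ S q := by
    intro q
    have : AnalyticAt ℂ (fun w : ℂ × ℂ => w.2 - t₀ - g * w.1) q :=
        ContDiffAt.analyticAt (by fun_prop)
    exact analyticAt_fst.prod this
  have hS0 : S (0, t₀) = 0 := by simp [S]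
  have hSt : Tendsto S (𝓝 (0, t₀)) (𝓝 0) := by
    rw [← hS0]; exact (hSa _).continuousAt
  have hSd : ∀ q, HasFDerivAt S ((ContinuousLinearMap.fst ℂ ℂ ℂ).prod
      (ContinuousLinearMap.snd ℂ ℂ ℂ - g • ContinuousLinearMap.fst ℂ ℂ ℂ)) q := by
    intro q
    refine (hasFDerivAt_fst (𝕜 := ℂ)).prodMk ?_
    exact ((hasFDerivAt_snd (𝕜 := ℂ)).sub_const t₀).sub
      ((hasFDerivAt_fst (𝕜 := ℂ)).const_smul g)
  refine ⟨fun q => t₀ + y (S q), ?_, ?_, ?_⟩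
  · refine analyticAt_const.add (AnalyticAt.comp (g := y) ?_ (hSa _))
    rwa [hS0]
  · have hc : Tendsto (fun t : ℂ => ((0 : ℂ), t - t₀)) (𝓝 t₀) (𝓝 0) := by
      have : Continuous (fun t : ℂ => ((0 : ℂ), t - t₀)) := by fun_prop
      simpa [Prod.zero_eq_mk] using this.tendsto t₀
    filter_upwards [hc.eventually hχfix, hc.eventually hζχ] with t h1 h2
    -- `χ` fixes the kernel of `Λ`, which is the axis `{x = 0}`; this gives the normalization `z (0,
    -- t) = t`.
    have h3 := h1 (by simp [hΛ])
    rw [h3] at h2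
    simp [S, y, h2]
  · filter_upwards [hSt.eventually hyD', hSt.eventually hya.eventually_analyticAt,
      hBa.continuousAt.eventually_ne hB] with q h1 h2 h3
    have h4 : HasFDerivAt (fun q => t₀ + y (S q)) _ q :=
      (h2.differentiableAt.hasFDerivAt.comp q (hSd q)).const_add t₀
    rw [h4.fderiv]
    have hTS : T (S q) = q := by
      ext
      · simp [T, S]
      · simp only [T, S]; ring
    simp only [H, hTS, G] at h1
    unfold wedge
    have e1 : ((fderiv ℂ y (S q)).comp ((ContinuousLinearMap.fst ℂ ℂ ℂ).prod
      (ContinuousLinearMap.snd ℂ ℂ ℂ - g • ContinuousLinearMap.fst ℂ ℂ ℂ))) (1, 0)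
        = fderiv ℂ y (S q) (1, 0) - g * fderiv ℂ y (S q) (0, 1) := by
      rw [ContinuousLinearMap.comp_apply, covector_apply]
      simp
      ring
    have e2 : ((fderiv ℂ y (S q)).comp ((ContinuousLinearMap.fst ℂ ℂ ℂ).prod
      (ContinuousLinearMap.snd ℂ ℂ ℂ - g • ContinuousLinearMap.fst ℂ ℂ ℂ))) (0, 1)
        = fderiv ℂ y (S q) (0, 1) := by
      rw [ContinuousLinearMap.comp_apply, covector_apply]
      simp
    rw [e1, e2]
    field_simp at h1
    linear_combination h1

/-- A regular foliation has a local primitive first integral. -/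
theorem exists_first_integral {η : ℂ × ℂ → (ℂ × ℂ →L[ℂ] ℂ)} {t₀ : ℂ}
    (hη : AnalyticAt ℂ η (0, t₀)) (h0 : η (0, t₀) ≠ 0) :
    ∃ f : ℂ × ℂ → ℂ, AnalyticAt ℂ f (0, t₀) ∧ fderiv ℂ f (0, t₀) ≠ 0 ∧
      ∀ᶠ q in 𝓝 ((0 : ℂ), t₀), wedge (fderiv ℂ f q) (η q) = 0 := by
  have hne : ∀ (z : ℂ × ℂ → ℂ) (t : ℂ), AnalyticAt ℂ z (0, t) → (∀ᶠ s in 𝓝 t, z (0, s) = s) →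
      fderiv ℂ z (0, t) (0, 1) = 1 := by
    intro z t hz hzt
    have hp : HasDerivAt (fun s : ℂ => ((0 : ℂ), s)) ((0 : ℂ), (1 : ℂ)) t :=
      (hasDerivAt_const t (0 : ℂ)).prodMk (hasDerivAt_id t)
    have h1 : HasDerivAt (fun s => z (0, s)) (fderiv ℂ z (0, t) (0, 1)) t :=
      hz.differentiableAt.hasFDerivAt.comp_hasDerivAt t hp
    exact h1.unique ((hasDerivAt_id t).congr_of_eventuallyEq hzt)
  by_cases hB : η (0, t₀) (0, 1) = 0
  · have hA : η (0, t₀) (1, 0) ≠ 0 := fun hA =>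
      h0 (covector_ext (by simpa using hA) (by simpa using hB))
    -- The leaf through the point is tangent to `{x = 0}`. Exchanging the two coordinates makes it
    -- transverse to the new axis.
    set W : ℂ × ℂ →L[ℂ] ℂ × ℂ :=
      (ContinuousLinearMap.snd ℂ ℂ ℂ).prod (ContinuousLinearMap.fst ℂ ℂ ℂ)
    set σ : ℂ × ℂ → ℂ × ℂ := fun q => (q.2, t₀ + q.1)
    have hσa : AnalyticAt ℂ σ (0, 0) := by
      have : AnalyticAt ℂ (fun q : ℂ × ℂ => t₀ + q.1) (0, 0) :=
        ContDiffAt.analyticAt (by fun_prop)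
      exact analyticAt_snd.prod this
    have hσ0 : σ (0, 0) = (0, t₀) := by simp [σ]
    have hηa : AnalyticAt ℂ (fun q => (η (σ q)).comp W) (0, 0) := by
      have h1 : AnalyticAt ℂ (fun q => η (σ q)) (0, 0) := by
        refine AnalyticAt.comp (g := η) ?_ hσa
        rwa [hσ0]
      exact (ContinuousLinearMap.analyticAt
        ((ContinuousLinearMap.compL ℂ (ℂ × ℂ) (ℂ × ℂ) ℂ).flip W) _).comp h1
    obtain ⟨z, hza, hz0, hzw⟩ := exists_first_integral_of_transverse hηa (by
      simpa [hσ0, W] using hA)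
    set τ : ℂ × ℂ → ℂ × ℂ := fun q => (q.2 - t₀, q.1)
    have hτd : ∀ q, HasFDerivAt τ W q := fun q =>
      ((hasFDerivAt_snd (𝕜 := ℂ)).sub_const t₀).prodMk (hasFDerivAt_fst (𝕜 := ℂ))
    have hτa : ∀ q, AnalyticAt ℂ τ q := by
      intro q
      have : AnalyticAt ℂ (fun q : ℂ × ℂ => q.2 - t₀) q :=
        ContDiffAt.analyticAt (by fun_prop)
      exact this.prod analyticAt_fst
    have hτ0 : τ (0, t₀) = (0, 0) := by simp [τ]
    have hτt : Tendsto τ (𝓝 (0, t₀)) (𝓝 (0, 0)) := by rw [← hτ0]; exact (hτa _).continuousAt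
    have hfd : ∀ q, AnalyticAt ℂ z (τ q) →
        HasFDerivAt (fun q => z (τ q)) ((fderiv ℂ z (τ q)).comp W) q := fun q hq =>
      hq.differentiableAt.hasFDerivAt.comp q (hτd q)
    refine ⟨fun q => z (τ q), ?_, ?_, ?_⟩
    · refine AnalyticAt.comp (g := z) ?_ (hτa _)
      rwa [hτ0]
    · rw [(hfd (0, t₀) (by rwa [hτ0])).fderiv, hτ0]
      intro h
      have := congrArg (fun M : ℂ × ℂ →L[ℂ] ℂ => M (1, 0)) h
      simp only [ContinuousLinearMap.comp_apply] at this
      have h3 : W (1, 0) = (0, 1) := by simp [W]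
      rw [h3, hne z 0 hza hz0] at this
      simp at this
    · filter_upwards [hτt.eventually hzw, hτt.eventually hza.eventually_analyticAt] with q h1 h2
      rw [(hfd q h2).fderiv]
      have hστ : σ (τ q) = q := by simp [σ, τ]
      rw [hστ] at h1
      unfold wedge at h1 ⊢
      simp [W] at h1 ⊢
      linear_combination -h1
  · obtain ⟨z, hza, hz0, hzw⟩ := exists_first_integral_of_transverse hη hB
    refine ⟨z, hza, fun h => ?_, hzw⟩
    have := hne z t₀ hza hz0
    rw [h] at this
    simp at this

/-! ### Hartogs extension -/

section Hartogs

variable {c : ℂ} {r : ℝ}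

/-- The mean Cauchy integral over a circle, as a functional on continuous functions. -/
def circleFunctional (c : ℂ) (r : ℝ) : C(Metric.sphere c |r|, ℂ) →L[ℂ] ℂ :=
  LinearMap.mkContinuous
    { toFun := fun w => (2 * Real.pi * Complex.I : ℂ)⁻¹ • ∫ θ in (0 : ℝ)..2 * Real.pi,
        deriv (circleMap c r) θ • w ⟨circleMap c r θ, circleMap_mem_sphere' c r θ⟩
      map_add' := by
        intro x y
        rw [← smul_add, ← intervalIntegral.integral_add]
        · simp only [ContinuousMap.add_apply, smul_add]
        · apply Continuous.intervalIntegrable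
          simp only [deriv_circleMap]
          fun_prop
        · apply Continuous.intervalIntegrable
          simp only [deriv_circleMap]
          fun_prop
      map_smul' := by
        intro a x
        simp only [ContinuousMap.smul_apply, RingHom.id_apply]
        rw [smul_comm a]
        refine congrArg (fun I : ℂ => (2 * Real.pi * Complex.I : ℂ)⁻¹ • I) ?_
        rw [← intervalIntegral.integral_smul]
        refine intervalIntegral.integral_congr fun θ _ => ?_
        simp only [smul_eq_mul]
        ring }
    (‖(2 * Real.pi * Complex.I : ℂ)⁻¹‖ * (|r| * |2 * Real.pi - 0|)) (by
      intro w
      refine (norm_smul_le _ _).trans ?_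
      rw [mul_assoc ‖_‖]
      refine mul_le_mul_of_nonneg_left ?_ (norm_nonneg _)
      refine (intervalIntegral.norm_integral_le_of_norm_le_const (C := |r| * ‖w‖)
        fun θ _ => ?_).trans (le_of_eq (by ring))
      rw [norm_smul]
      gcongr
      · simp [deriv_circleMap]
      · exact w.norm_coe_le_norm _)

theorem circleFunctional_apply (w : C(Metric.sphere c |r|, ℂ)) (h : ℂ → ℂ)
    (hw : ∀ z : Metric.sphere c |r|, w z = h z) :
    circleFunctional c r w = (2 * Real.pi * Complex.I : ℂ)⁻¹ • ∮ z in C(c, r), h z := by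
  refine congrArg (fun I : ℂ => (2 * Real.pi * Complex.I : ℂ)⁻¹ • I) ?_
  refine intervalIntegral.integral_congr fun θ _ => ?_
  simp only [hw]

/-- Hartogs' extension theorem for a Hartogs figure. -/
theorem exists_hartogs_extension {f : ℂ × ℂ → ℂ} {ρ : ℝ} (hr : 0 < r) (hρ : 0 < ρ)
    (h₁ : ∀ y ∈ Metric.closedBall (0 : ℂ) ρ, ∀ z ∈ Metric.sphere c r, AnalyticAt ℂ f (y, z))
    (h₂ : ∀ y ∈ Metric.closedBall (0 : ℂ) ρ, y ≠ 0 → ∀ z ∈ Metric.closedBall c r,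
      AnalyticAt ℂ f (y, z)) :
    ∃ g : ℂ × ℂ → ℂ, AnalyticAt ℂ g (0, c) ∧ ∀ᶠ q in 𝓝 ((0 : ℂ), c), q.1 ≠ 0 → g q = f q := by
  have hrabs : |r| = r := abs_of_pos hr
  have hsub : ∀ z : Metric.sphere c |r|, (z : ℂ) ∈ Metric.sphere c r := by
    intro z; exact (Metric.mem_sphere.1 z.2).trans hrabs
  classical
  -- `U y` is the restriction of `f (y, ·)` to the circle, viewed in the Banach space of continuous
  -- functions on the circle.
  set U : ℂ → C(Metric.sphere c |r|, ℂ) := fun y =>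
    if h : Continuous (fun z : Metric.sphere c |r| => f (y, z)) then ⟨_, h⟩ else 0
  have hU : ∀ y ∈ Metric.closedBall (0 : ℂ) ρ, ∀ z, U y z = f (y, z) := by
    intro y hy z
    have h : Continuous (fun z : Metric.sphere c |r| => f (y, z)) := by
      rw [continuous_iff_continuousAt]
      intro w
      refine ContinuousAt.comp (f := fun z : Metric.sphere c |r| => (y, (z : ℂ)))
        (h₁ y hy w (hsub w)).continuousAt (by fun_prop)
    simp only [U, dif_pos h, ContinuousMap.coe_mk]
  have hUc : ContinuousOn U (Metric.closedBall 0 ρ) := by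
    rw [continuousOn_iff_continuous_domRestrict]
    set Fc : C(Metric.closedBall (0 : ℂ) ρ × Metric.sphere c |r|, ℂ) :=
      ⟨fun p => f (p.1, p.2), by
        rw [continuous_iff_continuousAt]
        intro p
        refine ContinuousAt.comp (f := fun p : Metric.closedBall (0 : ℂ) ρ × Metric.sphere c |r| =>
          ((p.1 : ℂ), (p.2 : ℂ))) (h₁ _ p.1.2 _ (hsub p.2)).continuousAt (by fun_prop)⟩
    have : (Metric.closedBall (0 : ℂ) ρ).domRestrict U = Fc.curry := by
      ext y z
      exact hU y y.2 z
    rw [this]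
    exact Fc.curry.continuous
  lift ρ to NNReal using hρ.le
  have hρ' : 0 < ρ := by exact_mod_cast hρ
  have hci : CircleIntegrable U 0 ρ :=
    (hUc.mono Metric.sphere_subset_closedBall).circleIntegrable ρ.coe_nonneg
  -- The Cauchy integral in `y` with values in this Banach space is analytic in `y`, and the scalar
  -- Cauchy formula at each point of the circle shows that it equals `U`.
  set V : ℂ → C(Metric.sphere c |r|, ℂ) := fun y =>
    (2 * Real.pi * Complex.I : ℂ)⁻¹ • ∮ z in C(0, ρ), (z - y)⁻¹ • U z
  have hVa : AnalyticAt ℂ V 0 := (hasFPowerSeriesOn_cauchy_integral hci hρ').analyticAt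
  have hV : ∀ y ∈ Metric.ball (0 : ℂ) ρ, ∀ z, V y z = f (y, z) := by
    intro y hy z
    have hcont : ContinuousOn (fun w => (w - y)⁻¹ • U w) (Metric.sphere 0 ρ) := by
      refine ContinuousOn.fun_smul ?_ (hUc.mono Metric.sphere_subset_closedBall)
      refine ContinuousOn.inv₀ (by fun_prop) fun w hw h0 => ?_
      rw [sub_eq_zero] at h0
      subst h0
      rw [Metric.mem_sphere] at hw
      rw [Metric.mem_ball] at hy
      exact absurd hw hy.ne
    have e1 : (∮ w in C(0, ρ), (w - y)⁻¹ • U w) z = ∮ w in C(0, ρ), (w - y)⁻¹ • f (w, z) := by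
      have hint := (hcont.circleIntegrable ρ.coe_nonneg).out
      have := (ContinuousMap.evalCLM ℂ z : C(Metric.sphere c |r|, ℂ) →L[ℂ] ℂ).intervalIntegral_comp_comm
        hint
      unfold circleIntegral
      refine this.symm.trans ?_
      refine intervalIntegral.integral_congr fun θ _ => ?_
      have hθ : circleMap 0 ρ θ ∈ Metric.closedBall (0 : ℂ) ρ :=
        Metric.sphere_subset_closedBall (circleMap_mem_sphere _ ρ.coe_nonneg _)
      simp only [map_smul]
      exact congrArg (fun v : ℂ => deriv (circleMap 0 ρ) θ • (circleMap 0 ρ θ - y)⁻¹ • v)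
        (hU _ hθ z)
    have hdc : DiffContOnCl ℂ (fun w => f (w, z)) (Metric.ball 0 ρ) := by
      apply DifferentiableOn.diffContOnCl
      rw [closure_ball _ hρ.ne']
      intro w hw
      have h1 := (h₁ w hw z (hsub z)).differentiableAt
      exact (h1.comp w (f := fun w : ℂ => (w, (z : ℂ))) (by fun_prop)).differentiableWithinAt
    have := hdc.two_pi_i_inv_smul_circleIntegral_sub_inv_smul hy
    simp only [V, ContinuousMap.smul_apply, e1]
    exact this
  -- For `x` inside the circle, `z ↦ z - x` is invertible in the Banach algebra of continuous
  -- functions on the circle, so the Cauchy kernel is analytic in `x` as an element of this algebra.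
  set ι : ℂ → C(Metric.sphere c |r|, ℂ) := fun x => ⟨fun z => (z : ℂ) - x, by fun_prop⟩
  have hιa : AnalyticAt ℂ ι c := by
    have : ι = fun x => ι 0 - x • (1 : C(Metric.sphere c |r|, ℂ)) := by
      ext x z; simp [ι]
    rw [this]
    exact analyticAt_const.sub (analyticAt_id.smul analyticAt_const)
  have hunit : ∀ x ∈ Metric.ball c r, IsUnit (ι x) := by
    intro x hx
    rw [ContinuousMap.isUnit_iff_forall_ne_zero]
    intro z h0
    have h0' : (z : ℂ) = x := sub_eq_zero.1 h0
    have := hsub z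
    rw [h0', Metric.mem_sphere] at this
    rw [Metric.mem_ball] at hx
    exact absurd this hx.ne
  have hcb : c ∈ Metric.ball c r := Metric.mem_ball_self hr
  -- The extension is the Cauchy integral over the circle in the second variable. It is analytic in
  -- both variables, and it equals `f` when `y ≠ 0` because `f (y, ·)` is then analytic on the whole
  -- disc.
  refine ⟨fun q => circleFunctional c r (Ring.inverse (ι q.2) * V q.1), ?_, ?_⟩
  · refine AnalyticAt.comp (g := circleFunctional c r) (ContinuousLinearMap.analyticAt _ _) ?_
    refine AnalyticAt.mul ?_ (AnalyticAt.comp (g := V) hVa analyticAt_fst)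
    refine AnalyticAt.comp (g := Ring.inverse) ?_ (AnalyticAt.comp (g := ι) hιa analyticAt_snd)
    exact analyticAt_inverse (hunit c hcb).unit
  · have e1 : ∀ᶠ q : ℂ × ℂ in 𝓝 (0, c), q.1 ∈ Metric.ball (0 : ℂ) ρ :=
      continuous_fst.continuousAt (x := ((0 : ℂ), c)) (Metric.ball_mem_nhds _ hρ)
    have e2 : ∀ᶠ q : ℂ × ℂ in 𝓝 (0, c), q.2 ∈ Metric.ball c r :=
      continuous_snd.continuousAt (x := ((0 : ℂ), c)) (Metric.ball_mem_nhds _ hr)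
    filter_upwards [e1, e2] with q h1 h2 hne
    have hmul := Ring.mul_inverse_cancel _ (hunit _ h2)
    rw [circleFunctional_apply _ (fun z => (z - q.2)⁻¹ • f (q.1, z)) (by
      intro z
      have h3 := congrArg (fun w : C(Metric.sphere c |r|, ℂ) => w z) hmul
      simp only [ContinuousMap.mul_apply, ContinuousMap.one_apply] at h3
      rw [ContinuousMap.mul_apply, hV _ h1, smul_eq_mul]
      congr 1
      exact eq_inv_of_mul_eq_one_right h3)]
    have hdc : DiffContOnCl ℂ (fun z => f (q.1, z)) (Metric.ball c r) := by
      apply DifferentiableOn.diffContOnCl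
      rw [closure_ball _ hr.ne']
      intro w hw
      have h1 := (h₂ q.1 (Metric.ball_subset_closedBall h1) hne w hw).differentiableAt
      exact (h1.comp w (f := fun w : ℂ => (q.1, w)) (by fun_prop)).differentiableWithinAt
    exact hdc.two_pi_i_inv_smul_circleIntegral_sub_inv_smul h2

/-- Isolated singularities of analytic functions of two variables are removable. -/
theorem exists_analytic_extension {f : ℂ × ℂ → ℂ}
    (hf : ∀ᶠ q in 𝓝[≠] (0 : ℂ × ℂ), AnalyticAt ℂ f q) :
    ∃ g : ℂ × ℂ → ℂ, AnalyticAt ℂ g 0 ∧ ∀ᶠ q in 𝓝[≠] (0 : ℂ × ℂ), g q = f q := by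
  obtain ⟨R, hR, hball⟩ := Metric.eventually_nhds_iff_ball.1 (eventually_nhdsWithin_iff.1 hf)
  have hmem : ∀ y z : ℂ, ‖y‖ ≤ R / 2 → ‖z‖ ≤ R / 2 → (y, z) ∈ Metric.ball (0 : ℂ × ℂ) R := by
    intro y z hy hz
    rw [mem_ball_zero_iff, Prod.norm_def]
    exact max_lt (by linarith) (by linarith)
  have hR2 : 0 < R / 2 := by linarith
  obtain ⟨g, hg, hgf⟩ := exists_hartogs_extension (f := f) (c := 0) hR2 hR2
    (fun y hy z hz => by
      rw [mem_closedBall_zero_iff] at hy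
      rw [mem_sphere_zero_iff_norm] at hz
      refine hball _ (hmem y z hy hz.le) fun h => ?_
      have : z = 0 := congrArg Prod.snd h
      rw [this, norm_zero] at hz
      linarith)
    (fun y hy hy0 z hz => by
      rw [mem_closedBall_zero_iff] at hy hz
      exact hball _ (hmem y z hy hz) fun h => hy0 (congrArg Prod.fst h))
  refine ⟨g, hg, ?_⟩
  rw [eventually_nhdsWithin_iff] at hf ⊢
  filter_upwards [hgf.eventually_nhds, hf, AnalyticAt.eventually_continuousAt hg] with q h1 h2 h3 h4
  exact eq_of_eventually_fst_ne_zero h3 (h2 h4).continuousAt h1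

/-- Zeros of analytic functions of two variables are not isolated. -/
theorem frequently_eq_zero_of_eq_zero {g : ℂ × ℂ → ℂ} (hg : AnalyticAt ℂ g 0) (h0 : g 0 = 0) :
    ∃ᶠ q in 𝓝[≠] (0 : ℂ × ℂ), g q = 0 := by
  intro hne
  obtain ⟨G, hG, hGg⟩ := exists_analytic_extension (f := fun q => (g q)⁻¹) (by
    filter_upwards [hne, nhdsWithin_le_nhds hg.eventually_analyticAt] with q h1 h2
    exact h2.inv h1)
  have h1 : (fun q => g q * G q) =ᶠ[𝓝[≠] 0] fun _ => 1 := by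
    filter_upwards [hne, hGg] with q h1 h2
    rw [h2, mul_inv_cancel₀ h1]
  have h2 : Tendsto (fun q => g q * G q) (𝓝[≠] 0) (𝓝 (g 0 * G 0)) :=
    (hg.continuousAt.mul hG.continuousAt).tendsto.mono_left nhdsWithin_le_nhds
  have := tendsto_nhds_unique_of_eventuallyEq h2 tendsto_const_nhds h1
  rw [h0, zero_mul] at this
  exact zero_ne_one this

end Hartogs

/-! ### Divisibility, powers and roots of analytic germs -/

/-- If `A K = P L`, where `A` does not vanish identically on `{x = 0}` and `P` vanishes at most
there, then `P` divides `K`. -/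
theorem exists_eq_mul_of_mul_eq_mul {A K P L : ℂ × ℂ → ℂ} {t₀ : ℂ} (hA : AnalyticAt ℂ A (0, t₀))
    (hK : AnalyticAt ℂ K (0, t₀)) (hP : AnalyticAt ℂ P (0, t₀)) (hL : AnalyticAt ℂ L (0, t₀))
    (hA0 : ¬ ∀ᶠ t in 𝓝 t₀, A (0, t) = 0) (hP0 : ∀ᶠ q in 𝓝 ((0 : ℂ), t₀), q.1 ≠ 0 → P q ≠ 0)
    (h : ∀ᶠ q in 𝓝 ((0 : ℂ), t₀), A q * K q = P q * L q) :
    ∃ κ : ℂ × ℂ → ℂ, AnalyticAt ℂ κ (0, t₀) ∧ ∀ᶠ q in 𝓝 ((0 : ℂ), t₀), K q = P q * κ q := by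
  have hgood := ((hA.eventually_analyticAt.and hK.eventually_analyticAt).and
    (hP.eventually_analyticAt.and hL.eventually_analyticAt)).and
    (h.eventually_nhds.and hP0.eventually_nhds)
  obtain ⟨R, hR, hball⟩ := Metric.eventually_nhds_iff_ball.1 hgood
  have hA0a : AnalyticAt ℂ (fun t => A (0, t)) t₀ :=
    AnalyticAt.comp (g := A) (f := fun t : ℂ => ((0 : ℂ), t)) hA
      (ContDiffAt.analyticAt (by fun_prop))
  have hiso := hA0a.eventually_eq_zero_or_eventually_ne_zero.resolve_left hA0
  rw [eventually_nhdsWithin_iff] at hiso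
  obtain ⟨R', hR', hball'⟩ := Metric.eventually_nhds_iff_ball.1 hiso
  set r := min R R' / 2
  have hr : 0 < r := by positivity
  have hrR : r < R := by
    have := min_le_left R R'
    simp only [r]; linarith [lt_min hR hR']
  have hrR' : r < R' := by
    have := min_le_right R R'
    simp only [r]; linarith [lt_min hR hR']
  classical
  -- The quotient `K / P` makes sense off `{x = 0}` and equals `L / A` wherever both are defined.
  -- Hence `f` is analytic off the common zeros of `x` and `A`.
  set f : ℂ × ℂ → ℂ := fun q => if q.1 = 0 then L q / A q else K q / P q
  have hmem : ∀ y z : ℂ, ‖y‖ < R → ‖z - t₀‖ < R → (y, z) ∈ Metric.ball ((0 : ℂ), t₀) R := by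
    intro y z hy hz
    rw [Metric.mem_ball, Prod.dist_eq]
    exact max_lt (by simpa using hy) (by simpa [dist_eq_norm] using hz)
  have hf1 : ∀ q ∈ Metric.ball ((0 : ℂ), t₀) R, q.1 ≠ 0 → AnalyticAt ℂ f q := by
    intro q hq hq0
    obtain ⟨⟨⟨-, h2⟩, h3, -⟩, -, h6⟩ := hball q hq
    refine (h2.div h3 (h6.self_of_nhds hq0)).congr ?_
    filter_upwards [continuous_fst.continuousAt.eventually_ne hq0] with p hp
    simp [f, hp]
  have hf2 : ∀ q ∈ Metric.ball ((0 : ℂ), t₀) R, A q ≠ 0 → AnalyticAt ℂ f q := by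
    intro q hq hq0
    obtain ⟨⟨⟨h1, -⟩, -, h4⟩, h5, h6⟩ := hball q hq
    refine (h4.div h1 hq0).congr ?_
    filter_upwards [h5, h6, h1.continuousAt.eventually_ne hq0] with p h5 h6 h7
    by_cases hp : p.1 = 0
    · simp [f, hp]
    · simp only [f, hp, if_false, Pi.div_apply]
      rw [div_eq_div_iff h7 (h6 hp)]
      linear_combination -h5
  -- `A (0, ·)` has no zero on a small circle around `t₀`. By compactness this persists for small
  -- `y`, which yields a Hartogs figure where `f` is analytic.
  have hsph : ∀ᶠ y in 𝓝 (0 : ℂ), ∀ z ∈ Metric.sphere t₀ r, A (y, z) ≠ 0 := by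
    refine (isCompact_sphere t₀ r).eventually_forall_of_forall_eventually fun z hz => ?_
    rw [Metric.mem_sphere, dist_eq_norm] at hz
    have h1 := (hball (0, z) (hmem 0 z (by simpa using hR) (by linarith))).1.1.1
    refine h1.continuousAt.eventually_ne (hball' z ?_ ?_)
    · rw [Metric.mem_ball, dist_eq_norm]; linarith
    · rintro rfl
      rw [sub_self, norm_zero] at hz
      exact hr.ne hz
  obtain ⟨ρ', hρ', hballρ⟩ := Metric.eventually_nhds_iff_ball.1 hsph
  set ρ := min R ρ' / 2
  have hρ : 0 < ρ := by positivity
  have hρR : ρ < R := by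
    have := min_le_left R ρ'
    simp only [ρ]; linarith [lt_min hR hρ']
  have hρρ : ρ < ρ' := by
    have := min_le_right R ρ'
    simp only [ρ]; linarith [lt_min hR hρ']
  obtain ⟨g, hg, hgf⟩ := exists_hartogs_extension (f := f) (c := t₀) hr hρ
    (fun y hy z hz => by
      rw [mem_closedBall_zero_iff] at hy
      have hz' := hz
      rw [Metric.mem_sphere, dist_eq_norm] at hz'
      exact hf2 _ (hmem y z (by linarith) (by linarith))
        (hballρ y (by rw [mem_ball_zero_iff]; linarith) z hz))
    (fun y hy hy0 z hz => by
      rw [mem_closedBall_zero_iff] at hy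
      rw [Metric.mem_closedBall, dist_eq_norm] at hz
      exact hf1 _ (hmem y z (by linarith) (by linarith)) hy0)
  refine ⟨g, hg, ?_⟩
  refine eventually_eq_of_fst_ne_zero (AnalyticAt.eventually_continuousAt hK)
    (AnalyticAt.eventually_continuousAt (hP.mul hg)) ?_
  filter_upwards [hgf, hP0] with q h1 h2 h3
  rw [h1 h3]
  simp only [f, h3, if_false]
  rw [mul_div_cancel₀ _ (h2 h3)]

/-- An analytic solution of `∂A/∂y = κ A` in the coordinates `(s, y)` has the form `sᵏ` times a
unit. -/
theorem exists_eq_pow_mul_unit {κ : ℂ × ℂ → ℂ} (hκ : AnalyticAt ℂ κ (0, 0)) (k : ℕ) :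
    ∀ {A : ℂ × ℂ → ℂ}, AnalyticAt ℂ A (0, 0) →
      (∀ᶠ q in 𝓝 ((0 : ℂ), (0 : ℂ)), fderiv ℂ A q (0, 1) = κ q * A q) →
      analyticOrderAt (fun s => A (s, 0)) 0 = k →
      ∃ U : ℂ × ℂ → ℂ, AnalyticAt ℂ U (0, 0) ∧ U (0, 0) ≠ 0 ∧
        ∀ᶠ q in 𝓝 ((0 : ℂ), (0 : ℂ)), A q = q.1 ^ k * U q := by
  have hline : ∀ {A : ℂ × ℂ → ℂ}, AnalyticAt ℂ A (0, 0) → AnalyticAt ℂ (fun s => A (s, 0)) 0 :=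
    fun {A} hA => AnalyticAt.comp (g := A) (f := fun s : ℂ => (s, (0 : ℂ))) hA
      (ContDiffAt.analyticAt (by fun_prop))
  induction k with
  | zero =>
    intro A hA _ hord
    refine ⟨A, hA, ?_, by simp⟩
    exact ((hline hA).analyticOrderAt_eq_zero).1 hord
  | succ k ih =>
    intro A hA hAκ hord
    have hA00 : A (0, 0) = 0 := by
      by_contra hne
      rw [((hline hA).analyticOrderAt_eq_zero).2 hne] at hord
      exact absurd hord.symm (by exact_mod_cast Nat.succ_ne_zero k)
    have hya : AnalyticAt ℂ (fun y => A (0, y)) 0 :=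
      AnalyticAt.comp (g := A) (f := fun y : ℂ => ((0 : ℂ), y)) hA
        (ContDiffAt.analyticAt (by fun_prop))
    have hκy : AnalyticAt ℂ (fun y => κ (0, y)) 0 :=
      AnalyticAt.comp (g := κ) (f := fun y : ℂ => ((0 : ℂ), y)) hκ
        (ContDiffAt.analyticAt (by fun_prop))
    have hty : Tendsto (fun y : ℂ => ((0 : ℂ), y)) (𝓝 0) (𝓝 (0, 0)) :=
      (Continuous.prodMk_right (0 : ℂ)).tendsto 0
    have hderiv : deriv (fun y => A (0, y)) =ᶠ[𝓝 0] fun y => κ (0, y) * A (0, y) := by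
      filter_upwards [hty.eventually hAκ, hty.eventually hA.eventually_analyticAt] with y h1 h2
      rw [← h1]
      have hp : HasDerivAt (fun s : ℂ => ((0 : ℂ), s)) ((0 : ℂ), (1 : ℂ)) y :=
        (hasDerivAt_const y (0 : ℂ)).prodMk (hasDerivAt_id y)
      exact (h2.differentiableAt.hasFDerivAt.comp_hasDerivAt y hp).deriv
    -- On `{s = 0}` the function solves a linear differential equation and vanishes at `0`. A finite
    -- order of vanishing would drop by one under differentiation, while the equation says that it
    -- does not drop.
    have hzero : ∀ᶠ y in 𝓝 (0 : ℂ), A (0, y) = 0 := by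
      rw [← analyticOrderAt_eq_top]
      by_contra hne
      have h1 := hya.analyticOrderAt_deriv_add_one
      simp only [hA00, sub_zero] at h1
      rw [analyticOrderAt_congr hderiv] at h1
      change analyticOrderAt ((fun y => κ (0, y)) * fun y => A (0, y)) 0 + 1 = _ at h1
      rw [analyticOrderAt_mul hκy hya] at h1
      have h2 : analyticOrderAt (fun y => A (0, y)) 0 + 1 ≤ analyticOrderAt (fun y => A (0, y)) 0 := by
        conv_rhs => rw [← h1]
        gcongr
        exact le_add_self
      exact absurd h2 (not_le.2 (ENat.lt_add_one_iff hne |>.2 le_rfl))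
    -- The quotient by `s` satisfies the same equation, since `s` does not depend on `y`, and its
    -- order along `{y = 0}` is one less.
    obtain ⟨A₁, hA₁, hAA₁, -⟩ := exists_eq_smul_of_eq_zero hA hzero
    have hA₁κ : ∀ᶠ q in 𝓝 ((0 : ℂ), (0 : ℂ)), fderiv ℂ A₁ q (0, 1) = κ q * A₁ q := by
      refine eventually_eq_of_fst_ne_zero
        (AnalyticAt.eventually_continuousAt (analyticAt_clm_apply hA₁.fderiv analyticAt_const))
        (AnalyticAt.eventually_continuousAt (hκ.mul hA₁)) ?_
      filter_upwards [hAA₁.eventually_nhds, hAκ, hA₁.eventually_analyticAt] with q h1 h2 h3 h4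
      have h5 : HasFDerivAt A (q.1 • fderiv ℂ A₁ q +
          A₁ q • ContinuousLinearMap.fst ℂ ℂ ℂ) q := by
        have := (hasFDerivAt_fst (𝕜 := ℂ) (p := q)).mul h3.differentiableAt.hasFDerivAt
        exact this.congr_of_eventuallyEq h1
      rw [h5.fderiv, h1.self_of_nhds] at h2
      simp only [add_apply, smul_apply, ContinuousLinearMap.coe_fst', smul_eq_mul, mul_zero,
        add_zero] at h2
      refine mul_left_cancel₀ h4 ?_
      linear_combination h2
    have hord₁ : analyticOrderAt (fun s => A₁ (s, 0)) 0 = k := by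
      have hts : Tendsto (fun s : ℂ => (s, (0 : ℂ))) (𝓝 0) (𝓝 (0, 0)) :=
        (Continuous.prodMk_left (0 : ℂ)).tendsto 0
      have : (fun s => A (s, 0)) =ᶠ[𝓝 0] id * fun s => A₁ (s, 0) := by
        filter_upwards [hts.eventually hAA₁] with s hs
        simpa using hs
      rw [analyticOrderAt_congr this, analyticOrderAt_mul analyticAt_id (hline hA₁),
        analyticOrderAt_id] at hord
      have h2 : (1 : ℕ∞) + analyticOrderAt (fun s => A₁ (s, 0)) 0 = 1 + k := by
        rw [hord]; push_cast; ring
      exact ENat.add_right_injective_of_ne_top ENat.one_ne_top h2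
    obtain ⟨U, hU, hU0, hAU⟩ := ih hA₁ hA₁κ hord₁
    refine ⟨U, hU, hU0, ?_⟩
    filter_upwards [hAA₁, hAU] with q h1 h2
    rw [h1, h2, smul_eq_mul]
    ring

/-- A function invariant by a rotation of order `m` is a function of the `m`-th power. -/
theorem exists_comp_pow_of_invariant {h : ℂ → ℂ} (hh : AnalyticAt ℂ h 0) {m : ℕ} (hm : m ≠ 0)
    {ζ : ℂ} (hζ : IsPrimitiveRoot ζ m) (hinv : ∀ᶠ s in 𝓝 (0 : ℂ), h (ζ * s) = h s) :
    ∃ V : ℂ → ℂ, AnalyticAt ℂ V 0 ∧ ∀ᶠ s in 𝓝 (0 : ℂ), V (s ^ m) = h s := by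
  obtain ⟨ε, hε, hball⟩ := Metric.eventually_nhds_iff_ball.1 (hinv.and hh.eventually_analyticAt)
  have hζn : ‖ζ‖ = 1 := hζ.norm'_eq_one hm
  have hpow : ∀ (j : ℕ), ∀ s ∈ Metric.ball (0 : ℂ) ε, h (ζ ^ j * s) = h s := by
    intro j
    induction j with
    | zero => simp
    | succ j ih =>
      intro s hs
      rw [pow_succ', mul_assoc]
      rw [(hball (ζ ^ j * s) ?_).1, ih s hs]
      rw [mem_ball_zero_iff] at hs ⊢
      simpa [hζn] using hs
  -- The principal root is discontinuous, but by invariance `h` takes the same value at all `m`-th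
  -- roots. So `V` is analytic off `0`, where `s ↦ s ^ m` is a local biholomorphism, and continuous
  -- at `0`; the singularity is removable.
  set V : ℂ → ℂ := fun u => h (u ^ ((1 : ℂ) / m))
  have hmC : (m : ℂ) ≠ 0 := by exact_mod_cast hm
  have hV : ∀ s ∈ Metric.ball (0 : ℂ) ε, V (s ^ m) = h s := by
    intro s hs
    by_cases hs0 : s = 0
    · simp [V, hs0, hm]
    have h1 : ((s ^ m) ^ ((1 : ℂ) / m) / s) ^ m = 1 := by
      rw [div_pow, one_div, Complex.cpow_nat_inv_pow _ hm, div_self (pow_ne_zero _ hs0)]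
    have : NeZero m := ⟨hm⟩
    obtain ⟨j, -, hj⟩ := hζ.eq_pow_of_pow_eq_one h1
    simp only [V]
    rw [← hpow j s hs, hj, div_mul_cancel₀ _ hs0]
  refine ⟨V, ?_, Metric.eventually_nhds_iff_ball.2 ⟨ε, hε, hV⟩⟩
  refine Complex.analyticAt_of_differentiable_on_punctured_nhds_of_continuousAt ?_ ?_
  · rw [eventually_nhdsWithin_iff]
    have hε' : 0 < ε ^ m := by positivity
    filter_upwards [Metric.ball_mem_nhds (0 : ℂ) hε'] with u hu hu0
    obtain ⟨s, hs⟩ := IsAlgClosed.exists_pow_nat_eq u (Nat.pos_of_ne_zero hm)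
    have hs0 : s ≠ 0 := by
      rintro rfl
      rw [zero_pow hm] at hs
      exact hu0 hs.symm
    have hsb : s ∈ Metric.ball (0 : ℂ) ε := by
      rw [mem_ball_zero_iff, ← hs, norm_pow] at hu
      rw [mem_ball_zero_iff]
      exact lt_of_pow_lt_pow_left₀ m hε.le hu
    have hd : deriv (fun s : ℂ => s ^ m) s ≠ 0 := by
      simp [hm, hs0]
    have ha : AnalyticAt ℂ (fun s : ℂ => s ^ m) s := analyticAt_id.pow m
    rw [← hs]
    refine AnalyticAt.differentiableAt ?_
    refine (analyticAt_comp_iff_of_deriv_ne_zero (g := V) ha hd).1 ?_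
    refine ((hball s hsb).2).congr ?_
    filter_upwards [Metric.isOpen_ball.mem_nhds hsb] with s' hs'
    exact (hV s' hs').symm
  · have hc : ContinuousAt (fun u : ℂ => u ^ ((1 : ℂ) / m)) 0 := by
      refine Complex.continuousAt_cpow_const_of_re_pos (Or.inl (by simp)) ?_
      rw [one_div, ← Complex.ofReal_natCast, ← Complex.ofReal_inv, Complex.ofReal_re]
      positivity
    refine ContinuousAt.comp (g := h) ?_ hc
    have : (0 : ℂ) ^ ((1 : ℂ) / m) = 0 := by simp [hmC]
    rw [this]
    exact hh.continuousAt

/-- Roots of analytic functions of one variable. -/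
theorem exists_eq_pow_of_analyticOrderAt {F : ℂ → ℂ} {t₀ : ℂ} (hF : AnalyticAt ℂ F t₀) {m : ℕ}
    (hm : m ≠ 0) (hord : analyticOrderAt F t₀ = m) :
    ∃ ψ : ℂ → ℂ, AnalyticAt ℂ ψ t₀ ∧ ψ t₀ = 0 ∧ deriv ψ t₀ ≠ 0 ∧
      ∀ᶠ t in 𝓝 t₀, F t = ψ t ^ m := by
  obtain ⟨u, hu, hu0, hFu⟩ := (hF.analyticOrderAt_eq_natCast).1 hord
  obtain ⟨c, hc⟩ := IsAlgClosed.exists_pow_nat_eq (u t₀) (Nat.pos_of_ne_zero hm)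
  have hc0 : c ≠ 0 := by
    rintro rfl
    rw [zero_pow hm] at hc
    exact hu0 hc.symm
  have hmC : (m : ℂ) ≠ 0 := by exact_mod_cast hm
  -- An `m`-th root of the unit `u`. Dividing by `u t₀` brings the argument of the logarithm close
  -- to `1`, inside the slit plane.
  set w : ℂ → ℂ := fun t => c * Complex.exp (Complex.log (u t / u t₀) / m)
  have hdiv : AnalyticAt ℂ (fun t => u t / u t₀) t₀ := hu.div analyticAt_const hu0
  have hone : u t₀ / u t₀ = 1 := div_self hu0
  have hw : AnalyticAt ℂ w t₀ := by
    refine analyticAt_const.mul (AnalyticAt.cexp (AnalyticAt.div ?_ analyticAt_const hmC))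
    refine hdiv.clog ?_
    rw [hone]
    exact Complex.one_mem_slitPlane
  have hwpow : ∀ᶠ t in 𝓝 t₀, w t ^ m = u t := by
    filter_upwards [hu.continuousAt.eventually_ne hu0] with t ht
    simp only [w]
    rw [mul_pow, hc, ← Complex.exp_nat_mul, mul_div_cancel₀ _ hmC,
      Complex.exp_log (div_ne_zero ht hu0), mul_div_cancel₀ _ hu0]
  have hw0 : w t₀ ≠ 0 := mul_ne_zero hc0 (Complex.exp_ne_zero _)
  have hψd : HasDerivAt (fun t => (t - t₀) * w t) (w t₀) t₀ := by
    have := ((hasDerivAt_id t₀).sub_const t₀).mul hw.differentiableAt.hasDerivAt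
    exact this.congr_deriv (by simp)
  refine ⟨fun t => (t - t₀) * w t, (analyticAt_id.sub analyticAt_const).mul hw, by simp,
    by rwa [hψd.deriv], ?_⟩
  filter_upwards [hFu, hwpow] with t h1 h2
  rw [h1, mul_pow, h2, smul_eq_mul]

/-- Solving `f₂ (x ℓ, t) = f₁ (x, t)` for two functions which agree on `{x = 0}` and are equally
tangent to the fibration by the lines `t = const`. -/
theorem exists_fibered_conjugacy {f₁ f₂ v₁ v₂ : ℂ × ℂ → ℂ} {t₀ : ℂ} (k : ℕ)
    (hv₁ : AnalyticAt ℂ v₁ (0, t₀)) (hv₂ : AnalyticAt ℂ v₂ (0, t₀))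
    (h₁ : v₁ (0, t₀) ≠ 0) (h₂ : v₂ (0, t₀) ≠ 0)
    (hf : ∀ᶠ t in 𝓝 t₀, f₁ (0, t) = f₂ (0, t))
    (hf₁ : ∀ᶠ q in 𝓝 ((0 : ℂ), t₀), f₁ q = f₁ (0, q.2) + q.1 * (q.2 - t₀) ^ k * v₁ q)
    (hf₂ : ∀ᶠ q in 𝓝 ((0 : ℂ), t₀), f₂ q = f₂ (0, q.2) + q.1 * (q.2 - t₀) ^ k * v₂ q) :
    ∃ ℓ : ℂ × ℂ → ℂ, AnalyticAt ℂ ℓ (0, t₀) ∧ ℓ (0, t₀) ≠ 0 ∧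
      ∀ᶠ q in 𝓝 ((0 : ℂ), t₀), f₂ (q.1 * ℓ q, q.2) = f₁ q := by
  set l₀ := v₁ (0, t₀) / v₂ (0, t₀)
  set S : (ℂ × ℂ) × ℂ → ℂ × ℂ := fun z => (z.1.1 * z.2, z.1.2)
  have hSa : AnalyticAt ℂ S ((0, t₀), l₀) := ContDiffAt.analyticAt (by fun_prop)
  have hS0 : S ((0, t₀), l₀) = (0, t₀) := by simp [S]
  have hvS : AnalyticAt ℂ (fun z => v₂ (S z)) ((0, t₀), l₀) := by
    refine AnalyticAt.comp (g := v₂) ?_ hSa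
    rwa [hS0]
  -- The difference `f₂ (xℓ, t) - f₁ (x, t)` is `x (t - t₀)^k` times `Ψ ((x, t), ℓ)`. After this
  -- factor is removed, the derivative in `ℓ` at the base point is `v₂ (0, t₀) ≠ 0`.
  set Ψ : (ℂ × ℂ) × ℂ → ℂ := fun z => z.2 * v₂ (S z) - v₁ z.1
  have hΨa : AnalyticAt ℂ Ψ ((0, t₀), l₀) :=
    (analyticAt_snd.mul hvS).sub (AnalyticAt.comp (g := v₁) hv₁ analyticAt_fst)
  have hcd : ContDiffAt ℂ ⊤ Ψ ((0, t₀), l₀) := hΨa.contDiffAt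
  have hinv : (fderiv ℂ Ψ ((0, t₀), l₀) ∘L .inr ℂ (ℂ × ℂ) ℂ).IsInvertible := by
    have hp : HasFDerivAt (fun l : ℂ => (((0 : ℂ), t₀), l)) (.inr ℂ (ℂ × ℂ) ℂ) l₀ :=
      (hasFDerivAt_const _ _).prodMk (hasFDerivAt_id _)
    have h3 := (hΨa.differentiableAt.hasFDerivAt).comp l₀ hp
    have h4 : HasDerivAt (fun l : ℂ => l * v₂ (0, t₀) - v₁ (0, t₀)) (v₂ (0, t₀)) l₀ := by
      simpa using ((hasDerivAt_id l₀).mul_const (v₂ (0, t₀))).sub_const (v₁ (0, t₀))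
    have h5 : (Ψ ∘ fun l : ℂ => (((0 : ℂ), t₀), l)) = fun l : ℂ => l * v₂ (0, t₀) - v₁ (0, t₀) := by
      ext l; simp [Ψ, S]
    rw [h5] at h3
    rw [h3.unique h4.hasFDerivAt]
    refine ⟨ContinuousLinearEquiv.smulLeft (Units.mk0 _ h₂), ?_⟩
    ext
    simp [Units.smul_def]
  have hne : (⊤ : WithTop ℕ∞) ≠ 0 := by simp
  have hΨ0 : Ψ ((0, t₀), l₀) = 0 := by
    simp [Ψ, S, l₀, div_mul_cancel₀ _ h₂]
  set ℓ := hcd.implicitFunction hne hinv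
  have hℓ0 : ℓ (0, t₀) = l₀ := hcd.implicitFunction_apply_self hne hinv
  have hℓa : AnalyticAt ℂ ℓ (0, t₀) := (hcd.contDiffAt_implicitFunction hne hinv).analyticAt
  refine ⟨ℓ, hℓa, by rw [hℓ0]; exact div_ne_zero h₁ h₂, ?_⟩
  have hev := hcd.eventually_apply_implicitFunction hne hinv
  rw [hΨ0] at hev
  have ht : Tendsto (fun q : ℂ × ℂ => (q.1 * ℓ q, q.2)) (𝓝 (0, t₀)) (𝓝 (0, t₀)) := by
    have hc : ContinuousAt (fun q : ℂ × ℂ => (q.1 * ℓ q, q.2)) (0, t₀) :=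
      (continuousAt_fst.mul hℓa.continuousAt).prodMk continuousAt_snd
    simpa [ContinuousAt] using hc
  filter_upwards [hev, ht.eventually hf₂, hf₁,
    (continuous_snd.tendsto ((0 : ℂ), t₀)).eventually hf] with q h3 h4 h5 h6
  rw [h4, h5, h6]
  have h7 : ℓ q * v₂ (q.1 * ℓ q, q.2) - v₁ q = 0 := h3
  linear_combination (q.1 * (q.2 - t₀) ^ k) * h7

/-! ### The blow-down map in charts -/

/-- The direction of the second coordinate of the chart `i`. -/
def fibDir (i : Fin 2) : ℂ × ℂ := if i = 0 then (0, 1) else (1, 0)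

/-- The coordinate of `ℂ²` defining the chart `i`. -/
def mainCoord (i : Fin 2) (p : ℂ × ℂ) : ℂ := if i = 0 then p.1 else p.2

/-- The other coordinate. -/
def sideCoord (i : Fin 2) (p : ℂ × ℂ) : ℂ := if i = 0 then p.2 else p.1

/-- The inverse of the blow-down map in the chart `i`. -/
def blowUp (i : Fin 2) (p : ℂ × ℂ) : ℂ × ℂ := (mainCoord i p, sideCoord i p / mainCoord i p)

theorem eq_zero_or_eq_one (i : Fin 2) : i = 0 ∨ i = 1 := by
  fin_cases i <;> simp

theorem blowDown_blowUp {i : Fin 2} {p : ℂ × ℂ} (h : mainCoord i p ≠ 0) :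
    blowDown i (blowUp i p) = p := by
  obtain rfl | rfl := eq_zero_or_eq_one i <;>
  · simp [blowDown, blowUp, mainCoord, sideCoord, dir] at h ⊢
    ext <;> simp [mul_div_cancel₀ _ h]

theorem mainCoord_blowDown (i : Fin 2) (q : ℂ × ℂ) : mainCoord i (blowDown i q) = q.1 := by
  obtain rfl | rfl := eq_zero_or_eq_one i <;> simp [blowDown, mainCoord, dir]

theorem sideCoord_blowDown (i : Fin 2) (q : ℂ × ℂ) : sideCoord i (blowDown i q) = q.1 * q.2 := by
  obtain rfl | rfl := eq_zero_or_eq_one i <;> simp [blowDown, sideCoord, dir]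

theorem blowUp_blowDown (i : Fin 2) {q : ℂ × ℂ} (h : q.1 ≠ 0) : blowUp i (blowDown i q) = q := by
  unfold blowUp
  rw [mainCoord_blowDown, sideCoord_blowDown, mul_div_cancel_left₀ _ h]

theorem blowDown_eq_zero {i : Fin 2} {q : ℂ × ℂ} : blowDown i q = 0 ↔ q.1 = 0 := by
  unfold blowDown
  rw [smul_eq_zero, or_iff_left (dir_ne_zero i q.2)]

theorem blowDown_injective {i : Fin 2} {q q' : ℂ × ℂ} (h : blowDown i q = blowDown i q')
    (h0 : q'.1 ≠ 0) : q = q' := by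
  have h1 : q.1 ≠ 0 := by
    rw [← mainCoord_blowDown i q, h, mainCoord_blowDown]
    exact h0
  rw [← blowUp_blowDown i h1, h, blowUp_blowDown i h0]

theorem contDiff_blowDown (i : Fin 2) : ContDiff ℂ ⊤ (blowDown i) := by
  obtain rfl | rfl := eq_zero_or_eq_one i
  · have : blowDown 0 = fun q : ℂ × ℂ => (q.1, q.1 * q.2) := by
      ext q <;> simp [blowDown, dir]
    rw [this]
    fun_prop
  · have : blowDown 1 = fun q : ℂ × ℂ => (q.1 * q.2, q.1) := by
      ext q <;> simp [blowDown, dir]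
    rw [this]
    fun_prop

theorem analyticAt_blowDown (i : Fin 2) (q : ℂ × ℂ) : AnalyticAt ℂ (blowDown i) q :=
  (contDiff_blowDown i).contDiffAt.analyticAt

theorem tendsto_blowDown (i : Fin 2) (t₀ : ℂ) : Tendsto (blowDown i) (𝓝 (0, t₀)) (𝓝 0) := by
  have := (contDiff_blowDown i).continuous.tendsto ((0 : ℂ), t₀)
  rwa [blowDown_eq_zero.2 rfl] at this

theorem fderiv_blowDown_apply (i : Fin 2) (q v : ℂ × ℂ) :
    fderiv ℂ (blowDown i) q v = v.1 • dir i q.2 + (q.1 * v.2) • fibDir i := by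
  have h1 : HasFDerivAt (fun q : ℂ × ℂ => dir i q.2)
      ((ContinuousLinearMap.snd ℂ ℂ ℂ).smulRight (fibDir i)) q := by
    have : (fun q : ℂ × ℂ => dir i q.2) = fun q => dir i 0 +
        ((ContinuousLinearMap.snd ℂ ℂ ℂ).smulRight (fibDir i)) q := by
      ext q <;> obtain rfl | rfl := eq_zero_or_eq_one i <;> simp [dir, fibDir]
    rw [this]
    exact (ContinuousLinearMap.hasFDerivAt _).const_add _
  have h2 : HasFDerivAt (blowDown i) _ q := (hasFDerivAt_fst (𝕜 := ℂ) (p := q)).smul h1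
  rw [h2.fderiv]
  simp [smul_smul, add_comm]

theorem det_fderiv_blowDown (i : Fin 2) (q : ℂ × ℂ) :
    (fderiv ℂ (blowDown i) q (1, 0)).1 * (fderiv ℂ (blowDown i) q (0, 1)).2
      - (fderiv ℂ (blowDown i) q (0, 1)).1 * (fderiv ℂ (blowDown i) q (1, 0)).2
      = (if i = 0 then 1 else -1) * q.1 := by
  simp only [fderiv_blowDown_apply]
  obtain rfl | rfl := eq_zero_or_eq_one i <;> simp [dir, fibDir]

theorem sign_ne_zero (i : Fin 2) : (if i = 0 then 1 else -1 : ℂ) ≠ 0 := by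
  obtain rfl | rfl := eq_zero_or_eq_one i <;> simp

theorem det_fderiv_blowDown_ne_zero (i : Fin 2) {q : ℂ × ℂ} (hq : q.1 ≠ 0) :
    (fderiv ℂ (blowDown i) q (1, 0)).1 * (fderiv ℂ (blowDown i) q (0, 1)).2
      - (fderiv ℂ (blowDown i) q (0, 1)).1 * (fderiv ℂ (blowDown i) q (1, 0)).2 ≠ 0 := by
  rw [det_fderiv_blowDown]
  exact mul_ne_zero (sign_ne_zero i) hq

/-! ### Points of the exceptional divisor -/

theorem mainCoord_smul (i : Fin 2) (c : ℂ) (v : ℂ × ℂ) : mainCoord i (c • v) = c * mainCoord i v := by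
  obtain rfl | rfl := eq_zero_or_eq_one i <;> simp [mainCoord]

theorem sideCoord_smul (i : Fin 2) (c : ℂ) (v : ℂ × ℂ) : sideCoord i (c • v) = c * sideCoord i v := by
  obtain rfl | rfl := eq_zero_or_eq_one i <;> simp [sideCoord]

theorem mainCoord_dir (i : Fin 2) (t : ℂ) : mainCoord i (dir i t) = 1 := by
  obtain rfl | rfl := eq_zero_or_eq_one i <;> simp [mainCoord, dir]

theorem sideCoord_dir (i : Fin 2) (t : ℂ) : sideCoord i (dir i t) = t := by
  obtain rfl | rfl := eq_zero_or_eq_one i <;> simp [sideCoord, dir]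

theorem eq_smul_dir {i : Fin 2} {v : ℂ × ℂ} (h : mainCoord i v ≠ 0) :
    v = mainCoord i v • dir i (sideCoord i v / mainCoord i v) :=
  (blowDown_blowUp h).symm

theorem mk_eq_pt_iff {i : Fin 2} {t : ℂ} {v : ℂ × ℂ} (hv : v ≠ 0) :
    Projectivization.mk ℂ v hv = pt i t ↔
      mainCoord i v ≠ 0 ∧ sideCoord i v / mainCoord i v = t := by
  unfold pt
  rw [Projectivization.mk_eq_mk_iff']
  constructor
  · rintro ⟨a, ha⟩
    have ha0 : a ≠ 0 := by
      rintro rfl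
      exact hv (by rw [← ha, zero_smul])
    rw [← ha, mainCoord_smul, sideCoord_smul, mainCoord_dir, sideCoord_dir, mul_one]
    exact ⟨ha0, mul_div_cancel_left₀ _ ha0⟩
  · rintro ⟨h1, h2⟩
    exact ⟨mainCoord i v, by rw [← h2]; exact (eq_smul_dir h1).symm⟩

theorem pt_injective (i : Fin 2) : Function.Injective (pt i) := by
  intro s t h
  have := ((mk_eq_pt_iff (dir_ne_zero i s)).1 h).2
  rwa [mainCoord_dir, sideCoord_dir, div_one] at this

theorem exists_mainCoord_ne_zero {v : ℂ × ℂ} (hv : v ≠ 0) : ∃ i, mainCoord i v ≠ 0 := by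
  by_contra hcon
  push Not at hcon
  exact hv (Prod.ext (by simpa [mainCoord] using hcon 0) (by simpa [mainCoord] using hcon 1))

theorem exists_eq_pt (p : ExcDiv) : ∃ i t, p = pt i t := by
  induction p using Projectivization.ind with
  | h v hv =>
    obtain ⟨i, hi⟩ := exists_mainCoord_ne_zero hv
    exact ⟨i, _, (mk_eq_pt_iff hv).2 ⟨hi, rfl⟩⟩

/-! ### Local generators -/

theorem wedge_eq_zero_trans {a b c : ℂ × ℂ →L[ℂ] ℂ} (hb : b ≠ 0) (hab : wedge a b = 0)
    (hbc : wedge b c = 0) : wedge a c = 0 := by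
  obtain ⟨u, rfl⟩ := (wedge_eq_zero_iff hb).1 hab
  unfold wedge at hbc ⊢
  simp only [smul_apply, smul_eq_mul]
  linear_combination u * hbc

theorem wedge_swap (a b : ℂ × ℂ →L[ℂ] ℂ) : wedge a b = -wedge b a := by
  unfold wedge; ring

theorem wedge_smul_left (c : ℂ) (a b : ℂ × ℂ →L[ℂ] ℂ) : wedge (c • a) b = c * wedge a b := by
  unfold wedge; simp only [smul_apply, smul_eq_mul]; ring

theorem wedge_smul_right (c : ℂ) (a b : ℂ × ℂ →L[ℂ] ℂ) : wedge a (c • b) = c * wedge a b := by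
  unfold wedge; simp only [smul_apply, smul_eq_mul]; ring

theorem wedge_add_left (a a' b : ℂ × ℂ →L[ℂ] ℂ) : wedge (a + a') b = wedge a b + wedge a' b := by
  unfold wedge; simp only [add_apply]; ring

theorem wedge_self (a : ℂ × ℂ →L[ℂ] ℂ) : wedge a a = 0 := by
  unfold wedge; ring

theorem comp_ne_zero_of_det_ne_zero {a : ℂ × ℂ →L[ℂ] ℂ} {M : ℂ × ℂ →L[ℂ] ℂ × ℂ} (ha : a ≠ 0)
    (hM : (M (1, 0)).1 * (M (0, 1)).2 - (M (0, 1)).1 * (M (1, 0)).2 ≠ 0) : a.comp M ≠ 0 := by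
  intro h
  obtain ⟨b, hb⟩ : ∃ b, wedge a b ≠ 0 := by
    by_contra hcon
    push Not at hcon
    refine ha (covector_ext ?_ ?_)
    · simpa [wedge] using hcon (ContinuousLinearMap.snd ℂ ℂ ℂ)
    · simpa [wedge] using hcon (ContinuousLinearMap.fst ℂ ℂ ℂ)
  have := wedge_comp a b M
  rw [h] at this
  simp only [wedge, zero_apply, zero_mul, sub_zero] at this
  exact mul_ne_zero hb hM this.symm

/-- The pull-back of a form defining `F` by the blow-down map in the chart `i`. -/
def FoliationGerm.pullback (F : FoliationGerm) (i : Fin 2) (q : ℂ × ℂ) : ℂ × ℂ →L[ℂ] ℂ :=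
  (F.form (blowDown i q)).comp (fderiv ℂ (blowDown i) q)

theorem FoliationGerm.analyticAt_pullback (F : FoliationGerm) (i : Fin 2) (t₀ : ℂ) :
    AnalyticAt ℂ (F.pullback i) (0, t₀) := by
  refine analyticAt_clm_comp (AnalyticAt.comp (g := F.form) ?_ (analyticAt_blowDown i _))
    (analyticAt_blowDown i _).fderiv
  rw [blowDown_eq_zero.2 rfl]
  exact F.analyticAt

theorem eventually_blowDown_of_nhdsNE {P : ℂ × ℂ → Prop} (h : ∀ᶠ p in 𝓝[≠] (0 : ℂ × ℂ), P p)
    (i : Fin 2) (t₀ : ℂ) : ∀ᶠ q in 𝓝 ((0 : ℂ), t₀), q.1 ≠ 0 → P (blowDown i q) := by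
  filter_upwards [(tendsto_blowDown i t₀).eventually (eventually_nhdsWithin_iff.1 h)] with q hq h0
  exact hq fun h => h0 (blowDown_eq_zero.1 h)

theorem FoliationGerm.pullback_ne_zero (F : FoliationGerm) (i : Fin 2) (t₀ : ℂ) :
    ∀ᶠ q in 𝓝 ((0 : ℂ), t₀), q.1 ≠ 0 → F.pullback i q ≠ 0 := by
  filter_upwards [eventually_blowDown_of_nhdsNE F.saturated i t₀] with q hq h0
  exact comp_ne_zero_of_det_ne_zero (hq h0) (det_fderiv_blowDown_ne_zero i h0)

/-- Since `η` does not vanish at the point, collinearity alone provides the analytic factor `k`.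
Generators can thus be tested by the vanishing of a wedge, which is needed only off the exceptional
divisor by continuity. -/
theorem FoliationGerm.isLocalGenerator_iff (F : FoliationGerm) (i : Fin 2) (t₀ : ℂ)
    (η : ℂ × ℂ → (ℂ × ℂ →L[ℂ] ℂ)) :
    F.IsLocalGenerator i t₀ η ↔ AnalyticAt ℂ η (0, t₀) ∧ η (0, t₀) ≠ 0 ∧
      ∀ᶠ q in 𝓝 ((0 : ℂ), t₀), wedge (F.pullback i q) (η q) = 0 := by
  refine and_congr_right fun hη => and_congr_right fun h0 => ⟨?_, fun h => ?_⟩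
  · rintro ⟨k, -, hk⟩
    filter_upwards [hk] with q hq
    unfold FoliationGerm.pullback
    rw [hq, wedge_smul_left, wedge_self, mul_zero]
  · obtain ⟨k, hk, hkη⟩ := exists_eq_smul_of_wedge_eq_zero (F.analyticAt_pullback i t₀) hη h0 h
    exact ⟨k, hk, hkη⟩

/-- A form collinear to a generator off the exceptional divisor is collinear to it. -/
theorem FoliationGerm.IsLocalGenerator.wedge_eq_zero {F : FoliationGerm} {i : Fin 2} {t₀ : ℂ}
    {η α : ℂ × ℂ → (ℂ × ℂ →L[ℂ] ℂ)} (hη : F.IsLocalGenerator i t₀ η)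
    (hα : AnalyticAt ℂ α (0, t₀))
    (h : ∀ᶠ q in 𝓝 ((0 : ℂ), t₀), q.1 ≠ 0 → wedge (α q) (F.pullback i q) = 0) :
    ∀ᶠ q in 𝓝 ((0 : ℂ), t₀), wedge (α q) (η q) = 0 := by
  obtain ⟨hηa, -, hw⟩ := (F.isLocalGenerator_iff i t₀ η).1 hη
  refine eventually_eq_of_fst_ne_zero (AnalyticAt.eventually_continuousAt (analyticAt_wedge hα hηa))
    (.of_forall fun _ => continuousAt_const) ?_
  filter_upwards [hw, h, F.pullback_ne_zero i t₀] with q h1 h2 h3 h4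
  exact wedge_eq_zero_trans (h3 h4) (h2 h4) h1

/-- Two generators differ by a unit. -/
theorem FoliationGerm.IsLocalGenerator.exists_unit {F : FoliationGerm} {i : Fin 2} {t₀ : ℂ}
    {η η' : ℂ × ℂ → (ℂ × ℂ →L[ℂ] ℂ)} (hη : F.IsLocalGenerator i t₀ η)
    (hη' : F.IsLocalGenerator i t₀ η') :
    ∃ u : ℂ × ℂ → ℂ, AnalyticAt ℂ u (0, t₀) ∧ u (0, t₀) ≠ 0 ∧
      ∀ᶠ q in 𝓝 ((0 : ℂ), t₀), η' q = u q • η q := by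
  obtain ⟨hηa', h0', hw'⟩ := (F.isLocalGenerator_iff i t₀ η').1 hη'
  have hw := hη.wedge_eq_zero hηa' (by
    filter_upwards [hw'] with q hq _
    rw [wedge_swap, hq, neg_zero])
  obtain ⟨u, hu, hev⟩ := exists_eq_smul_of_wedge_eq_zero hηa' hη.1 hη.2.1 hw
  refine ⟨u, hu, fun h => h0' ?_, hev⟩
  rw [hev.self_of_nhds, h]
  exact zero_smul ℂ (η (0, t₀))

/-- Near `(0, t₀)`, the generator at this point is a generator at the points `(0, t)`. -/
theorem FoliationGerm.IsLocalGenerator.eventually {F : FoliationGerm} {i : Fin 2} {t₀ : ℂ}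
    {η : ℂ × ℂ → (ℂ × ℂ →L[ℂ] ℂ)} (hη : F.IsLocalGenerator i t₀ η) :
    ∀ᶠ t in 𝓝 t₀, F.IsLocalGenerator i t η := by
  obtain ⟨hηa, h0, hw⟩ := (F.isLocalGenerator_iff i t₀ η).1 hη
  have ht : Tendsto (fun t : ℂ => ((0 : ℂ), t)) (𝓝 t₀) (𝓝 (0, t₀)) :=
    (Continuous.prodMk_right (0 : ℂ)).tendsto t₀
  filter_upwards [ht.eventually hηa.eventually_analyticAt,
    ht.eventually (hηa.continuousAt.eventually_ne h0), ht.eventually hw.eventually_nhds]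
    with t h1 h2 h3
  exact (F.isLocalGenerator_iff i t η).2 ⟨h1, h2, h3⟩

/-! ### The group of germs of biholomorphisms -/

theorem BiholGerm.tendsto (Φ : BiholGerm) : Tendsto Φ.toFun (𝓝 0) (𝓝 0) := by
  have := Φ.analyticAt.continuousAt.tendsto
  rwa [Φ.map_zero] at this

theorem BiholGerm.analyticAt_comp {G : Type*} [NormedAddCommGroup G] [NormedSpace ℂ G]
    (Φ : BiholGerm) {f : ℂ × ℂ → G} (hf : AnalyticAt ℂ f 0) :
    AnalyticAt ℂ (fun p => f (Φ.toFun p)) 0 :=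
  AnalyticAt.comp (g := f) (by rw [Φ.map_zero]; exact hf) Φ.analyticAt

/-- `Ψ` is the inverse germ of `Φ`. -/
structure BiholGerm.IsInverse (Φ Ψ : BiholGerm) : Prop where
  left : ∀ᶠ p in 𝓝 (0 : ℂ × ℂ), Ψ.toFun (Φ.toFun p) = p
  right : ∀ᶠ p in 𝓝 (0 : ℂ × ℂ), Φ.toFun (Ψ.toFun p) = p
  linear_left : ∀ v, Ψ.linearPart (Φ.linearPart v) = v
  linear_right : ∀ v, Φ.linearPart (Ψ.linearPart v) = v

theorem BiholGerm.IsInverse.symm {Φ Ψ : BiholGerm} (h : Φ.IsInverse Ψ) : Ψ.IsInverse Φ :=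
  ⟨h.right, h.left, h.linear_right, h.linear_left⟩

theorem BiholGerm.exists_inverse (Φ : BiholGerm) : ∃ Ψ, Φ.IsInverse Ψ := by
  obtain ⟨ζ, hζ, hζ0, hl, hr⟩ := exists_analytic_local_inverse Φ.analyticAt Φ.hasFDerivAt
  rw [Φ.map_zero] at hζ hζ0 hr
  refine ⟨⟨ζ, hζ, hζ0, Φ.linearPart.symm, ?_⟩, hl, hr, fun v => by simp, fun v => by simp⟩
  have h0 : HasFDerivAt Φ.toFun (Φ.linearPart : ℂ × ℂ →L[ℂ] ℂ × ℂ) (ζ 0) := by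
    rw [hζ0]; exact Φ.hasFDerivAt
  exact HasFDerivAt.of_local_left_inverse hζ.continuousAt h0 hr

theorem BiholGerm.IsInverse.onE_onE {Φ Ψ : BiholGerm} (h : Φ.IsInverse Ψ) (p : ExcDiv) :
    Ψ.onE (Φ.onE p) = p := by
  induction p using Projectivization.ind with
  | h v hv =>
    unfold BiholGerm.onE
    simp only [Projectivization.map_mk, ContinuousLinearEquiv.coe_toLinearEquiv,
      LinearEquiv.coe_coe, h.linear_left]

theorem BiholGerm.IsInverse.fderiv_comp {Φ Ψ : BiholGerm} (h : Φ.IsInverse Ψ) :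
    ∀ᶠ p in 𝓝 (0 : ℂ × ℂ), (fderiv ℂ Ψ.toFun (Φ.toFun p)).comp (fderiv ℂ Φ.toFun p)
      = ContinuousLinearMap.id ℂ (ℂ × ℂ) := by
  filter_upwards [h.left.eventually_nhds, Φ.analyticAt.eventually_analyticAt,
    Φ.tendsto.eventually Ψ.analyticAt.eventually_analyticAt] with p h1 h2 h3
  rw [← _root_.fderiv_comp p h3.differentiableAt h2.differentiableAt]
  exact (Filter.EventuallyEq.fderiv_eq (f := id) h1).trans fderiv_id

theorem BiholGerm.IsInverse.fderiv_comp' {Φ Ψ : BiholGerm} (h : Φ.IsInverse Ψ) :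
    ∀ᶠ p in 𝓝 (0 : ℂ × ℂ), (fderiv ℂ Φ.toFun p).comp (fderiv ℂ Ψ.toFun (Φ.toFun p))
      = ContinuousLinearMap.id ℂ (ℂ × ℂ) := by
  filter_upwards [Φ.tendsto.eventually h.symm.fderiv_comp, h.left] with p h1 h2
  rwa [h2] at h1

theorem BiholGerm.MapsTo.symm {Φ Ψ : BiholGerm} {F₁ F₂ : FoliationGerm} (hΦ : Φ.MapsTo F₁ F₂)
    (h : Φ.IsInverse Ψ) : Ψ.MapsTo F₂ F₁ := by
  obtain ⟨u, hu, hu0, hev⟩ := hΦ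
  refine ⟨fun p => (u (Ψ.toFun p))⁻¹, ?_, inv_ne_zero (by rwa [Ψ.map_zero]), ?_⟩
  · exact (Ψ.analyticAt_comp hu).inv (by rw [Ψ.map_zero]; exact hu0)
  filter_upwards [Ψ.tendsto.eventually hev, h.right, h.symm.fderiv_comp,
    Ψ.tendsto.eventually (hu.continuousAt.eventually_ne hu0)] with p h1 h2 h3 h4
  rw [h2] at h1
  rw [eq_inv_smul_iff₀ h4, ← ContinuousLinearMap.smul_comp, ← h1, ContinuousLinearMap.comp_assoc,
    h3, ContinuousLinearMap.comp_id]

/-- The composition `Φ ∘ Ψ`. -/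
def BiholGerm.comp (Φ Ψ : BiholGerm) : BiholGerm where
  toFun p := Φ.toFun (Ψ.toFun p)
  analyticAt := Ψ.analyticAt_comp Φ.analyticAt
  map_zero := by rw [Ψ.map_zero, Φ.map_zero]
  linearPart := Ψ.linearPart.trans Φ.linearPart
  hasFDerivAt := by
    have h0 : HasFDerivAt Φ.toFun (Φ.linearPart : ℂ × ℂ →L[ℂ] ℂ × ℂ) (Ψ.toFun 0) := by
      rw [Ψ.map_zero]; exact Φ.hasFDerivAt
    exact h0.comp 0 Ψ.hasFDerivAt

theorem BiholGerm.fderiv_comp (Φ Ψ : BiholGerm) : ∀ᶠ p in 𝓝 (0 : ℂ × ℂ),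
    fderiv ℂ (Φ.comp Ψ).toFun p
      = (fderiv ℂ Φ.toFun (Ψ.toFun p)).comp (fderiv ℂ Ψ.toFun p) := by
  filter_upwards [Ψ.analyticAt.eventually_analyticAt,
    Ψ.tendsto.eventually Φ.analyticAt.eventually_analyticAt] with p h1 h2
  exact _root_.fderiv_comp p h2.differentiableAt h1.differentiableAt

theorem BiholGerm.onE_comp (Φ Ψ : BiholGerm) (p : ExcDiv) :
    (Φ.comp Ψ).onE p = Φ.onE (Ψ.onE p) := by
  induction p using Projectivization.ind with
  | h v hv => rfl

theorem BiholGerm.MapsTo.comp {Φ Ψ : BiholGerm} {F₁ F₂ F₃ : FoliationGerm}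
    (hΦ : Φ.MapsTo F₂ F₃) (hΨ : Ψ.MapsTo F₁ F₂) : (Φ.comp Ψ).MapsTo F₁ F₃ := by
  obtain ⟨u, hu, hu0, hev⟩ := hΦ
  obtain ⟨v, hv, hv0, hev'⟩ := hΨ
  refine ⟨fun p => u (Ψ.toFun p) * v p, (Ψ.analyticAt_comp hu).mul hv,
    mul_ne_zero (by rwa [Ψ.map_zero]) hv0, ?_⟩
  filter_upwards [Φ.fderiv_comp Ψ, Ψ.tendsto.eventually hev, hev'] with p h1 h2 h3
  rw [h1, ← ContinuousLinearMap.comp_assoc]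
  change ((F₃.form (Φ.toFun (Ψ.toFun p))).comp (fderiv ℂ Φ.toFun (Ψ.toFun p))).comp
    (fderiv ℂ Ψ.toFun p) = _
  rw [h2, ContinuousLinearMap.smul_comp, h3, smul_smul]

/-- The pull-back of a foliation by a biholomorphism. -/
def FoliationGerm.pullbackGerm (F : FoliationGerm) (Φ : BiholGerm) : FoliationGerm where
  form p := (F.form (Φ.toFun p)).comp (fderiv ℂ Φ.toFun p)
  analyticAt := analyticAt_clm_comp (Φ.analyticAt_comp F.analyticAt) Φ.analyticAt.fderiv
  saturated := by
    obtain ⟨Ψ, h⟩ := Φ.exists_inverse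
    have h1 := Φ.tendsto.eventually (eventually_nhdsWithin_iff.1 F.saturated)
    refine eventually_nhdsWithin_iff.2 ?_
    filter_upwards [h1, h.left, h.fderiv_comp'] with p h1 h2 h3 h4 h5
    refine h1 (fun h6 => h4 ?_) ?_
    · change p = 0
      rw [← h2, h6, Ψ.map_zero]
    · rw [← ContinuousLinearMap.comp_id (F.form (Φ.toFun p)), ← h3,
        ← ContinuousLinearMap.comp_assoc, h5, ContinuousLinearMap.zero_comp]

theorem FoliationGerm.mapsTo_pullbackGerm (F : FoliationGerm) (Φ : BiholGerm) :
    Φ.MapsTo (F.pullbackGerm Φ) F :=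
  ⟨fun _ => 1, analyticAt_const, one_ne_zero, .of_forall fun _ => (one_smul ℂ _).symm⟩

/-! ### Lifts to the blow-up -/

/-- `T` is the lift of `Φ` to the blow-up, from the chart `i` at `t₀` to the chart `j` at `s₀`. -/
structure BiholGerm.IsLift (Φ : BiholGerm) (i : Fin 2) (t₀ : ℂ) (j : Fin 2) (s₀ : ℂ)
    (T : ℂ × ℂ → ℂ × ℂ) : Prop where
  analyticAt : AnalyticAt ℂ T (0, t₀)
  base : T (0, t₀) = (0, s₀)
  fst_eq_zero : ∀ᶠ t in 𝓝 t₀, (T (0, t)).1 = 0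
  comm : ∀ᶠ q in 𝓝 ((0 : ℂ), t₀), blowDown j (T q) = Φ.toFun (blowDown i q)
  onE : ∀ᶠ t in 𝓝 t₀, Φ.onE (pt i t) = pt j (T (0, t)).2

theorem analyticAt_mainCoord_comp {E : Type*} [NormedAddCommGroup E] [NormedSpace ℂ E]
    {M : E → ℂ × ℂ} {a : E} (j : Fin 2) (hM : AnalyticAt ℂ M a) :
    AnalyticAt ℂ (fun q => mainCoord j (M q)) a := by
  obtain rfl | rfl := eq_zero_or_eq_one j
  · exact analyticAt_fst.comp hM
  · exact analyticAt_snd.comp hM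

theorem analyticAt_sideCoord_comp {E : Type*} [NormedAddCommGroup E] [NormedSpace ℂ E]
    {M : E → ℂ × ℂ} {a : E} (j : Fin 2) (hM : AnalyticAt ℂ M a) :
    AnalyticAt ℂ (fun q => sideCoord j (M q)) a := by
  obtain rfl | rfl := eq_zero_or_eq_one j
  · exact analyticAt_snd.comp hM
  · exact analyticAt_fst.comp hM

theorem tendsto_zero_prodMk (t₀ : ℂ) :
    Tendsto (fun t : ℂ => ((0 : ℂ), t)) (𝓝 t₀) (𝓝 (0, t₀)) :=
  (Continuous.prodMk_right (0 : ℂ)).tendsto t₀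

theorem BiholGerm.onE_pt_eq_iff (Φ : BiholGerm) (i : Fin 2) (t : ℂ) (j : Fin 2) (s : ℂ) :
    Φ.onE (pt i t) = pt j s ↔ mainCoord j (Φ.linearPart (dir i t)) ≠ 0 ∧
      sideCoord j (Φ.linearPart (dir i t)) / mainCoord j (Φ.linearPart (dir i t)) = s :=
  mk_eq_pt_iff (v := Φ.linearPart (dir i t))
    (fun h => dir_ne_zero i t (Φ.linearPart.map_eq_zero_iff.1 h))

/-- `Φ ∘ blowDown i` vanishes on `{x = 0}`, so it is `x M` with `M` analytic. Comparing
`x`-derivatives on the divisor gives `M (0, t) = DΦ(0) (dir i t)`. In the target chart the lift is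
`x` times the main coordinate of `M`, together with the quotient of the two coordinates of `M`. -/
theorem BiholGerm.exists_isLift (Φ : BiholGerm) {i : Fin 2} {t₀ : ℂ} {j : Fin 2} {s₀ : ℂ}
    (h : Φ.onE (pt i t₀) = pt j s₀) : ∃ T, Φ.IsLift i t₀ j s₀ T := by
  have hHa : AnalyticAt ℂ (fun q => Φ.toFun (blowDown i q)) (0, t₀) :=
    AnalyticAt.comp (g := Φ.toFun) (by rw [blowDown_eq_zero.2 rfl]; exact Φ.analyticAt)
      (analyticAt_blowDown i _)
  have hH0 (t : ℂ) : Φ.toFun (blowDown i (0, t)) = 0 := by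
    rw [blowDown_eq_zero.2 rfl, Φ.map_zero]
  obtain ⟨M, hM, hHM, -⟩ := exists_eq_smul_of_eq_zero hHa (.of_forall hH0)
  have hM0 : ∀ᶠ t in 𝓝 t₀, M (0, t) = Φ.linearPart (dir i t) := by
    filter_upwards [(tendsto_zero_prodMk t₀).eventually hM.eventually_analyticAt,
      (tendsto_zero_prodMk t₀).eventually hHM.eventually_nhds] with t h1 h2
    have e1 : HasFDerivAt (fun q : ℂ × ℂ => q.1 • M q) _ ((0 : ℂ), t) :=
      (hasFDerivAt_fst (𝕜 := ℂ)).smul h1.differentiableAt.hasFDerivAt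
    have e2 : HasFDerivAt (fun q => Φ.toFun (blowDown i q))
        ((Φ.linearPart : ℂ × ℂ →L[ℂ] ℂ × ℂ).comp (fderiv ℂ (blowDown i) (0, t))) ((0 : ℂ), t) := by
      refine HasFDerivAt.comp (g := Φ.toFun) _ ?_
        (analyticAt_blowDown i _).differentiableAt.hasFDerivAt
      rw [blowDown_eq_zero.2 rfl]
      exact Φ.hasFDerivAt
    have := DFunLike.congr_fun (e1.unique (e2.congr_of_eventuallyEq
      (h2.mono fun _ h => h.symm))) ((1 : ℂ), (0 : ℂ))
    simpa [fderiv_blowDown_apply] using this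
  obtain ⟨hm, hs⟩ := (Φ.onE_pt_eq_iff i t₀ j s₀).1 h
  rw [← hM0.self_of_nhds] at hm hs
  have hma := analyticAt_mainCoord_comp j hM
  refine ⟨fun q => (q.1 * mainCoord j (M q), sideCoord j (M q) / mainCoord j (M q)),
    (analyticAt_fst.mul hma).prod ((analyticAt_sideCoord_comp j hM).div hma hm),
    by simp [hs], .of_forall fun t => by simp, ?_, ?_⟩
  · filter_upwards [hHM, hma.continuousAt.eventually_ne hm] with q h1 h2
    rw [h1]
    conv_rhs => rw [eq_smul_dir h2, smul_smul]
    rfl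
  · filter_upwards [hM0, (tendsto_zero_prodMk t₀).eventually (hma.continuousAt.eventually_ne hm)]
      with t h1 h2
    rw [Φ.onE_pt_eq_iff, ← h1]
    exact ⟨h2, rfl⟩

namespace BiholGerm.IsLift

variable {Φ Ψ : BiholGerm} {i j : Fin 2} {t₀ s₀ : ℂ} {T T' : ℂ × ℂ → ℂ × ℂ}

theorem tendsto (h : Φ.IsLift i t₀ j s₀ T) : Tendsto T (𝓝 (0, t₀)) (𝓝 (0, s₀)) := by
  have := h.analyticAt.continuousAt.tendsto
  rwa [h.base] at this

theorem analyticAt_comp {G : Type*} [NormedAddCommGroup G] [NormedSpace ℂ G]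
    (h : Φ.IsLift i t₀ j s₀ T) {f : ℂ × ℂ → G} (hf : AnalyticAt ℂ f (0, s₀)) :
    AnalyticAt ℂ (fun q => f (T q)) (0, t₀) :=
  AnalyticAt.comp (g := f) (by rw [h.base]; exact hf) h.analyticAt

/-- Off the divisor this follows from the injectivity of the blow-down map; the divisor itself is
reached by continuity. -/
theorem left_inverse (h : Φ.IsLift i t₀ j s₀ T) (h' : Ψ.IsLift j s₀ i t₀ T')
    (hΦ : Φ.IsInverse Ψ) : ∀ᶠ q in 𝓝 ((0 : ℂ), t₀), T' (T q) = q := by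
  refine eventually_eq_of_fst_ne_zero
    (AnalyticAt.eventually_continuousAt (h.analyticAt_comp h'.analyticAt))
    (.of_forall fun _ => continuousAt_id) ?_
  filter_upwards [h.comm, h.tendsto.eventually h'.comm,
    (tendsto_blowDown i t₀).eventually hΦ.left] with q h1 h2 h3 h4
  refine blowDown_injective (i := i) ?_ h4
  rw [h2, h1, h3]

theorem fderiv_comp (h : Φ.IsLift i t₀ j s₀ T) (h' : Ψ.IsLift j s₀ i t₀ T')
    (hΦ : Φ.IsInverse Ψ) : ∀ᶠ q in 𝓝 ((0 : ℂ), t₀),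
      (fderiv ℂ T' (T q)).comp (fderiv ℂ T q) = ContinuousLinearMap.id ℂ (ℂ × ℂ) := by
  filter_upwards [(h.left_inverse h' hΦ).eventually_nhds, h.analyticAt.eventually_analyticAt,
    h.tendsto.eventually h'.analyticAt.eventually_analyticAt] with p h1 h2 h3
  rw [← _root_.fderiv_comp p h3.differentiableAt h2.differentiableAt]
  exact (Filter.EventuallyEq.fderiv_eq (f := id) h1).trans fderiv_id

theorem fderiv_comp' (h : Φ.IsLift i t₀ j s₀ T) (h' : Ψ.IsLift j s₀ i t₀ T')
    (hΦ : Φ.IsInverse Ψ) : ∀ᶠ q in 𝓝 ((0 : ℂ), t₀),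
      (fderiv ℂ T q).comp (fderiv ℂ T' (T q)) = ContinuousLinearMap.id ℂ (ℂ × ℂ) := by
  filter_upwards [h.tendsto.eventually (h'.fderiv_comp h hΦ.symm), h.left_inverse h' hΦ]
    with q h1 h2
  rwa [h2] at h1

/-- The map induced on the exceptional divisor. -/
theorem analyticAt_snd (h : Φ.IsLift i t₀ j s₀ T) : AnalyticAt ℂ (fun t => (T (0, t)).2) t₀ := by
  have h1 : AnalyticAt ℂ (fun t : ℂ => ((0 : ℂ), t)) t₀ := analyticAt_const.prod analyticAt_id
  exact (_root_.analyticAt_snd (𝕜 := ℂ)).comp (AnalyticAt.comp (g := T) h.analyticAt h1)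

theorem eq_prod (h : Φ.IsLift i t₀ j s₀ T) : ∀ᶠ t in 𝓝 t₀, T (0, t) = (0, (T (0, t)).2) := by
  filter_upwards [h.fst_eq_zero] with t h1
  exact Prod.ext h1 rfl

theorem fderiv_snd (h : Φ.IsLift i t₀ j s₀ T) : ∀ᶠ t in 𝓝 t₀,
    fderiv ℂ T (0, t) (0, 1) = (0, deriv (fun t => (T (0, t)).2) t) := by
  filter_upwards [h.eq_prod.eventually_nhds, h.analyticAt_snd.eventually_analyticAt,
    (tendsto_zero_prodMk t₀).eventually h.analyticAt.eventually_analyticAt] with t h1 h2 h3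
  have e1 : HasDerivAt (fun s : ℂ => T (0, s)) (fderiv ℂ T (0, t) (0, 1)) t :=
    h3.differentiableAt.hasFDerivAt.comp_hasDerivAt t
      ((hasDerivAt_const t (0 : ℂ)).prodMk (hasDerivAt_id t))
  have e2 : HasDerivAt (fun s : ℂ => ((0 : ℂ), (T (0, s)).2))
      (0, deriv (fun t => (T (0, t)).2) t) t :=
    (hasDerivAt_const t (0 : ℂ)).prodMk h2.differentiableAt.hasDerivAt
  exact e1.unique (e2.congr_of_eventuallyEq h1)

theorem deriv_snd_ne_zero (h : Φ.IsLift i t₀ j s₀ T) (h' : Ψ.IsLift j s₀ i t₀ T')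
    (hΦ : Φ.IsInverse Ψ) : deriv (fun t => (T (0, t)).2) t₀ ≠ 0 := by
  intro h0
  have h1 := h.fderiv_snd.self_of_nhds
  have h2 := DFunLike.congr_fun (h.fderiv_comp h' hΦ).self_of_nhds ((0 : ℂ), (1 : ℂ))
  rw [ContinuousLinearMap.comp_apply, h1, h0] at h2
  have h3 : ((0 : ℂ), (0 : ℂ)) = 0 := rfl
  rw [h3, _root_.map_zero] at h2
  simpa using congrArg Prod.snd h2

/-- The derivative of the commutation relation. -/
theorem fderiv_comm (h : Φ.IsLift i t₀ j s₀ T) : ∀ᶠ q in 𝓝 ((0 : ℂ), t₀),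
    (fderiv ℂ (blowDown j) (T q)).comp (fderiv ℂ T q)
      = (fderiv ℂ Φ.toFun (blowDown i q)).comp (fderiv ℂ (blowDown i) q) := by
  filter_upwards [h.comm.eventually_nhds, h.analyticAt.eventually_analyticAt,
    (tendsto_blowDown i t₀).eventually Φ.analyticAt.eventually_analyticAt] with q h1 h2 h3
  rw [← _root_.fderiv_comp q (analyticAt_blowDown j _).differentiableAt h2.differentiableAt,
    ← _root_.fderiv_comp q h3.differentiableAt (analyticAt_blowDown i _).differentiableAt]
  exact Filter.EventuallyEq.fderiv_eq h1

end BiholGerm.IsLift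

/-! ### Transport along a biholomorphism: generators, holonomy -/

theorem FoliationGerm.IsLocalGenerator.congr {F : FoliationGerm} {i : Fin 2} {t₀ : ℂ}
    {η η' : ℂ × ℂ → (ℂ × ℂ →L[ℂ] ℂ)} (hη : F.IsLocalGenerator i t₀ η)
    (h : ∀ᶠ q in 𝓝 ((0 : ℂ), t₀), η q = η' q) : F.IsLocalGenerator i t₀ η' := by
  obtain ⟨h1, h2, k, hk, h3⟩ := hη
  refine ⟨h1.congr h, by rwa [← h.self_of_nhds], k, hk, ?_⟩
  filter_upwards [h3, h] with q h3 h4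
  rw [h3, h4]

section

variable {Φ Ψ : BiholGerm} {F₁ F₂ : FoliationGerm} {i j : Fin 2} {t₀ s₀ : ℂ} {T T' : ℂ × ℂ → ℂ × ℂ}

theorem BiholGerm.MapsTo.pullback_comp (hF : Φ.MapsTo F₁ F₂) (hT : Φ.IsLift i t₀ j s₀ T) :
    ∀ᶠ q in 𝓝 ((0 : ℂ), t₀), ∃ c : ℂ, c ≠ 0 ∧
      (F₂.pullback j (T q)).comp (fderiv ℂ T q) = c • F₁.pullback i q := by
  obtain ⟨u, hu, hu0, hev⟩ := hF
  filter_upwards [hT.fderiv_comm, hT.comm, (tendsto_blowDown i t₀).eventually hev,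
    (tendsto_blowDown i t₀).eventually (hu.continuousAt.eventually_ne hu0)] with q h1 h2 h3 h4
  refine ⟨_, h4, ?_⟩
  unfold FoliationGerm.pullback
  rw [ContinuousLinearMap.comp_assoc, h1, h2, ← ContinuousLinearMap.comp_assoc, h3,
    ContinuousLinearMap.smul_comp]

theorem FoliationGerm.IsLocalGenerator.comp_lift {η : ℂ × ℂ → (ℂ × ℂ →L[ℂ] ℂ)}
    (hη : F₂.IsLocalGenerator j s₀ η) (hF : Φ.MapsTo F₁ F₂) (hΦ : Φ.IsInverse Ψ)
    (hT : Φ.IsLift i t₀ j s₀ T) (hT' : Ψ.IsLift j s₀ i t₀ T') :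
    F₁.IsLocalGenerator i t₀ fun q => (η (T q)).comp (fderiv ℂ T q) := by
  obtain ⟨h1, h2, h3⟩ := (F₂.isLocalGenerator_iff j s₀ η).1 hη
  refine (F₁.isLocalGenerator_iff i t₀ _).2 ⟨analyticAt_clm_comp (hT.analyticAt_comp h1)
    hT.analyticAt.fderiv, fun h0 => h2 ?_, ?_⟩
  · rw [← ContinuousLinearMap.comp_id (η (0, s₀)), ← hT.base,
      ← (hT.fderiv_comp' hT' hΦ).self_of_nhds, ← ContinuousLinearMap.comp_assoc, h0,
      ContinuousLinearMap.zero_comp]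
  · filter_upwards [hT.tendsto.eventually h3, hF.pullback_comp hT] with q e1 e2
    obtain ⟨c, hc, e2⟩ := e2
    refine (mul_eq_zero.1 ?_).resolve_left hc
    rw [← wedge_smul_left, ← e2, wedge_comp, e1, zero_mul]

theorem BiholGerm.MapsTo.inD (hF : Φ.MapsTo F₁ F₂) (h : F₂.InD) : F₁.InD := by
  obtain ⟨Ψ, hΦ⟩ := Φ.exists_inverse
  intro i t₀
  obtain ⟨j, s₀, hj⟩ := exists_eq_pt (Φ.onE (pt i t₀))
  obtain ⟨T, hT⟩ := Φ.exists_isLift hj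
  obtain ⟨T', hT'⟩ := Ψ.exists_isLift (i := j) (t₀ := s₀) (j := i) (s₀ := t₀)
    (by rw [← hj, hΦ.onE_onE])
  obtain ⟨η, hη⟩ := h j s₀
  exact ⟨_, hη.comp_lift hF hΦ hT hT'⟩

/-- The lift preserves the divisor, so its differential multiplies the tangent vector `(0, 1)` by
the derivative of the induced map, a unit. The order is otherwise only transported by a local change
of coordinate. -/
theorem FoliationGerm.IsLocalGenerator.analyticOrderAt_comp_lift {η : ℂ × ℂ → (ℂ × ℂ →L[ℂ] ℂ)}
    (hη : F₂.IsLocalGenerator j s₀ η) (hΦ : Φ.IsInverse Ψ)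
    (hT : Φ.IsLift i t₀ j s₀ T) (hT' : Ψ.IsLift j s₀ i t₀ T') :
    analyticOrderAt (fun t : ℂ => ((η (T (0, t))).comp (fderiv ℂ T (0, t))) (0, 1)) t₀
      = analyticOrderAt (fun t : ℂ => η (0, t) (0, 1)) s₀ := by
  have hd := hT.deriv_snd_ne_zero hT' hΦ
  have hτ := hT.analyticAt_snd
  have hev : ∀ᶠ t in 𝓝 t₀, ((η (T (0, t))).comp (fderiv ℂ T (0, t))) (0, 1)
      = deriv (fun t => (T (0, t)).2) t * η (0, (T (0, t)).2) (0, 1) := by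
    filter_upwards [hT.fderiv_snd, hT.eq_prod] with t h1 h2
    rw [ContinuousLinearMap.comp_apply, h1, covector_apply, ← h2]
    ring
  have hb : (T (0, t₀)).2 = s₀ := by rw [hT.base]
  have ha : AnalyticAt ℂ (fun s : ℂ => η (0, s) (0, 1)) (T (0, t₀)).2 := by
    rw [hb]
    exact analyticAt_covector_apply (AnalyticAt.comp (g := η) hη.1
      (analyticAt_const.prod analyticAt_id)) _
  rw [analyticOrderAt_congr hev]
  change analyticOrderAt ((deriv fun t => (T (0, t)).2) *
    ((fun s : ℂ => η (0, s) (0, 1)) ∘ fun t => (T (0, t)).2)) t₀ = _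
  rw [analyticOrderAt_mul hτ.deriv (AnalyticAt.comp (f := fun t => (T (0, t)).2) ha hτ), hτ.deriv.analyticOrderAt_eq_zero.2 hd, zero_add,
    analyticOrderAt_comp_of_deriv_ne_zero hτ hd, hb]

theorem FoliationGerm.HasTangencyOrder.comp_lift {r : ℕ} (h : F₂.HasTangencyOrder j s₀ r)
    (hF : Φ.MapsTo F₁ F₂) (hΦ : Φ.IsInverse Ψ)
    (hT : Φ.IsLift i t₀ j s₀ T) (hT' : Ψ.IsLift j s₀ i t₀ T') : F₁.HasTangencyOrder i t₀ r := by
  obtain ⟨η, hη, hr⟩ := h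
  exact ⟨_, hη.comp_lift hF hΦ hT hT', (hη.analyticOrderAt_comp_lift hΦ hT hT').trans hr⟩

theorem FoliationGerm.IsFirstIntegral.comp_lift {f : ℂ × ℂ → ℂ} (h : F₂.IsFirstIntegral j s₀ f)
    (hF : Φ.MapsTo F₁ F₂) (hΦ : Φ.IsInverse Ψ)
    (hT : Φ.IsLift i t₀ j s₀ T) (hT' : Ψ.IsLift j s₀ i t₀ T') :
    F₁.IsFirstIntegral i t₀ fun q => f (T q) := by
  refine ⟨hT.analyticAt_comp h.1, (h.2.comp_lift hF hΦ hT hT').congr ?_⟩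
  filter_upwards [hT.tendsto.eventually h.1.eventually_analyticAt,
    hT.analyticAt.eventually_analyticAt] with q h1 h2
  exact (fderiv_comp q h1.differentiableAt h2.differentiableAt).symm

/-- The holonomy germ `h` at the point `t₀` of the chart `i`, in the coordinate of this chart. -/
def FoliationGerm.IsHolonomyInChart (F : FoliationGerm) (i : Fin 2) (t₀ : ℂ)
    (h : ExcDiv → ExcDiv) : Prop :=
  ∃ (r : ℕ) (f : ℂ × ℂ → ℂ) (ψ g : ℂ → ℂ),
    1 ≤ r ∧ F.HasTangencyOrder i t₀ r ∧ F.IsFirstIntegral i t₀ f ∧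
    AnalyticAt ℂ ψ t₀ ∧ ψ t₀ = 0 ∧ deriv ψ t₀ ≠ 0 ∧
    (∀ᶠ t in 𝓝 t₀, f (0, t) = ψ t ^ (r + 1)) ∧
    AnalyticAt ℂ g t₀ ∧ g t₀ = t₀ ∧
    (∀ᶠ t in 𝓝 t₀, ψ (g t) = Complex.exp (2 * Real.pi * Complex.I / ((r : ℂ) + 1)) * ψ t) ∧
    ∀ᶠ t in 𝓝 t₀, h (pt i t) = pt i (g t)

theorem FoliationGerm.IsHolonomyInChart.isHolonomyAt {F : FoliationGerm} {h : ExcDiv → ExcDiv}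
    (hh : F.IsHolonomyInChart i t₀ h) : F.IsHolonomyAt (pt i t₀) h := by
  obtain ⟨r, f, ψ, g, hr⟩ := hh
  exact ⟨i, t₀, r, f, ψ, g, rfl, hr⟩

theorem FoliationGerm.IsHolonomyAt.exists_chart {F : FoliationGerm} {p : ExcDiv}
    {h : ExcDiv → ExcDiv} (hh : F.IsHolonomyAt p h) :
    ∃ i t₀, p = pt i t₀ ∧ F.IsHolonomyInChart i t₀ h := by
  obtain ⟨i, t₀, r, f, ψ, g, hp, hr⟩ := hh
  exact ⟨i, t₀, hp, r, f, ψ, g, hr⟩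

/-- A primitive first integral composed with the lift is again primitive, with root `ψ ∘ τ` on the
divisor, where `τ` is the map induced there; the rotation in the coordinate `ψ ∘ τ` is the conjugate
of `g` by `τ`. -/
theorem FoliationGerm.IsHolonomyInChart.comp_lift {h : ExcDiv → ExcDiv}
    (hh : F₂.IsHolonomyInChart j s₀ h) (hF : Φ.MapsTo F₁ F₂) (hΦ : Φ.IsInverse Ψ)
    (hT : Φ.IsLift i t₀ j s₀ T) (hT' : Ψ.IsLift j s₀ i t₀ T') :
    F₁.IsHolonomyInChart i t₀ (Ψ.onE ∘ h ∘ Φ.onE) := by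
  obtain ⟨r, f, ψ, g, hr, htan, hf, hψ, hψ0, hψd, hfψ, hg, hg0, hψg, hhg⟩ := hh
  have hτ := hT.analyticAt_snd
  have hτ' := hT'.analyticAt_snd
  have hb : (T (0, t₀)).2 = s₀ := by rw [hT.base]
  have hb' : (T' (0, s₀)).2 = t₀ := by rw [hT'.base]
  have ht : Tendsto (fun t => (T (0, t)).2) (𝓝 t₀) (𝓝 s₀) := by
    have := hτ.continuousAt.tendsto
    rwa [hb] at this
  have hgt : Tendsto g (𝓝 s₀) (𝓝 s₀) := by
    have := hg.continuousAt.tendsto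
    rwa [hg0] at this
  have hinv : ∀ᶠ s in 𝓝 s₀, (T (0, (T' (0, s)).2)).2 = s := by
    filter_upwards [(tendsto_zero_prodMk s₀).eventually (hT'.left_inverse hT hΦ.symm),
      hT'.eq_prod] with s h1 h2
    rw [← h2, h1]
  have hga : AnalyticAt ℂ (fun t => g (T (0, t)).2) t₀ :=
    AnalyticAt.comp (g := g) (by rw [hb]; exact hg) hτ
  refine ⟨r, fun q => f (T q), fun t => ψ (T (0, t)).2,
    fun t => (T' (0, g (T (0, t)).2)).2, hr, htan.comp_lift hF hΦ hT hT',
    hf.comp_lift hF hΦ hT hT', AnalyticAt.comp (g := ψ) (by rw [hb]; exact hψ) hτ,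
    by simp only [hb, hψ0], ?_, ?_, ?_, by simp only [hb, hg0, hb'], ?_, ?_⟩
  · have e1 : HasDerivAt ψ (deriv ψ s₀) (T (0, t₀)).2 := by
      rw [hb]; exact hψ.differentiableAt.hasDerivAt
    have e2 : HasDerivAt (fun t => ψ (T (0, t)).2) _ t₀ :=
      e1.comp t₀ hτ.differentiableAt.hasDerivAt
    rw [e2.deriv]
    exact mul_ne_zero hψd (hT.deriv_snd_ne_zero hT' hΦ)
  · filter_upwards [ht.eventually hfψ, hT.eq_prod] with t h1 h2
    rw [h2]
    exact h1
  · exact AnalyticAt.comp (g := fun s => (T' (0, s)).2) (by rw [hb, hg0]; exact hτ') hga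
  · filter_upwards [ht.eventually hψg, (hgt.comp ht).eventually hinv] with t h1 h2
    rw [← h1]
    exact congrArg ψ h2
  · filter_upwards [ht.eventually hhg, hT.onE, (hgt.comp ht).eventually hT'.onE] with t h1 h2 h3
    simp only [Function.comp_apply, h2, h1]
    exact h3

theorem FoliationGerm.IsHolonomyAt.comp_onE {p : ExcDiv} {h : ExcDiv → ExcDiv}
    (hh : F₂.IsHolonomyAt (Φ.onE p) h) (hF : Φ.MapsTo F₁ F₂) (hΦ : Φ.IsInverse Ψ) :
    F₁.IsHolonomyAt p (Ψ.onE ∘ h ∘ Φ.onE) := by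
  obtain ⟨j, s₀, hp, hc⟩ := hh.exists_chart
  obtain ⟨i, t₀, rfl⟩ := exists_eq_pt p
  obtain ⟨T, hT⟩ := Φ.exists_isLift hp
  obtain ⟨T', hT'⟩ := Ψ.exists_isLift (i := j) (t₀ := s₀) (j := i) (s₀ := t₀)
    (by rw [← hp, hΦ.onE_onE])
  exact (hc.comp_lift hF hΦ hT hT').isHolonomyAt

end

/-! ### Transport of radial fields and tangency divisors -/

/-- The pull-back of a radial vector field. -/
theorem RadialField.exists_pullback (X : RadialField) {Φ Ψ : BiholGerm} (hΦ : Φ.IsInverse Ψ) :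
    ∃ X₁ : RadialField,
      ∀ p, X₁.toFun p = fderiv ℂ Ψ.toFun (Φ.toFun p) (X.toFun (Φ.toFun p)) := by
  refine ⟨⟨fun p => fderiv ℂ Ψ.toFun (Φ.toFun p) (X.toFun (Φ.toFun p)),
    analyticAt_clm_apply (Φ.analyticAt_comp Ψ.analyticAt.fderiv) (Φ.analyticAt_comp X.analyticAt),
    by rw [Φ.map_zero, X.map_zero, _root_.map_zero], ?_⟩, fun _ => rfl⟩
  have h1 := (Φ.analyticAt_comp Ψ.analyticAt.fderiv).differentiableAt.hasFDerivAt
  have h2 : HasFDerivAt X.toFun (ContinuousLinearMap.id ℂ (ℂ × ℂ)) (Φ.toFun 0) := by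
    rw [Φ.map_zero]; exact X.hasFDerivAt
  have h3 := h1.clm_apply (h2.comp 0 Φ.hasFDerivAt)
  refine h3.congr_fderiv ?_
  ext <;>
    simp [Φ.map_zero, X.map_zero, Ψ.hasFDerivAt.fderiv, hΦ.linear_left]

section

variable {Φ Ψ : BiholGerm} {F₁ F₂ : FoliationGerm} {X₁ X₂ : RadialField}

theorem BiholGerm.IsInverse.fderiv_radialField (hΦ : Φ.IsInverse Ψ)
    (hX : ∀ p, X₁.toFun p = fderiv ℂ Ψ.toFun (Φ.toFun p) (X₂.toFun (Φ.toFun p))) :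
    ∀ᶠ p in 𝓝 (0 : ℂ × ℂ), fderiv ℂ Φ.toFun p (X₁.toFun p) = X₂.toFun (Φ.toFun p) := by
  filter_upwards [hΦ.fderiv_comp'] with p h
  rw [hX, ← ContinuousLinearMap.comp_apply, h]
  rfl

theorem FoliationGerm.analyticAt_tang (F : FoliationGerm) (X : RadialField) :
    AnalyticAt ℂ (F.tang X) 0 := analyticAt_clm_apply F.analyticAt X.analyticAt

theorem FoliationGerm.apply_tangentField (F : FoliationGerm) (a : ℂ × ℂ →L[ℂ] ℂ) (p : ℂ × ℂ) :
    a (F.tangentField p) = wedge a (F.form p) := by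
  rw [covector_apply]
  unfold FoliationGerm.tangentField wedge
  ring

/-- The tangency equations satisfy `g₂ ∘ Φ = u g₁` with the same unit `u` as for the forms, and
invariance of a curve does not depend on the choice of its equation. -/
theorem FoliationGerm.IsHomogeneousWrt.comp (h : F₂.IsHomogeneousWrt X₂) (hF : Φ.MapsTo F₁ F₂)
    (hΦ : Φ.IsInverse Ψ)
    (hX : ∀ p, X₁.toFun p = fderiv ℂ Ψ.toFun (Φ.toFun p) (X₂.toFun (Φ.toFun p))) :
    F₁.IsHomogeneousWrt X₁ := by
  obtain ⟨u, hu, hu0, hev⟩ := hF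
  have hg : ∀ᶠ p in 𝓝 (0 : ℂ × ℂ), F₂.tang X₂ (Φ.toFun p) = u p * F₁.tang X₁ p := by
    filter_upwards [hΦ.fderiv_radialField hX, hev] with p h1 h2
    unfold FoliationGerm.tang
    rw [← h1, ← ContinuousLinearMap.comp_apply, h2]
    rfl
  refine ⟨fun h0 => h.1 ?_, ?_⟩
  · filter_upwards [Ψ.tendsto.eventually hg, Ψ.tendsto.eventually h0, hΦ.right] with p h1 h2 h3
    rw [h3, h2, mul_zero] at h1
    exact h1
  obtain ⟨k, hk, hkev⟩ := h.2
  -- The cofactor for `g₁` comes from differentiating `u g₁ = g₂ ∘ Φ` along the foliation: the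
  -- Jacobian determinant of `Φ` enters through `wedge_comp`, and the second term removes the
  -- derivative of `u`.
  refine ⟨fun p => (((fderiv ℂ Φ.toFun p (1, 0)).1 * (fderiv ℂ Φ.toFun p (0, 1)).2
    - (fderiv ℂ Φ.toFun p (0, 1)).1 * (fderiv ℂ Φ.toFun p (1, 0)).2) * k (Φ.toFun p)
    - wedge (fderiv ℂ u p) (F₁.form p)) / u p, ?_, ?_⟩
  · have hD (v : ℂ × ℂ) : AnalyticAt ℂ (fun p => fderiv ℂ Φ.toFun p v) 0 :=
      analyticAt_clm_apply Φ.analyticAt.fderiv analyticAt_const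
    exact AnalyticAt.div ((((analyticAt_fst.comp (hD _)).mul (analyticAt_snd.comp (hD _))).sub
      ((analyticAt_fst.comp (hD _)).mul (analyticAt_snd.comp (hD _)))).mul
      (Φ.analyticAt_comp hk) |>.sub (analyticAt_wedge hu.fderiv F₁.analyticAt)) hu hu0
  filter_upwards [hg.eventually_nhds, hev, Φ.tendsto.eventually hkev,
    hu.continuousAt.eventually_ne hu0, hu.eventually_analyticAt,
    (F₁.analyticAt_tang X₁).eventually_analyticAt, Φ.analyticAt.eventually_analyticAt,
    Φ.tendsto.eventually (F₂.analyticAt_tang X₂).eventually_analyticAt]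
    with p h1 h2 h3 h4 h5 h6 h7 h8
  rw [F₂.apply_tangentField] at h3
  rw [F₁.apply_tangentField]
  have e1 : fderiv ℂ (fun p => F₂.tang X₂ (Φ.toFun p)) p
      = (fderiv ℂ (F₂.tang X₂) (Φ.toFun p)).comp (fderiv ℂ Φ.toFun p) :=
    fderiv_comp p h8.differentiableAt h7.differentiableAt
  have e2 : fderiv ℂ (fun p => F₂.tang X₂ (Φ.toFun p)) p
      = u p • fderiv ℂ (F₁.tang X₁) p + F₁.tang X₁ p • fderiv ℂ u p :=
    (Filter.EventuallyEq.fderiv_eq h1).trans (fderiv_mul h5.differentiableAt h6.differentiableAt)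
  have e3 := wedge_comp (fderiv ℂ (F₂.tang X₂) (Φ.toFun p)) (F₂.form (Φ.toFun p))
    (fderiv ℂ Φ.toFun p)
  rw [h2, h3, ← e1, e2, h1.self_of_nhds, wedge_smul_right, wedge_add_left, wedge_smul_left,
    wedge_smul_left] at e3
  rw [div_mul_eq_mul_div, eq_div_iff h4]
  refine mul_left_cancel₀ h4 ?_
  linear_combination e3

/-- The generator is pulled back by the lift and the vector field by the differential of the inverse
lift, so the pairing `η(Y)` is merely composed with the lift. -/
theorem FoliationGerm.IsTangRestrict.comp {D₁ D₂ : ExcDiv →₀ ℕ} (h : F₂.IsTangRestrict X₂ D₂)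
    (hF : Φ.MapsTo F₁ F₂) (hΦ : Φ.IsInverse Ψ)
    (hX : ∀ p, X₁.toFun p = fderiv ℂ Ψ.toFun (Φ.toFun p) (X₂.toFun (Φ.toFun p)))
    (hD : ∀ p, D₁ p = D₂ (Φ.onE p)) : F₁.IsTangRestrict X₁ D₁ := by
  intro i t₀
  obtain ⟨j, s₀, hp⟩ := exists_eq_pt (Φ.onE (pt i t₀))
  obtain ⟨T, hT⟩ := Φ.exists_isLift hp
  have hq : Ψ.onE (pt j s₀) = pt i t₀ := by rw [← hp, hΦ.onE_onE]
  obtain ⟨T', hT'⟩ := Ψ.exists_isLift hq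
  obtain ⟨η, Y, hη, ⟨hY, hY0, k, hk, hkY⟩, hord⟩ := h j s₀
  have hτ := hT.analyticAt_snd
  have hb : (T (0, t₀)).2 = s₀ := by rw [hT.base]
  refine ⟨_, fun q => fderiv ℂ T' (T q) (Y (T q)), hη.comp_lift hF hΦ hT hT',
    ⟨analyticAt_clm_apply (hT.analyticAt_comp hT'.analyticAt.fderiv) (hT.analyticAt_comp hY),
      fun h0 => hY0 ?_, fun q => k (T q), hT.analyticAt_comp hk, ?_⟩, ?_⟩
  · have := DFunLike.congr_fun (hT.fderiv_comp' hT' hΦ).self_of_nhds (Y (0, s₀))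
    have h0' : fderiv ℂ T' (T (0, t₀)) (Y (T (0, t₀))) = 0 := h0
    rw [ContinuousLinearMap.comp_apply, ← hT.base, h0', _root_.map_zero] at this
    rw [← hT.base]
    exact this.symm
  · filter_upwards [hT.tendsto.eventually hkY, hT.tendsto.eventually hT'.fderiv_comm,
      hT.left_inverse hT' hΦ, hT.comm] with q h1 h2 h3 h4
    rw [h3, h4] at h2
    rw [h4] at h1
    rw [hX, ← h1, ← ContinuousLinearMap.comp_apply, ← h2, ContinuousLinearMap.comp_apply, map_smul,
      map_smul, map_smul]
  · have ha : AnalyticAt ℂ (fun s : ℂ => η (0, s) (Y (0, s))) (T (0, t₀)).2 := by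
      rw [hb]
      have hz : AnalyticAt ℂ (fun s : ℂ => ((0 : ℂ), s)) s₀ := analyticAt_const.prod analyticAt_id
      exact analyticAt_clm_apply (AnalyticAt.comp (g := η) hη.1 hz) (AnalyticAt.comp (g := Y) hY hz)
    have hev : ∀ᶠ t in 𝓝 t₀, ((η (T (0, t))).comp (fderiv ℂ T (0, t)))
        (fderiv ℂ T' (T (0, t)) (Y (T (0, t))))
        = ((fun s : ℂ => η (0, s) (Y (0, s))) ∘ fun t => (T (0, t)).2) t := by
      filter_upwards [(tendsto_zero_prodMk t₀).eventually (hT.fderiv_comp' hT' hΦ), hT.eq_prod]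
        with t h1 h2
      have h3 := DFunLike.congr_fun h1 (Y (T (0, t)))
      rw [ContinuousLinearMap.comp_apply] at h3
      rw [ContinuousLinearMap.comp_apply, h3, Function.comp_apply, ← h2]
      rfl
    rw [analyticOrderAt_congr hev, analyticOrderAt_comp_of_deriv_ne_zero hτ
      (hT.deriv_snd_ne_zero hT' hΦ), hb, hord, hD, hp]

end

/-! ### Transport of the multiplicity -/

theorem analyticAt_flip {V E F G : Type*} [NormedAddCommGroup V] [NormedSpace ℂ V]
    [NormedAddCommGroup E] [NormedSpace ℂ E] [NormedAddCommGroup F] [NormedSpace ℂ F]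
    [NormedAddCommGroup G] [NormedSpace ℂ G] {c : V → E →L[ℂ] F →L[ℂ] G} {x : V}
    (hc : AnalyticAt ℂ c x) : AnalyticAt ℂ (fun y => (c y).flip) x := by
  have : AnalyticAt ℂ (fun c : E →L[ℂ] F →L[ℂ] G => c.flip) (c x) :=
    (IsBoundedLinearMap.contDiff (n := ⊤) ⟨⟨fun _ _ => rfl, fun _ _ => rfl⟩, 1, one_pos,
      fun c => by rw [ContinuousLinearMap.opNorm_flip, one_mul]⟩).contDiffAt.analyticAt
  exact this.comp hc

theorem analyticAt_precomp {V D E F : Type*} [NormedAddCommGroup V] [NormedSpace ℂ V]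
    [NormedAddCommGroup D] [NormedSpace ℂ D] [NormedAddCommGroup E] [NormedSpace ℂ E]
    [NormedAddCommGroup F] [NormedSpace ℂ F] {u : V → D →L[ℂ] E} {x : V}
    (hu : AnalyticAt ℂ u x) :
    AnalyticAt ℂ (fun y => (ContinuousLinearMap.compL ℂ D E F).flip (u y)) x := by
  have : AnalyticAt ℂ (fun v : D →L[ℂ] E => (ContinuousLinearMap.compL ℂ D E F).flip v) (u x) :=
    ContinuousLinearMap.analyticAt (E := D →L[ℂ] E) _ _
  exact this.comp hu

theorem analyticAt_postcomp {V D E F : Type*} [NormedAddCommGroup V] [NormedSpace ℂ V]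
    [NormedAddCommGroup D] [NormedSpace ℂ D] [NormedAddCommGroup E] [NormedSpace ℂ E]
    [NormedAddCommGroup F] [NormedSpace ℂ F] {u : V → E →L[ℂ] F} {x : V}
    (hu : AnalyticAt ℂ u x) :
    AnalyticAt ℂ (fun y => ContinuousLinearMap.compL ℂ D E F (u y)) x := by
  have : AnalyticAt ℂ (fun v : E →L[ℂ] F => ContinuousLinearMap.compL ℂ D E F v) (u x) :=
    ContinuousLinearMap.analyticAt (E := E →L[ℂ] F) _ _
  exact this.comp hu
-- The form suited to induction on the order of vanishing: one derivative is traded for a change of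
-- target space.
theorem iteratedFDeriv_succ_eq_zero_iff {E F : Type*} [NormedAddCommGroup E] [NormedSpace ℂ E]
    [NormedAddCommGroup F] [NormedSpace ℂ F] {f : E → F} {x : E} {m : ℕ} :
    (∀ j < m + 1, iteratedFDeriv ℂ j f x = 0) ↔
      f x = 0 ∧ ∀ j < m, iteratedFDeriv ℂ j (fderiv ℂ f) x = 0 := by
  have h0 : iteratedFDeriv ℂ 0 f x = 0 ↔ f x = 0 := by
    rw [← norm_eq_zero, norm_iteratedFDeriv_zero, norm_eq_zero]
  have hs (j : ℕ) : iteratedFDeriv ℂ (j + 1) f x = 0 ↔ iteratedFDeriv ℂ j (fderiv ℂ f) x = 0 := by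
    rw [← norm_eq_zero, ← norm_iteratedFDeriv_fderiv, norm_eq_zero]
  constructor
  · intro h
    exact ⟨h0.1 (h 0 (by omega)), fun j hj => (hs j).1 (h (j + 1) (by omega))⟩
  · rintro ⟨h1, h2⟩ (_ | j) hj
    · exact h0.2 h1
    · exact (hs j).2 (h2 j (by omega))

/-- Order of vanishing is not decreased by composition and multiplication by operators. -/
theorem BiholGerm.iteratedFDeriv_comp_eq_zero (Ψ : BiholGerm) (m : ℕ) :
    ∀ {F G : Type} [NormedAddCommGroup F] [NormedSpace ℂ F] [NormedAddCommGroup G]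
      [NormedSpace ℂ G] [CompleteSpace F] [CompleteSpace G]
      {f : ℂ × ℂ → F} {A : ℂ × ℂ → (F →L[ℂ] G)}, AnalyticAt ℂ f 0 →
      AnalyticAt ℂ A 0 → (∀ j < m, iteratedFDeriv ℂ j f 0 = 0) →
      ∀ j < m, iteratedFDeriv ℂ j (fun p => A p (f (Ψ.toFun p))) 0 = 0 := by
  induction m with
  | zero => intro _ _ _ _ _ _ _ _ _ _ _ _ _ j hj; omega
  | succ m ih =>
    intro F G _ _ _ _ _ _ f A hf hA h
    rw [iteratedFDeriv_succ_eq_zero_iff] at h ⊢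
    refine ⟨by rw [Ψ.map_zero, h.1, _root_.map_zero], fun j hj => ?_⟩
    -- The product rule splits the derivative into an operator applied to `f ∘ Ψ` and an operator
    -- applied to `Df ∘ Ψ`. Both fall under the induction hypothesis, which is stated for all target
    -- spaces because `Df` takes values in another space than `f`.
    have h1 := ih hf (A := fun p => (fderiv ℂ A p).flip)
      (analyticAt_flip hA.fderiv)
      (fun j hj => (iteratedFDeriv_succ_eq_zero_iff.2 h) j (by omega)) j hj
    have hB : AnalyticAt ℂ (fun p => (ContinuousLinearMap.compL ℂ (ℂ × ℂ) F G (A p)).comp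
        ((ContinuousLinearMap.compL ℂ (ℂ × ℂ) (ℂ × ℂ) F).flip (fderiv ℂ Ψ.toFun p))) 0 :=
      analyticAt_clm_comp (analyticAt_postcomp hA) (analyticAt_precomp Ψ.analyticAt.fderiv)
    have h2 := ih hf.fderiv hB h.2 j hj
    have hev : fderiv ℂ (fun p => A p (f (Ψ.toFun p))) =ᶠ[𝓝 0]
        (fun p => (fderiv ℂ A p).flip (f (Ψ.toFun p))) +
        fun p => ((ContinuousLinearMap.compL ℂ (ℂ × ℂ) F G (A p)).comp
        ((ContinuousLinearMap.compL ℂ (ℂ × ℂ) (ℂ × ℂ) F).flip (fderiv ℂ Ψ.toFun p)))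
          (fderiv ℂ f (Ψ.toFun p)) := by
      filter_upwards [hA.eventually_analyticAt, Ψ.analyticAt.eventually_analyticAt,
        Ψ.tendsto.eventually hf.eventually_analyticAt] with p e1 e2 e3
      have e4 : HasFDerivAt (fun p => f (Ψ.toFun p)) _ p :=
        e3.differentiableAt.hasFDerivAt.comp p e2.differentiableAt.hasFDerivAt
      rw [(e1.differentiableAt.hasFDerivAt.clm_apply e4).fderiv]
      ext <;> simp [add_comm]
    have ha1 := analyticAt_clm_apply (analyticAt_flip hA.fderiv) (Ψ.analyticAt_comp hf)
    have ha2 := analyticAt_clm_apply hB (Ψ.analyticAt_comp hf.fderiv)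
    rw [(hev.iteratedFDeriv ℂ j).self_of_nhds, iteratedFDeriv_add_apply ha1.contDiffAt ha2.contDiffAt]
    exact (congrArg₂ (· + ·) h1 h2).trans (add_zero _)

theorem BiholGerm.MapsTo.iteratedFDeriv_eq_zero {Φ : BiholGerm} {F₁ F₂ : FoliationGerm}
    (hF : Φ.MapsTo F₁ F₂) {m : ℕ} (h : ∀ j < m, iteratedFDeriv ℂ j F₂.form 0 = 0) :
    ∀ j < m, iteratedFDeriv ℂ j F₁.form 0 = 0 := by
  obtain ⟨u, hu, hu0, hev⟩ := hF
  intro j hj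
  have hA : AnalyticAt ℂ (fun p => (u p)⁻¹ •
      (ContinuousLinearMap.compL ℂ (ℂ × ℂ) (ℂ × ℂ) ℂ).flip (fderiv ℂ Φ.toFun p)) 0 :=
    (hu.inv hu0).smul (analyticAt_precomp Φ.analyticAt.fderiv)
  have h1 := Φ.iteratedFDeriv_comp_eq_zero m F₂.analyticAt hA h j hj
  rw [← h1]
  refine (Filter.EventuallyEq.iteratedFDeriv ℂ ?_ j).self_of_nhds
  filter_upwards [hev, hu.continuousAt.eventually_ne hu0] with p h2 h3
  have h4 : ((u p)⁻¹ • (ContinuousLinearMap.compL ℂ (ℂ × ℂ) (ℂ × ℂ) ℂ).flip (fderiv ℂ Φ.toFun p))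
      (F₂.form (Φ.toFun p)) = (u p)⁻¹ • ((F₂.form (Φ.toFun p)).comp (fderiv ℂ Φ.toFun p)) := rfl
  rw [h4, h2, inv_smul_smul₀ h3]

/-- A conjugacy cannot lower the order of vanishing; the same statement for the inverse germ turns
the inequality into an equality. -/
theorem BiholGerm.MapsTo.hasMultiplicity {Φ : BiholGerm} {F₁ F₂ : FoliationGerm}
    (hF : Φ.MapsTo F₁ F₂) {m : ℕ} (h : F₂.HasMultiplicity m) : F₁.HasMultiplicity m := by
  obtain ⟨Ψ, hΦ⟩ := Φ.exists_inverse
  refine ⟨hF.iteratedFDeriv_eq_zero h.1, fun h0 => h.2 ?_⟩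
  refine (hF.symm hΦ).iteratedFDeriv_eq_zero (m := m + 1) (fun j hj => ?_) m (by omega)
  obtain hj | rfl := Nat.lt_succ_iff_lt_or_eq.1 hj
  · exact hF.iteratedFDeriv_eq_zero h.1 j hj
  · exact h0

theorem BiholGerm.MapsTo.inDn {Φ : BiholGerm} {F₁ F₂ : FoliationGerm}
    (hF : Φ.MapsTo F₁ F₂) {n : ℕ} (h : F₂.InDn n) : F₁.InDn n :=
  ⟨hF.inD h.1, hF.hasMultiplicity h.2⟩

/-! ### Automorphisms of the exceptional divisor -/

theorem IsHolomorphicOnE.exists_coord {f : ExcDiv → ExcDiv} (hf : IsHolomorphicOnE f)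
    {i j : Fin 2} {t₀ s₀ : ℂ} (h : f (pt i t₀) = pt j s₀) :
    ∃ τ : ℂ → ℂ, AnalyticAt ℂ τ t₀ ∧ τ t₀ = s₀ ∧ ∀ᶠ t in 𝓝 t₀, f (pt i t) = pt j (τ t) := by
  obtain ⟨v, hv, hev⟩ := hf i t₀
  obtain ⟨hv0, h0⟩ := hev.self_of_nhds
  rw [h0, mk_eq_pt_iff] at h
  have hm := analyticAt_mainCoord_comp j hv
  refine ⟨fun t => sideCoord j (v t) / mainCoord j (v t),
    (analyticAt_sideCoord_comp j hv).div hm h.1, h.2, ?_⟩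
  filter_upwards [hev, hm.continuousAt.eventually_ne h.1] with t h1 h2
  obtain ⟨h3, h4⟩ := h1
  rw [h4, mk_eq_pt_iff]
  exact ⟨h2, rfl⟩

theorem IsHolomorphicOnE.comp {f g : ExcDiv → ExcDiv} (hf : IsHolomorphicOnE f)
    (hg : IsHolomorphicOnE g) : IsHolomorphicOnE (f ∘ g) := by
  intro i t₀
  obtain ⟨j, s₀, h⟩ := exists_eq_pt (g (pt i t₀))
  obtain ⟨τ, hτ, rfl, hev⟩ := hg.exists_coord h
  obtain ⟨v, hv, hev'⟩ := hf j (τ t₀)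
  refine ⟨fun t => v (τ t), AnalyticAt.comp (g := v) hv hτ, ?_⟩
  filter_upwards [hev, hτ.continuousAt.eventually hev'] with t h1 h2
  rwa [Function.comp_apply, h1]

theorem contDiff_dir (i : Fin 2) : ContDiff ℂ ⊤ (dir i) := by
  obtain rfl | rfl := eq_zero_or_eq_one i
  · have : dir 0 = fun t : ℂ => ((1 : ℂ), t) := by
      ext t <;> simp [dir]
    rw [this]
    fun_prop
  · have : dir 1 = fun t : ℂ => (t, (1 : ℂ)) := by
      ext t <;> simp [dir]
    rw [this]
    fun_prop

theorem BiholGerm.isHolomorphicOnE (Φ : BiholGerm) : IsHolomorphicOnE Φ.onE := by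
  intro i t₀
  refine ⟨fun t => Φ.linearPart (dir i t),
    ((Φ.linearPart : ℂ × ℂ →L[ℂ] ℂ × ℂ).analyticAt _).comp
      (contDiff_dir i).contDiffAt.analyticAt, .of_forall fun t =>
      ⟨fun h => dir_ne_zero i t (Φ.linearPart.map_eq_zero_iff.1 h), rfl⟩⟩

theorem BiholGerm.exists_autE (Φ : BiholGerm) : ∃ φ : AutE, Φ.onE = φ.toEquiv := by
  obtain ⟨Ψ, h⟩ := Φ.exists_inverse
  exact ⟨⟨⟨Φ.onE, Ψ.onE, h.onE_onE, h.symm.onE_onE⟩, Φ.isHolomorphicOnE, Ψ.isHolomorphicOnE⟩, rfl⟩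

theorem BiholGerm.exists_linear {a b c d : ℂ} (h : a * d - b * c ≠ 0) :
    ∃ Λ : BiholGerm, ∀ v : ℂ × ℂ, Λ.linearPart v = (a * v.1 + b * v.2, c * v.1 + d * v.2) := by
  let M (a b c d : ℂ) : ℂ × ℂ →L[ℂ] ℂ × ℂ :=
    (a • ContinuousLinearMap.fst ℂ ℂ ℂ + b • ContinuousLinearMap.snd ℂ ℂ ℂ).prod
      (c • ContinuousLinearMap.fst ℂ ℂ ℂ + d • ContinuousLinearMap.snd ℂ ℂ ℂ)
  have hM (a b c d : ℂ) (v : ℂ × ℂ) : M a b c d v = (a * v.1 + b * v.2, c * v.1 + d * v.2) := by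
    simp [M]
  set δ := a * d - b * c
  let L : (ℂ × ℂ) ≃L[ℂ] (ℂ × ℂ) := ContinuousLinearEquiv.equivOfInverse (M a b c d)
    (M (d / δ) (-b / δ) (-c / δ) (a / δ))
    (fun v => by
      simp only [hM]
      ext <;> simp only <;> field_simp <;> simp only [δ] <;> ring)
    (fun v => by
      simp only [hM]
      ext <;> simp only <;> field_simp <;> simp only [δ] <;> ring)
  exact ⟨⟨L, (L : ℂ × ℂ →L[ℂ] ℂ × ℂ).analyticAt 0, _root_.map_zero L, L, L.hasFDerivAt⟩, hM a b c d⟩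

theorem pt_zero_eq_pt_one_iff {a b : ℂ} : pt 0 a = pt 1 b ↔ a * b = 1 := by
  have h := mk_eq_pt_iff (i := 1) (t := b) (dir_ne_zero 0 a)
  change pt 0 a = pt 1 b ↔ _ at h
  rw [h]
  simp only [mainCoord, sideCoord, dir, if_true, one_ne_zero, if_false]
  constructor
  · rintro ⟨h1, rfl⟩
    exact mul_div_cancel₀ _ h1
  · intro h1
    have h2 : a ≠ 0 := by rintro rfl; simp at h1
    exact ⟨h2, by rw [div_eq_iff h2, mul_comm, h1]⟩

theorem exists_eq_pt_zero {p : ExcDiv} (hp : p ≠ pt 1 0) : ∃ t, p = pt 0 t := by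
  obtain ⟨i, t, rfl⟩ := exists_eq_pt p
  obtain rfl | rfl := eq_zero_or_eq_one i
  · exact ⟨t, rfl⟩
  · have ht : t ≠ 0 := by rintro rfl; exact hp rfl
    exact ⟨t⁻¹, (pt_zero_eq_pt_one_iff.2 (inv_mul_cancel₀ ht)).symm⟩

theorem BiholGerm.exists_onE_eq (p : ExcDiv) : ∃ Λ : BiholGerm, Λ.onE p = pt 1 0 := by
  obtain ⟨i, t, rfl⟩ := exists_eq_pt p
  obtain rfl | rfl := eq_zero_or_eq_one i
  · obtain ⟨Λ, hΛ⟩ := BiholGerm.exists_linear (a := t) (b := -1) (c := 1) (d := 0) (by simp)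
    refine ⟨Λ, (Λ.onE_pt_eq_iff 0 t 1 0).2 ?_⟩
    rw [hΛ]
    simp [mainCoord, sideCoord, dir]
  · obtain ⟨Λ, hΛ⟩ := BiholGerm.exists_linear (a := 1) (b := -t) (c := 0) (d := 1) (by simp)
    refine ⟨Λ, (Λ.onE_pt_eq_iff 1 t 1 0).2 ?_⟩
    rw [hΛ]
    simp [mainCoord, sideCoord, dir]

/-- An entire function of linear growth is affine. -/
theorem exists_eq_add_mul_of_norm_le {h : ℂ → ℂ} (hh : Differentiable ℂ h) {C : ℝ}
    (hC : ∀ᶠ t in cocompact ℂ, ‖h t‖ ≤ C * ‖t‖) : ∃ a, ∀ t, h t = h 0 + a * t := by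
  -- The slope `(h(t) - h(0)) / t` is entire and bounded, hence constant by Liouville's theorem.
  have hd : Differentiable ℂ (dslope h 0) := by
    rw [← differentiableOn_univ, Complex.differentiableOn_dslope univ_mem, differentiableOn_univ]
    exact hh
  have hb : Bornology.IsBounded (Set.range (dslope h 0)) := by
    obtain ⟨K, hK, hKC⟩ := mem_cocompact.1
      (hC.and ((tendsto_norm_cocompact_atTop (E := ℂ)).eventually_ge_atTop 1))
    obtain ⟨B, hB⟩ := (hK.image hd.continuous).isBounded.exists_norm_le
    refine isBounded_iff_forall_norm_le.2 ⟨max B (C + ‖h 0‖), ?_⟩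
    rintro _ ⟨t, rfl⟩
    by_cases ht : t ∈ K
    · exact (hB _ ⟨t, ht, rfl⟩).trans (le_max_left _ _)
    · obtain ⟨h1, h2⟩ := hKC ht
      have ht0 : 0 < ‖t‖ := by linarith
      refine le_trans ?_ (le_max_right _ _)
      rw [dslope_of_ne _ (norm_pos_iff.1 ht0), slope_def_field, sub_zero, norm_div, div_le_iff₀ ht0]
      calc ‖h t - h 0‖ ≤ ‖h t‖ + ‖h 0‖ := norm_sub_le _ _
        _ ≤ C * ‖t‖ + ‖h 0‖ * ‖t‖ := by
          gcongr
          exact le_mul_of_one_le_right (norm_nonneg _) h2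
        _ = (C + ‖h 0‖) * ‖t‖ := by ring
  refine ⟨dslope h 0 0, fun t => ?_⟩
  have h1 := sub_smul_dslope h 0 t
  rw [hd.apply_eq_apply_of_bounded hb t 0, sub_zero, smul_eq_mul] at h1
  linear_combination -h1

/-- Automorphisms of the projective line are projective maps. After composition with a linear germ
the point `pt 1 0`, the point at infinity of chart `0`, is fixed; the automorphism is then an entire
function `h` in this chart, of linear growth, hence affine. -/
theorem AutE.exists_biholGerm (φ : AutE) : ∃ Λ : BiholGerm, Λ.onE = φ.toEquiv := by
  obtain ⟨Λ, hΛ⟩ := BiholGerm.exists_onE_eq (φ.toEquiv (pt 1 0))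
  obtain ⟨Λ', hinv⟩ := Λ.exists_inverse
  set f : ExcDiv → ExcDiv := Λ.onE ∘ φ.toEquiv
  set f' : ExcDiv → ExcDiv := φ.toEquiv.symm ∘ Λ'.onE
  have hf : IsHolomorphicOnE f := Λ.isHolomorphicOnE.comp φ.holomorphic
  have hf' : IsHolomorphicOnE f' := φ.holomorphic_symm.comp Λ'.isHolomorphicOnE
  have hff (p) : f' (f p) = p := by simp [f, f', hinv.onE_onE]
  have hf0 : f (pt 1 0) = pt 1 0 := hΛ
  have hf0' : f' (pt 1 0) = pt 1 0 := by conv_lhs => rw [← hf0, hff]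
  have hinj : Function.Injective f := Function.LeftInverse.injective hff
  have hex (t : ℂ) : ∃ s, f (pt 0 t) = pt 0 s := by
    refine exists_eq_pt_zero fun h => ?_
    have := hinj (h.trans hf0.symm)
    simp [pt_zero_eq_pt_one_iff] at this
  choose h hh using hex
  have hd : Differentiable ℂ h := by
    intro t
    obtain ⟨τ, hτ, -, hev⟩ := hf.exists_coord (hh t)
    refine (hτ.congr ?_).differentiableAt
    filter_upwards [hev] with s hs
    exact pt_injective 0 (hs.symm.trans (hh s))
  obtain ⟨k, hk, hk0, hkev⟩ := hf.exists_coord hf0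
  obtain ⟨k', hk', hk0', hkev'⟩ := hf'.exists_coord hf0'
  have hO : ∃ C : ℝ, ∀ᶠ s in 𝓝 (0 : ℂ), ‖k' s‖ ≤ C * ‖s‖ := by
    have := hk'.differentiableAt.isBigO_sub
    simp only [hk0', sub_zero] at this
    exact this.bound
  obtain ⟨C, hC⟩ := hO
  have hkt : Tendsto k (𝓝 0) (𝓝 0) := by
    have := hk.continuousAt.tendsto
    rwa [hk0] at this
  -- Near infinity `h (1/s) = 1 / k(s)`. Since `k' ∘ k` is the identity and `k'` is differentiable
  -- at `0`, `|s| ≤ C |k(s)|`, which is the linear growth of `h`.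
  have hgrow : ∀ᶠ s in 𝓝[≠] (0 : ℂ), ‖h s⁻¹‖ ≤ C * ‖s⁻¹‖ := by
    refine eventually_nhdsWithin_iff.2 ?_
    filter_upwards [hkev, hkt.eventually hC, hkt.eventually hkev'] with s h1 h2 h3 hs
    have h4 : k' (k s) = s := by
      rw [← h1, hff] at h3
      exact (pt_injective 1 h3).symm
    rw [h4] at h2
    have h5 : h s⁻¹ * k s = 1 := by
      rw [← pt_zero_eq_pt_one_iff, ← hh, ← h1]
      congr 1
      exact pt_zero_eq_pt_one_iff.2 (inv_mul_cancel₀ hs)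
    have h6 : k s ≠ 0 := right_ne_zero_of_mul_eq_one h5
    rw [eq_div_of_mul_eq h6 h5, norm_div, norm_one, norm_inv, div_le_iff₀ (norm_pos_iff.2 h6),
      mul_right_comm, ← div_eq_mul_inv, le_div_iff₀ (norm_pos_iff.2 hs), one_mul]
    exact h2
  obtain ⟨a, ha⟩ := exists_eq_add_mul_of_norm_le hd (C := C) (by
    have := (tendsto_inv₀_cobounded' (α := ℂ)).eventually hgrow
    rw [Metric.cobounded_eq_cocompact] at this
    simpa only [inv_inv] using this)
  have ha0 : a ≠ 0 := by
    rintro rfl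
    have h1 : pt 0 0 = pt 0 1 := hinj (by rw [hh, hh, ha 1, zero_mul, add_zero])
    exact zero_ne_one (pt_injective 0 h1)
  obtain ⟨N, hN⟩ := BiholGerm.exists_linear (a := 1) (b := 0) (c := h 0) (d := a) (by simpa)
  have hNf : N.onE = f := by
    funext p
    by_cases hp : p = pt 1 0
    · rw [hp, hf0, N.onE_pt_eq_iff, hN]
      simp [mainCoord, sideCoord, dir, ha0]
    · obtain ⟨t, rfl⟩ := exists_eq_pt_zero hp
      rw [hh, N.onE_pt_eq_iff, hN, ha t]
      simp [mainCoord, sideCoord, dir]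
  refine ⟨Λ'.comp N, funext fun p => ?_⟩
  rw [Λ'.onE_comp, hNf]
  exact hinv.onE_onE _

/-! ### Invariants of a conjugacy -/

section

variable {Φ : BiholGerm} {F₁ F₂ : FoliationGerm} {φ : AutE}

theorem BiholGerm.IsInverse.onE_eq_symm {Ψ : BiholGerm} (hΦ : Φ.IsInverse Ψ)
    (hφ : Φ.onE = φ.toEquiv) (p : ExcDiv) : Ψ.onE p = φ.toEquiv.symm p := by
  rw [Equiv.eq_symm_apply, ← hφ, hΦ.symm.onE_onE]

theorem BiholGerm.MapsTo.holonomy_eq (hF : Φ.MapsTo F₁ F₂) (hφ : Φ.onE = φ.toEquiv) :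
    F₂.holonomy = φ.conj F₁.holonomy := by
  obtain ⟨Ψ, hΦ⟩ := Φ.exists_inverse
  have hψ : Ψ.onE = φ.toEquiv.symm := funext (hΦ.onE_eq_symm hφ)
  ext ⟨p, h⟩
  constructor
  · intro hh
    refine ⟨(Ψ.onE p, Ψ.onE ∘ h ∘ Φ.onE), ?_, ?_⟩
    · refine FoliationGerm.IsHolonomyAt.comp_onE (F₂ := F₂) ?_ hF hΦ
      rw [hΦ.symm.onE_onE]
      exact hh
    · refine Prod.ext ?_ (funext fun x => ?_) <;> simp [hψ, hφ]
  · rintro ⟨⟨p', h'⟩, hh, heq⟩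
    obtain ⟨rfl, rfl⟩ := Prod.ext_iff.1 heq
    have : F₁.IsHolonomyAt (Ψ.onE (φ.toEquiv p')) h' := by
      rw [hψ, Equiv.symm_apply_apply]
      exact hh
    have h2 := FoliationGerm.IsHolonomyAt.comp_onE this (hF.symm hΦ) hΦ.symm
    rw [hψ, hφ] at h2
    exact h2

theorem BiholGerm.MapsTo.push_mem_divh (hF : Φ.MapsTo F₁ F₂) (hφ : Φ.onE = φ.toEquiv)
    {D : ExcDiv →₀ ℕ} (hD : D ∈ F₁.divh) : φ.push D ∈ F₂.divh := by
  obtain ⟨Ψ, hΦ⟩ := Φ.exists_inverse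
  obtain ⟨X, hX, hXD⟩ := hD
  obtain ⟨X₂, hX₂⟩ := X.exists_pullback hΦ.symm
  refine ⟨X₂, hX.comp (hF.symm hΦ) hΦ.symm hX₂, hXD.comp (hF.symm hΦ) hΦ.symm hX₂ fun p => ?_⟩
  rw [hΦ.onE_eq_symm hφ]
  conv_lhs => rw [← φ.toEquiv.apply_symm_apply p]
  exact Finsupp.mapDomain_apply φ.toEquiv.injective D _

end

/-! ### Changes of charts -/

/-- The identity germ. -/
def BiholGerm.one : BiholGerm where
  toFun := id
  analyticAt := analyticAt_id
  map_zero := rfl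
  linearPart := ContinuousLinearEquiv.refl ℂ (ℂ × ℂ)
  hasFDerivAt := hasFDerivAt_id 0

theorem BiholGerm.one_isInverse : BiholGerm.one.IsInverse BiholGerm.one :=
  ⟨.of_forall fun _ => rfl, .of_forall fun _ => rfl, fun _ => rfl, fun _ => rfl⟩

theorem BiholGerm.one_mapsTo (F : FoliationGerm) : BiholGerm.one.MapsTo F F := by
  refine ⟨fun _ => 1, analyticAt_const, one_ne_zero, .of_forall fun p => ?_⟩
  change (F.form p).comp (fderiv ℂ id p) = _
  rw [fderiv_id, ContinuousLinearMap.comp_id, one_smul]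

theorem BiholGerm.one_onE (p : ExcDiv) : BiholGerm.one.onE p = p := by
  induction p using Projectivization.ind with
  | h v hv => rfl

/-- Transition maps between charts are lifts of the identity, so every transport statement along a
biholomorphism specializes to independence of the chart. -/
theorem exists_chart_change {i j : Fin 2} {t s : ℂ} (h : pt i t = pt j s) :
    ∃ T, BiholGerm.one.IsLift i t j s T :=
  BiholGerm.one.exists_isLift (by rw [BiholGerm.one_onE, h])

theorem FoliationGerm.IsHolonomyAt.isHolonomyInChart {F : FoliationGerm} {i : Fin 2} {t₀ : ℂ}
    {h : ExcDiv → ExcDiv} (hh : F.IsHolonomyAt (pt i t₀) h) : F.IsHolonomyInChart i t₀ h := by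
  obtain ⟨j, s₀, hp, hc⟩ := hh.exists_chart
  obtain ⟨T, hT⟩ := exists_chart_change hp
  obtain ⟨T', hT'⟩ := exists_chart_change hp.symm
  have := hc.comp_lift (BiholGerm.one_mapsTo F) BiholGerm.one_isInverse hT hT'
  have h1 : BiholGerm.one.onE ∘ h ∘ BiholGerm.one.onE = h := by
    funext p
    simp [BiholGerm.one_onE]
  rwa [h1] at this

/-! ### Covering a punctured neighbourhood of the origin by sectors -/

/-- The closed unit discs of the two charts cover the exceptional divisor. By compactness the local
neighbourhoods contain a uniform one, whose image is a punctured neighbourhood of the origin. -/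
theorem eventually_nhdsNE_of_sectors {P : ℂ × ℂ → Prop}
    (h : ∀ (i : Fin 2) (t₀ : ℂ), ∀ᶠ q in 𝓝 ((0 : ℂ), t₀), q.1 ≠ 0 → P (blowDown i q)) :
    ∀ᶠ p in 𝓝[≠] (0 : ℂ × ℂ), P p := by
  have hK (i : Fin 2) : ∀ᶠ x in 𝓝 (0 : ℂ), ∀ t ∈ Metric.closedBall (0 : ℂ) 1,
      x ≠ 0 → P (blowDown i (x, t)) :=
    (isCompact_closedBall (0 : ℂ) 1).eventually_forall_of_forall_eventually
      fun t _ => h i t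
  have hm (i : Fin 2) : Tendsto (mainCoord i) (𝓝 (0 : ℂ × ℂ)) (𝓝 0) := by
    obtain rfl | rfl := eq_zero_or_eq_one i
    · exact continuous_fst.tendsto (0 : ℂ × ℂ)
    · exact continuous_snd.tendsto (0 : ℂ × ℂ)
  refine eventually_nhdsWithin_iff.2 ?_
  filter_upwards [(hm 0).eventually (hK 0), (hm 1).eventually (hK 1)] with p h0 h1 hp
  have key (i : Fin 2) (hi : ‖sideCoord i p‖ ≤ ‖mainCoord i p‖)
      (hPi : ∀ t ∈ Metric.closedBall (0 : ℂ) 1, mainCoord i p ≠ 0 →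
        P (blowDown i (mainCoord i p, t))) : P p := by
    have hm0 : mainCoord i p ≠ 0 := by
      intro h0
      rw [h0, norm_zero, norm_le_zero_iff] at hi
      refine hp ?_
      obtain rfl | rfl := eq_zero_or_eq_one i
      · exact Prod.ext h0 hi
      · exact Prod.ext hi h0
    have := hPi (sideCoord i p / mainCoord i p) (by
      rw [mem_closedBall_zero_iff, norm_div]
      exact div_le_one_of_le₀ hi (norm_nonneg _)) hm0
    rwa [show (mainCoord i p, sideCoord i p / mainCoord i p) = blowUp i p from rfl,
      blowDown_blowUp hm0] at this
  rcases le_total ‖p.2‖ ‖p.1‖ with hle | hle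
  · exact key 0 hle h0
  · exact key 1 hle h1

/-! ### Functions with prescribed derivative along the first coordinate -/

/-- Integrate along the horizontal segment from `(0, t)` to `(x, t)`: the factor `P` is constant on
it, and `v` is the mean of `W` over the segment. -/
theorem exists_eq_add_mul_of_fderiv_eq {f W : ℂ × ℂ → ℂ} {P : ℂ → ℂ} {t₀ : ℂ}
    (hf : AnalyticAt ℂ f (0, t₀)) (hW : AnalyticAt ℂ W (0, t₀))
    (h : ∀ᶠ q in 𝓝 ((0 : ℂ), t₀), fderiv ℂ f q (1, 0) = P q.2 * W q) :
    ∃ v : ℂ × ℂ → ℂ, AnalyticAt ℂ v (0, t₀) ∧ v (0, t₀) = W (0, t₀) ∧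
      ∀ᶠ q in 𝓝 ((0 : ℂ), t₀), f q = f (0, q.2) + q.1 * P q.2 * v q := by
  set T₀ : ℂ × ℂ →L[ℂ] ℂ × ℂ :=
    (ContinuousLinearMap.inr ℂ ℂ ℂ).comp (ContinuousLinearMap.snd ℂ ℂ ℂ)
  set T₁ : ℂ × ℂ →L[ℂ] ℂ × ℂ :=
    (ContinuousLinearMap.inl ℂ ℂ ℂ).comp (ContinuousLinearMap.fst ℂ ℂ ℂ)
  have hT (q : ℂ × ℂ) (s : ℂ) : T₀ q + s • T₁ q = (s * q.1, q.2) := by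
    simp [T₀, T₁]
  refine ⟨fun q => ∫ s in (0 : ℝ)..1, W (T₀ q + (s : ℂ) • T₁ q),
    analyticAt_integral_segment T₀ T₁ (by simp [T₁]) (by simpa [T₀] using hW),
    by simp only [hT]; simp, ?_⟩
  obtain ⟨r, hr, hball⟩ := Metric.eventually_nhds_iff_ball.1
    ((hf.eventually_analyticAt.and hW.eventually_analyticAt).and h)
  filter_upwards [Metric.ball_mem_nhds _ hr] with q hq
  simp only [hT]
  have hseg : ∀ s ∈ Set.uIcc (0 : ℝ) 1, ((s : ℂ) * q.1, q.2) ∈ Metric.ball ((0 : ℂ), t₀) r := by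
    intro s hs
    rw [Set.uIcc_of_le zero_le_one] at hs
    rw [Metric.mem_ball, Prod.dist_eq, max_lt_iff, dist_zero_right] at hq ⊢
    refine ⟨lt_of_le_of_lt ?_ hq.1, hq.2⟩
    rw [norm_mul, Complex.norm_real, Real.norm_of_nonneg hs.1]
    exact mul_le_of_le_one_left (norm_nonneg _) hs.2
  have hp : ∀ s : ℝ, HasDerivAt (fun s : ℝ => ((s : ℂ) * q.1, q.2)) (q.1, (0 : ℂ)) s := by
    intro s
    have := ((Complex.ofRealCLM.hasDerivAt (x := s)).mul_const q.1).prodMk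
      (hasDerivAt_const s q.2)
    simpa using this
  have hd : ∀ s ∈ Set.uIcc (0 : ℝ) 1, HasDerivAt (fun s : ℝ => f ((s : ℂ) * q.1, q.2))
      (q.1 * P q.2 * W ((s : ℂ) * q.1, q.2)) s := by
    intro s hs
    obtain ⟨⟨h1, -⟩, h3⟩ := hball _ (hseg s hs)
    have h4 := (h1.differentiableAt.hasFDerivAt.restrictScalars ℝ).comp_hasDerivAt s (hp s)
    refine h4.congr_deriv ?_
    have h5 : (q.1, (0 : ℂ)) = q.1 • ((1 : ℂ), (0 : ℂ)) := by simp
    rw [ContinuousLinearMap.coe_restrictScalars', h5, map_smul, h3, smul_eq_mul, mul_assoc]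
  have hc : ContinuousOn (fun s : ℝ => W ((s : ℂ) * q.1, q.2)) (Set.uIcc 0 1) := by
    intro s hs
    exact (ContinuousAt.comp (f := fun s : ℝ => ((s : ℂ) * q.1, q.2))
      (hball _ (hseg s hs)).1.2.continuousAt (hp s).continuousAt).continuousWithinAt
  have := intervalIntegral.integral_eq_sub_of_hasDerivAt hd
    ((continuousOn_const.mul hc).intervalIntegrable)
  rw [intervalIntegral.integral_const_mul] at this
  rw [this]
  simp

theorem exists_local_inverse_of_det_ne_zero {χ : ℂ × ℂ → ℂ × ℂ} {a : ℂ × ℂ}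
    (hχ : AnalyticAt ℂ χ a)
    (hd : (fderiv ℂ χ a (1, 0)).1 * (fderiv ℂ χ a (0, 1)).2
      - (fderiv ℂ χ a (0, 1)).1 * (fderiv ℂ χ a (1, 0)).2 ≠ 0) :
    ∃ ζ : ℂ × ℂ → ℂ × ℂ, AnalyticAt ℂ ζ (χ a) ∧ ζ (χ a) = a ∧ (∀ᶠ p in 𝓝 a, ζ (χ p) = p) ∧
      ∀ᶠ p in 𝓝 (χ a), χ (ζ p) = p := by
  obtain ⟨Λ, hΛ⟩ := BiholGerm.exists_linear hd
  refine exists_analytic_local_inverse hχ (L := Λ.linearPart) ?_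
  refine hχ.differentiableAt.hasFDerivAt.congr_fderiv ?_
  ext <;> simp [hΛ]

/-- First integrals of the same foliation which coincide on a transverse curve coincide. -/
theorem eq_of_wedge_eq_zero_of_eq {w w' : ℂ × ℂ → ℂ} {t₀ : ℂ} (hw : AnalyticAt ℂ w (0, t₀))
    (hw' : AnalyticAt ℂ w' (0, t₀)) (hd : fderiv ℂ w (0, t₀) (0, 1) ≠ 0)
    (h : ∀ᶠ q in 𝓝 ((0 : ℂ), t₀), wedge (fderiv ℂ w' q) (fderiv ℂ w q) = 0)
    (h0 : ∀ᶠ t in 𝓝 t₀, w' (0, t) = w (0, t)) :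
    ∀ᶠ q in 𝓝 ((0 : ℂ), t₀), w' q = w q := by
  have hwd : fderiv ℂ w (0, t₀) ≠ 0 := by
    intro e
    rw [e] at hd
    exact hd rfl
  -- In the coordinates `(x, w)` the leaves are horizontal. There `w'` has no `x`-derivative, so it
  -- is determined by its values on `{x = 0}`.
  set χ : ℂ × ℂ → ℂ × ℂ := fun q => (q.1, w q)
  have hχ : AnalyticAt ℂ χ (0, t₀) := analyticAt_fst.prod hw
  have hχd : fderiv ℂ χ (0, t₀) = (ContinuousLinearMap.fst ℂ ℂ ℂ).prod (fderiv ℂ w (0, t₀)) :=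
    (hasFDerivAt_fst.prodMk hw.differentiableAt.hasFDerivAt).fderiv
  obtain ⟨ζ, hζ, hζ0, hl, hr⟩ := exists_local_inverse_of_det_ne_zero hχ (by
    rw [hχd]
    simpa using hd)
  have hbase : χ (0, t₀) = (0, w (0, t₀)) := rfl
  rw [hbase] at hζ hζ0 hr
  have hζt : Tendsto ζ (𝓝 (0, w (0, t₀))) (𝓝 (0, t₀)) := by
    have := hζ.continuousAt.tendsto
    rwa [hζ0] at this
  have hg : AnalyticAt ℂ (fun p => w' (ζ p)) (0, w (0, t₀)) :=
    AnalyticAt.comp (g := w') (by rwa [hζ0]) hζ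
  have hgd : ∀ᶠ p in 𝓝 ((0 : ℂ), w (0, t₀)),
      fderiv ℂ (fun p => w' (ζ p)) p (1, 0) = (fun _ : ℂ => (0 : ℂ)) p.2 * (fun _ => 0) p := by
    filter_upwards [hr.eventually_nhds, hζt.eventually h, hζ.eventually_analyticAt,
      hζt.eventually hw.eventually_analyticAt, hζt.eventually hw'.eventually_analyticAt,
      hζt.eventually (hw.fderiv.continuousAt.eventually_ne hwd)]
      with p h1 h2 h3 h4 h5 h6
    obtain ⟨c, hc⟩ := (wedge_eq_zero_iff h6).1 h2
    have e1 : fderiv ℂ (fun p => w' (ζ p)) p = (fderiv ℂ w' (ζ p)).comp (fderiv ℂ ζ p) :=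
      fderiv_comp p h5.differentiableAt h3.differentiableAt
    have e2 : fderiv ℂ (fun p => w (ζ p)) p = (fderiv ℂ w (ζ p)).comp (fderiv ℂ ζ p) :=
      fderiv_comp p h4.differentiableAt h3.differentiableAt
    have e3 : fderiv ℂ (fun p => w (ζ p)) p = ContinuousLinearMap.snd ℂ ℂ ℂ := by
      rw [← (hasFDerivAt_snd (𝕜 := ℂ) (p := p)).fderiv]
      exact Filter.EventuallyEq.fderiv_eq (h1.mono fun x hx => congrArg Prod.snd hx)
    rw [e1, hc, ContinuousLinearMap.smul_comp, ← e2, e3]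
    simp
  obtain ⟨v, -, -, hv⟩ := exists_eq_add_mul_of_fderiv_eq (P := fun _ => 0) (W := fun _ => 0) hg
    analyticAt_const hgd
  have hg0 : ∀ᶠ y in 𝓝 (w (0, t₀)), w' (ζ (0, y)) = y := by
    have ht : Tendsto (fun y : ℂ => (ζ (0, y)).2) (𝓝 (w (0, t₀))) (𝓝 t₀) :=
      (continuous_snd.tendsto ((0 : ℂ), t₀)).comp (hζt.comp (tendsto_zero_prodMk _))
    filter_upwards [ht.eventually h0, (tendsto_zero_prodMk _).eventually hr] with y h1 h2
    have e1 : ζ (0, y) = (0, (ζ (0, y)).2) := Prod.ext (show (ζ (0, y)).1 = 0 from congrArg Prod.fst h2) rfl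
    rw [e1, h1, ← e1]
    exact congrArg Prod.snd h2
  have hg1 : ∀ᶠ p in 𝓝 ((0 : ℂ), w (0, t₀)), w' (ζ p) = p.2 := by
    filter_upwards [hv, (continuous_snd.tendsto ((0 : ℂ), w (0, t₀))).eventually hg0] with p h1 h2
    rw [h1, mul_zero, zero_mul, add_zero, h2]
  have hχt : Tendsto χ (𝓝 (0, t₀)) (𝓝 (0, w (0, t₀))) := hχ.continuousAt.tendsto
  filter_upwards [hχt.eventually hg1, hl] with q h1 h2
  rwa [h2] at h1

/-! ### Position of the blown-up foliation with respect to the exceptional divisor -/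

section

variable {F : FoliationGerm} {i j : Fin 2} {t₀ s₀ : ℂ} {η : ℂ × ℂ → (ℂ × ℂ →L[ℂ] ℂ)}

theorem analyticAt_restrict {v : ℂ × ℂ} (hη : AnalyticAt ℂ η (0, t₀)) :
    AnalyticAt ℂ (fun t : ℂ => η (0, t) v) t₀ :=
  analyticAt_covector_apply (AnalyticAt.comp (g := η) hη (analyticAt_const.prod analyticAt_id)) _

theorem analyticOrderAt_apply_eq_of_unit {η' : ℂ × ℂ → (ℂ × ℂ →L[ℂ] ℂ)} {v : ℂ × ℂ}
    (hη : F.IsLocalGenerator i t₀ η) (hη' : F.IsLocalGenerator i t₀ η') :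
    analyticOrderAt (fun t : ℂ => η' (0, t) v) t₀ = analyticOrderAt (fun t : ℂ => η (0, t) v) t₀ := by
  obtain ⟨u, hu, hu0, hev⟩ := hη.exists_unit hη'
  have hu1 : AnalyticAt ℂ (fun t : ℂ => u (0, t)) t₀ :=
    AnalyticAt.comp (g := u) hu (analyticAt_const.prod analyticAt_id)
  have h1 : (fun t : ℂ => η' (0, t) v) =ᶠ[𝓝 t₀]
      (fun t : ℂ => u (0, t)) * fun t : ℂ => η (0, t) v := by
    filter_upwards [(tendsto_zero_prodMk t₀).eventually hev] with t ht
    rw [ht]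
    rfl
  rw [analyticOrderAt_congr h1, analyticOrderAt_mul hu1 (analyticAt_restrict hη.1),
    hu1.analyticOrderAt_eq_zero.2 hu0, zero_add]

/-- The exceptional divisor is invariant near the point `(0, t₀)` of the chart `i`. -/
def FoliationGerm.IsInvariantAt (F : FoliationGerm) (i : Fin 2) (t₀ : ℂ) : Prop :=
  ∃ η, F.IsLocalGenerator i t₀ η ∧ analyticOrderAt (fun t : ℂ => η (0, t) (0, 1)) t₀ = ⊤

theorem FoliationGerm.IsInvariantAt.chart_change (h : F.IsInvariantAt j s₀)
    (hp : pt i t₀ = pt j s₀) : F.IsInvariantAt i t₀ := by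
  obtain ⟨η, hη, h0⟩ := h
  obtain ⟨T, hT⟩ := exists_chart_change hp
  obtain ⟨T', hT'⟩ := exists_chart_change hp.symm
  exact ⟨_, hη.comp_lift (BiholGerm.one_mapsTo F) BiholGerm.one_isInverse hT hT',
    (hη.analyticOrderAt_comp_lift BiholGerm.one_isInverse hT hT').trans h0⟩

/-- The identity principle along a chart of the divisor: near each point the restriction of a
generator either vanishes identically or has at most that point as a zero. Since generators differ
by units, the alternative does not depend on the generator. -/
theorem FoliationGerm.InD.isClopen_order_eq_top (hF : F.InD) (i : Fin 2) (v : ℂ × ℂ) :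
    IsClopen {t | ∃ η, F.IsLocalGenerator i t η ∧
      analyticOrderAt (fun t : ℂ => η (0, t) v) t = ⊤} := by
  set S := {t | ∃ η, F.IsLocalGenerator i t η ∧ analyticOrderAt (fun t : ℂ => η (0, t) v) t = ⊤}
  have hdich : ∀ t₀ : ℂ, (t₀ ∈ S ∧ ∀ᶠ t in 𝓝 t₀, t ∈ S) ∨ ∀ᶠ t in 𝓝 t₀, t ∉ S := by
    intro t₀
    obtain ⟨η, hη⟩ := hF i t₀
    rcases (analyticAt_restrict (v := v) hη.1).eventually_eq_zero_or_eventually_ne_zero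
      with h | h
    · have h1 : ∀ᶠ t in 𝓝 t₀, t ∈ S := by
        filter_upwards [hη.eventually, h.eventually_nhds] with t h1 h2
        exact ⟨η, h1, analyticOrderAt_eq_top.2 h2⟩
      exact Or.inl ⟨h1.self_of_nhds, h1⟩
    · refine Or.inr ?_
      filter_upwards [hη.eventually, (eventually_nhdsWithin_iff.1 h).eventually_nhds] with t h1 h2
      rintro ⟨η', hη', h3⟩
      rw [← analyticOrderAt_apply_eq_of_unit hη' h1, analyticOrderAt_eq_top] at h3
      have h4 : ∀ᶠ s in 𝓝 t, s = t₀ := by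
        filter_upwards [h2, h3] with s h5 h6
        by_contra h7
        exact h5 h7 h6
      have h5 : ∀ᶠ s in 𝓝[≠] t, s = t₀ := nhdsWithin_le_nhds h4
      obtain ⟨s, hs, hs'⟩ := (h5.and self_mem_nhdsWithin).exists
      exact hs' (hs.trans h4.self_of_nhds.symm)
  constructor
  · rw [← isOpen_compl_iff, isOpen_iff_eventually]
    intro t ht
    exact (hdich t).resolve_left fun h => ht h.1
  · rw [isOpen_iff_eventually]
    intro t ht
    rcases hdich t with h | h
    · exact h.2
    · exact absurd ht h.self_of_nhds

/-- A function on the exceptional divisor given by a generator vanishes identically as soon as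
it vanishes identically near one point. -/
theorem FoliationGerm.InD.order_eq_top (hF : F.InD) {v : ℂ × ℂ}
    (hv : ∀ (i j : Fin 2) (t s : ℂ), pt i t = pt j s →
      (∃ η, F.IsLocalGenerator j s η ∧ analyticOrderAt (fun t : ℂ => η (0, t) v) s = ⊤) →
      ∃ η, F.IsLocalGenerator i t η ∧ analyticOrderAt (fun t : ℂ => η (0, t) v) t = ⊤)
    (h : ∃ η, F.IsLocalGenerator j s₀ η ∧ analyticOrderAt (fun t : ℂ => η (0, t) v) s₀ = ⊤)
    (i : Fin 2) (t : ℂ) :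
    ∃ η, F.IsLocalGenerator i t η ∧ analyticOrderAt (fun t : ℂ => η (0, t) v) t = ⊤ := by
  have hall (k : Fin 2) (s t : ℂ)
      (h : ∃ η, F.IsLocalGenerator k s η ∧ analyticOrderAt (fun t : ℂ => η (0, t) v) s = ⊤) :
      ∃ η, F.IsLocalGenerator k t η ∧ analyticOrderAt (fun t : ℂ => η (0, t) v) t = ⊤ := by
    have h2 := (isClopen_iff.1 (hF.isClopen_order_eq_top k v)).resolve_left
      (Set.nonempty_iff_ne_empty.1 ⟨s, h⟩)
    exact (h2 ▸ Set.mem_univ t :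
      t ∈ {t | ∃ η, F.IsLocalGenerator k t η ∧ analyticOrderAt (fun t : ℂ => η (0, t) v) t = ⊤})
  -- The two charts share the point `t = 1`, the diagonal line, through which the vanishing passes
  -- from one chart to the other.
  have h1 (j k : Fin 2) : pt j 1 = pt k 1 := by
    obtain rfl | rfl := eq_zero_or_eq_one j <;> obtain rfl | rfl := eq_zero_or_eq_one k <;>
      simp [pt, dir]
  exact hall i 1 t (hv i j 1 1 (h1 i j) (hall j s₀ 1 h))

theorem pullback_apply_one_zero (F : FoliationGerm) (i : Fin 2) (q : ℂ × ℂ) :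
    F.form (blowDown i q) (blowDown i q) = q.1 * F.pullback i q (1, 0) := by
  have h : fderiv ℂ (blowDown i) q (1, 0) = dir i q.2 := by
    rw [fderiv_blowDown_apply]
    simp
  rw [FoliationGerm.pullback, ContinuousLinearMap.comp_apply, h, blowDown, map_smul, smul_eq_mul]

/-- Some leaf of the blown-up foliation is transverse to the exceptional divisor. -/
theorem FoliationGerm.InD.exists_apply_eq_zero (hF : F.InD) :
    ∃ i t₀ η, F.IsLocalGenerator i t₀ η ∧ η (0, t₀) (1, 0) = 0 := by
  by_contra hcon
  push Not at hcon
  -- If the coefficient `η (1, 0)` had no zero on the divisor, the contraction of the form with the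
  -- Euler field would vanish only at the origin, whereas zeros of analytic functions of two
  -- variables are not isolated.
  have hga : AnalyticAt ℂ (fun p => F.form p p) 0 := analyticAt_clm_apply F.analyticAt analyticAt_id
  refine frequently_eq_zero_of_eq_zero hga (map_zero _) (eventually_nhdsNE_of_sectors fun i t₀ => ?_)
  obtain ⟨η, hη⟩ := hF i t₀
  have hA := (analyticAt_covector_apply hη.1 (1, 0)).continuousAt.eventually_ne (hcon i t₀ η hη)
  obtain ⟨-, -, k, hk, hkη⟩ := hη
  filter_upwards [hA, hkη, F.pullback_ne_zero i t₀] with q h1 h2 h3 h4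
  rw [pullback_apply_one_zero]
  refine mul_ne_zero h4 ?_
  change F.pullback i q = _ at h2
  rw [h2]
  refine mul_ne_zero (fun h5 => h3 h4 ?_) h1
  rw [h2, h5]
  exact zero_smul ℂ (η q)

/-- The exceptional divisor is not invariant: the foliation is dicritical. -/
theorem FoliationGerm.InD.not_isInvariantAt (hF : F.InD) (i : Fin 2) (t₀ : ℂ) :
    ¬F.IsInvariantAt i t₀ := by
  obtain ⟨i₀, s₀, η, hη, hA⟩ := hF.exists_apply_eq_zero
  have h0 : ¬F.IsInvariantAt i₀ s₀ := by
    rintro ⟨η', hη', h1⟩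
    rw [← analyticOrderAt_apply_eq_of_unit hη' hη, analyticOrderAt_eq_top] at h1
    exact hη.2.1 (covector_ext hA h1.self_of_nhds)
  intro h
  exact h0 (hF.order_eq_top (fun _ _ _ _ hp h => FoliationGerm.IsInvariantAt.chart_change h hp) h
    i₀ s₀)

theorem FoliationGerm.InD.exists_hasTangencyOrder (hF : F.InD) (hη : F.IsLocalGenerator i t₀ η) :
    ∃ r : ℕ, analyticOrderAt (fun t : ℂ => η (0, t) (0, 1)) t₀ = r := by
  have h : analyticOrderAt (fun t : ℂ => η (0, t) (0, 1)) t₀ ≠ ⊤ :=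
    fun h => hF.not_isInvariantAt i t₀ ⟨η, hη, h⟩
  exact ⟨_, (ENat.natCast_toNat h).symm⟩

end

theorem hasDerivAt_restrict {f : ℂ × ℂ → ℂ} {t : ℂ} (hf : AnalyticAt ℂ f (0, t)) :
    HasDerivAt (fun s : ℂ => f (0, s)) (fderiv ℂ f (0, t) (0, 1)) t :=
  hf.differentiableAt.hasFDerivAt.comp_hasDerivAt t
    ((hasDerivAt_const t (0 : ℂ)).prodMk (hasDerivAt_id t))

theorem exists_local_inverse_of_deriv_ne_zero {ψ : ℂ → ℂ} {t₀ : ℂ} (hψ : AnalyticAt ℂ ψ t₀)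
    (hd : deriv ψ t₀ ≠ 0) : ∃ σ : ℂ → ℂ, AnalyticAt ℂ σ (ψ t₀) ∧ σ (ψ t₀) = t₀ ∧
      (∀ᶠ t in 𝓝 t₀, σ (ψ t) = t) ∧ ∀ᶠ s in 𝓝 (ψ t₀), ψ (σ s) = s := by
  refine exists_analytic_local_inverse hψ
    (L := ContinuousLinearEquiv.unitsEquivAut ℂ (Units.mk0 _ hd)) ?_
  refine hψ.differentiableAt.hasDerivAt.hasFDerivAt.congr_fderiv ?_
  ext
  simp

/-! ### Homogeneous foliations in the blow-up -/

section

variable {F : FoliationGerm} {X : RadialField} {i : Fin 2} {t₀ : ℂ}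
  {η : ℂ × ℂ → (ℂ × ℂ →L[ℂ] ℂ)}

/-- The blow-up of the Euler field is `x ∂_x`, so any generator `Y` of the saturated foliation is a
unit times `∂_x`. The divisor is thus read on the coefficient `η (1, 0)`. -/
theorem FoliationGerm.IsTangRestrict.analyticOrderAt_eq {D : ExcDiv →₀ ℕ}
    (h : F.IsTangRestrict X D) (hX : ∀ᶠ p in 𝓝 (0 : ℂ × ℂ), X.toFun p = p)
    (hη : F.IsLocalGenerator i t₀ η) :
    analyticOrderAt (fun t : ℂ => η (0, t) (1, 0)) t₀ = (D (pt i t₀) : ℕ∞) := by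
  obtain ⟨η', Y, hη', ⟨hY, hY0, k, hk, hkY⟩, hord⟩ := h i t₀
  have hY2 : ∀ᶠ q in 𝓝 ((0 : ℂ), t₀), (Y q).2 = 0 := by
    refine eventually_eq_of_fst_ne_zero
      (AnalyticAt.eventually_continuousAt (analyticAt_snd.comp hY))
      (.of_forall fun _ => continuousAt_const) ?_
    filter_upwards [hkY, (tendsto_blowDown i t₀).eventually hX] with q h1 h2 h3
    rw [h2, fderiv_blowDown_apply] at h1
    have h4 := congrArg (mainCoord i) h1
    have h5 := congrArg (sideCoord i) h1
    rw [mainCoord_blowDown] at h4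
    rw [sideCoord_blowDown] at h5
    obtain ⟨h6, h7⟩ : k q * (Y q).1 = q.1 ∧
        k q * (Y q).1 * q.2 + q.1 * (k q * (Y q).2) = q.1 * q.2 := by
      obtain rfl | rfl := eq_zero_or_eq_one i
      · simpa [mainCoord, sideCoord, dir, fibDir] using And.intro h4 h5
      · simpa [mainCoord, sideCoord, dir, fibDir] using And.intro h4 h5
    rw [h6] at h7
    have h8 : q.1 * (k q * (Y q).2) = 0 := by linear_combination h7
    refine ((mul_eq_zero.1 ((mul_eq_zero.1 h8).resolve_left h3))).resolve_left fun h9 => h3 ?_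
    rw [← h6, h9, zero_mul]
  have hY1 : (Y (0, t₀)).1 ≠ 0 := fun h0 => hY0 (Prod.ext h0 hY2.self_of_nhds)
  have hYa : AnalyticAt ℂ (fun t : ℂ => (Y (0, t)).1) t₀ :=
    analyticAt_fst.comp (AnalyticAt.comp (g := Y) hY (analyticAt_const.prod analyticAt_id))
  have hev : (fun t : ℂ => η' (0, t) (Y (0, t))) =ᶠ[𝓝 t₀]
      (fun t : ℂ => (Y (0, t)).1) * fun t : ℂ => η' (0, t) (1, 0) := by
    filter_upwards [(tendsto_zero_prodMk t₀).eventually hY2] with t ht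
    rw [covector_apply, ht, zero_mul, add_zero]
    rfl
  rw [analyticOrderAt_congr hev, analyticOrderAt_mul hYa (analyticAt_restrict hη'.1),
    hYa.analyticOrderAt_eq_zero.2 hY1, zero_add] at hord
  rw [analyticOrderAt_apply_eq_of_unit hη' hη, hord]

/-- Homogeneity in the blow-up: the derivative of the tangency function along the foliation is
divisible by this function. -/
theorem FoliationGerm.IsHomogeneousWrt.exists_wedge_eq (h : F.IsHomogeneousWrt X)
    (hX : ∀ᶠ p in 𝓝 (0 : ℂ × ℂ), X.toFun p = p) (hη : F.IsLocalGenerator i t₀ η)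
    (hA0 : analyticOrderAt (fun t : ℂ => η (0, t) (1, 0)) t₀ ≠ ⊤) :
    ∃ κ : ℂ × ℂ → ℂ, AnalyticAt ℂ κ (0, t₀) ∧ ∀ᶠ q in 𝓝 ((0 : ℂ), t₀),
      wedge (fderiv ℂ (fun q => η q (1, 0)) q) (η q) = κ q * η q (1, 0) := by
  obtain ⟨K₀, hK₀, hinv⟩ := h.2
  obtain ⟨-, -, k, hk, hkη⟩ := id hη
  set A : ℂ × ℂ → ℂ := fun q => η q (1, 0)
  set B : ℂ × ℂ → ℂ := fun q => η q (0, 1)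
  set L : ℂ × ℂ → ℂ := fun q => wedge (fderiv ℂ A q) (η q)
  have hA : AnalyticAt ℂ A (0, t₀) := analyticAt_covector_apply hη.1 _
  have hB : AnalyticAt ℂ B (0, t₀) := analyticAt_covector_apply hη.1 _
  have hL : AnalyticAt ℂ L (0, t₀) := analyticAt_wedge hA.fderiv hη.1
  set ε : ℂ := if i = 0 then 1 else -1
  -- The tangency equation pulls back to `x k A`. Its invariance, expanded by the product rule,
  -- becomes `A K = x k L`, where `L` is the derivative of `A` along the foliation and `K` collects
  -- the remaining factors.
  set K : ℂ × ℂ → ℂ := fun q => ε * q.1 ^ 2 * K₀ (blowDown i q) - k q * B q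
    - q.1 * wedge (fderiv ℂ k q) (η q)
  have hK : AnalyticAt ℂ K (0, t₀) := by
    have h1 : AnalyticAt ℂ (fun q => K₀ (blowDown i q)) (0, t₀) :=
      AnalyticAt.comp (g := K₀) (by rwa [blowDown_eq_zero.2 rfl]) (analyticAt_blowDown i _)
    exact (((analyticAt_const.mul (analyticAt_fst.pow 2)).mul h1).sub (hk.mul hB)).sub
      (analyticAt_fst.mul (analyticAt_wedge hk.fderiv hη.1))
  have hg : ∀ᶠ q in 𝓝 ((0 : ℂ), t₀), F.tang X (blowDown i q) = q.1 * (k q * A q) := by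
    filter_upwards [(tendsto_blowDown i t₀).eventually hX, hkη] with q h1 h2
    rw [FoliationGerm.tang, h1, pullback_apply_one_zero]
    change F.pullback i q = _ at h2
    rw [h2]
    rfl
  have hk0 : ∀ᶠ q in 𝓝 ((0 : ℂ), t₀), q.1 ≠ 0 → k q ≠ 0 := by
    filter_upwards [hkη, F.pullback_ne_zero i t₀] with q h1 h2 h3 h4
    refine h2 h3 ?_
    rw [FoliationGerm.pullback, h1, h4]
    exact zero_smul ℂ (η q)
  have key : ∀ᶠ q in 𝓝 ((0 : ℂ), t₀), A q * K q = q.1 * k q * L q := by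
    refine eventually_eq_of_fst_ne_zero (AnalyticAt.eventually_continuousAt (hA.mul hK))
      (AnalyticAt.eventually_continuousAt ((analyticAt_fst.mul hk).mul hL)) ?_
    filter_upwards [hg.eventually_nhds, hkη, hk0, (tendsto_blowDown i t₀).eventually hinv,
      hk.eventually_analyticAt, hA.eventually_analyticAt,
      (tendsto_blowDown i t₀).eventually (F.analyticAt_tang X).eventually_analyticAt]
      with q h1 h2 h3 h4 h5 h6 h7 h8
    have e1 : fderiv ℂ (fun q => F.tang X (blowDown i q)) q
        = (fderiv ℂ (F.tang X) (blowDown i q)).comp (fderiv ℂ (blowDown i) q) :=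
      fderiv_comp q h7.differentiableAt (analyticAt_blowDown i q).differentiableAt
    have e2 : fderiv ℂ (fun q => F.tang X (blowDown i q)) q
        = q.1 • (k q • fderiv ℂ A q + A q • fderiv ℂ k q)
          + (k q * A q) • ContinuousLinearMap.fst ℂ ℂ ℂ := by
      rw [Filter.EventuallyEq.fderiv_eq h1]
      exact (hasFDerivAt_fst.mul
        (h5.differentiableAt.hasFDerivAt.mul h6.differentiableAt.hasFDerivAt)).fderiv
    have e3 := wedge_comp (fderiv ℂ (F.tang X) (blowDown i q)) (F.form (blowDown i q))
      (fderiv ℂ (blowDown i) q)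
    rw [F.apply_tangentField] at h4
    rw [h2, h4, ← e1, e2, h1.self_of_nhds, det_fderiv_blowDown, wedge_smul_right, wedge_add_left,
      wedge_smul_left, wedge_smul_left, wedge_add_left, wedge_smul_left, wedge_smul_left] at e3
    have e4 : wedge (ContinuousLinearMap.fst ℂ ℂ ℂ) (η q) = B q := by simp [wedge, B]
    rw [e4] at e3
    refine mul_left_cancel₀ (h3 h8) ?_
    simp only [K, L, ε]
    linear_combination -e3
  -- `x k` vanishes only on the divisor, on which `A` is not identically zero. Hence `x k` divides
  -- `K`, and cancelling it leaves `L = κ A`.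
  obtain ⟨κ, hκ, hκev⟩ := exists_eq_mul_of_mul_eq_mul hA hK (analyticAt_fst.mul hk) hL
    (fun h0 => hA0 (analyticOrderAt_eq_top.2 h0))
    (by filter_upwards [hk0] with q h1 h2 using mul_ne_zero h2 (h1 h2)) key
  refine ⟨κ, hκ, eventually_eq_of_fst_ne_zero (AnalyticAt.eventually_continuousAt hL)
    (AnalyticAt.eventually_continuousAt (hκ.mul hA)) ?_⟩
  filter_upwards [key, hκev, hk0] with q h1 h2 h3 h4
  refine mul_left_cancel₀ (mul_ne_zero h4 (h3 h4)) ?_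
  change q.1 * k q * L q = q.1 * k q * (κ q * A q)
  change K q = q.1 * k q * κ q at h2
  rw [← h1, h2]
  ring

/-- At a point transverse to the divisor, invariance of `{A = 0}`, with `A = η (1, 0)`, becomes a
linear equation `∂_x A = μ A`. A zero of `A` on the divisor then propagates along its whole fibre,
so `A` is a power of `t - t₀` times a unit. -/
theorem FoliationGerm.IsHomogeneousWrt.exists_eq_pow_mul (h : F.IsHomogeneousWrt X)
    (hX : ∀ᶠ p in 𝓝 (0 : ℂ × ℂ), X.toFun p = p) (hη : F.IsLocalGenerator i t₀ η) {m : ℕ}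
    (hA : analyticOrderAt (fun t : ℂ => η (0, t) (1, 0)) t₀ = m) (hB : η (0, t₀) (0, 1) ≠ 0) :
    ∃ U : ℂ × ℂ → ℂ, AnalyticAt ℂ U (0, t₀) ∧ U (0, t₀) ≠ 0 ∧
      ∀ᶠ q in 𝓝 ((0 : ℂ), t₀), η q (1, 0) = (q.2 - t₀) ^ m * U q := by
  obtain ⟨κ, hκ, hev⟩ := h.exists_wedge_eq hX hη (by rw [hA]; exact ENat.natCast_ne_top m)
  have hBa := analyticAt_covector_apply hη.1 (0, 1)
  have hAa := analyticAt_covector_apply hη.1 (1, 0)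
  set σ : ℂ × ℂ → ℂ × ℂ := fun z => (z.2, t₀ + z.1)
  have hσ (z) : AnalyticAt ℂ σ z := ContDiffAt.analyticAt (by fun_prop)
  have hσ0 : σ (0, 0) = (0, t₀) := by simp [σ]
  have hσt : Tendsto σ (𝓝 (0, 0)) (𝓝 (0, t₀)) := by
    have := (hσ (0, 0)).continuousAt.tendsto
    rwa [hσ0] at this
  have hcomp {f : ℂ × ℂ → ℂ} (hf : AnalyticAt ℂ f (0, t₀)) :
      AnalyticAt ℂ (fun z => f (σ z)) (0, 0) :=
    AnalyticAt.comp (g := f) (by rwa [hσ0]) (hσ _)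
  -- Expanding `dA ∧ η = κ A` gives `B ∂_x A = (κ + ∂_t A) A`, where `B = η (0, 1)` is a unit here.
  -- The swap `σ` puts the variable of differentiation in second place, as in
  -- `exists_eq_pow_mul_unit`.
  set μ : ℂ × ℂ → ℂ := fun q =>
    (κ q + fderiv ℂ (fun q => η q (1, 0)) q (0, 1)) / η q (0, 1)
  have hμ : AnalyticAt ℂ μ (0, t₀) :=
    (hκ.add (analyticAt_covector_apply hAa.fderiv _)).div hBa hB
  obtain ⟨U, hU, hU0, hUev⟩ := exists_eq_pow_mul_unit (hcomp hμ) m (hcomp hAa) (by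
    filter_upwards [hσt.eventually hev, hσt.eventually (hBa.continuousAt.eventually_ne hB),
      hσt.eventually hAa.eventually_analyticAt] with z h1 h2 h3
    have e1 : HasFDerivAt σ ((ContinuousLinearMap.snd ℂ ℂ ℂ).prod
        (ContinuousLinearMap.fst ℂ ℂ ℂ)) z :=
      hasFDerivAt_snd.prodMk (hasFDerivAt_fst.const_add t₀)
    have e2 : fderiv ℂ (fun z => η (σ z) (1, 0)) z = _ :=
      (h3.differentiableAt.hasFDerivAt.comp z e1).fderiv
    rw [e2]
    simp only [ContinuousLinearMap.comp_apply, ContinuousLinearMap.prod_apply,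
      ContinuousLinearMap.coe_snd', ContinuousLinearMap.coe_fst', μ]
    rw [div_mul_eq_mul_div, eq_div_iff h2]
    unfold wedge at h1
    linear_combination h1) (by
    have h1 : (fun s : ℂ => η (σ (s, 0)) (1, 0))
        = (fun t : ℂ => η (0, t) (1, 0)) ∘ fun s => t₀ + s := rfl
    have h2 : AnalyticAt ℂ (fun s : ℂ => t₀ + s) 0 := analyticAt_const.add analyticAt_id
    have h3 : HasDerivAt (fun s : ℂ => t₀ + s) 1 0 := (hasDerivAt_id 0).const_add t₀
    rw [h1, analyticOrderAt_comp_of_deriv_ne_zero h2 (by rw [h3.deriv]; exact one_ne_zero),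
      add_zero, hA])
  set τ : ℂ × ℂ → ℂ × ℂ := fun q => (q.2 - t₀, q.1)
  have hτ : AnalyticAt ℂ τ (0, t₀) := ContDiffAt.analyticAt (by fun_prop)
  have hτ0 : τ (0, t₀) = (0, 0) := by simp [τ]
  have hτt : Tendsto τ (𝓝 (0, t₀)) (𝓝 (0, 0)) := by
    have := hτ.continuousAt.tendsto
    rwa [hτ0] at this
  refine ⟨fun q => U (τ q), AnalyticAt.comp (g := U) (by rwa [hτ0]) hτ, by simpa [hτ0] using hU0, ?_⟩
  filter_upwards [hτt.eventually hUev] with q hq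
  have : σ (τ q) = q := by simp [σ, τ]
  rw [this] at hq
  exact hq

/-- Flow boxes of homogeneous foliations at the points where they are transverse to the
exceptional divisor. -/
theorem FoliationGerm.IsHomogeneousWrt.exists_first_integral (h : F.IsHomogeneousWrt X)
    (hX : ∀ᶠ p in 𝓝 (0 : ℂ × ℂ), X.toFun p = p) (hη : F.IsLocalGenerator i t₀ η) {m : ℕ}
    (hA : analyticOrderAt (fun t : ℂ => η (0, t) (1, 0)) t₀ = m) (hB : η (0, t₀) (0, 1) ≠ 0) :
    ∃ z v : ℂ × ℂ → ℂ, AnalyticAt ℂ z (0, t₀) ∧ AnalyticAt ℂ v (0, t₀) ∧ v (0, t₀) ≠ 0 ∧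
      (∀ᶠ t in 𝓝 t₀, z (0, t) = t) ∧ fderiv ℂ z (0, t₀) (0, 1) = 1 ∧
      (∀ᶠ q in 𝓝 ((0 : ℂ), t₀), wedge (fderiv ℂ z q) (η q) = 0) ∧
      ∀ᶠ q in 𝓝 ((0 : ℂ), t₀), z q = z (0, q.2) + q.1 * (q.2 - t₀) ^ m * v q := by
  obtain ⟨U, hU, hU0, hUev⟩ := h.exists_eq_pow_mul hX hη hA hB
  obtain ⟨z, hz, hz0, hzη⟩ := exists_first_integral_of_transverse hη.1 hB
  have hBa := analyticAt_covector_apply hη.1 (0, 1)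
  have hzt : fderiv ℂ z (0, t₀) (0, 1) = 1 :=
    (hasDerivAt_restrict hz).unique ((hasDerivAt_id t₀).congr_of_eventuallyEq hz0)
  -- `dz ∧ η = 0` reads `∂_x z = (A / B) ∂_t z`, so `(t - t₀)^m` divides `∂_x z`; integration in `x`
  -- keeps this factor.
  obtain ⟨v, hv, hv0, hvev⟩ := exists_eq_add_mul_of_fderiv_eq (P := fun t => (t - t₀) ^ m)
    (W := fun q => U q * fderiv ℂ z q (0, 1) / η q (0, 1)) hz
    ((hU.mul (analyticAt_covector_apply hz.fderiv _)).div hBa hB) (by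
      filter_upwards [hUev, hzη, hBa.continuousAt.eventually_ne hB] with q h1 h2 h3
      unfold wedge at h2
      rw [mul_div_assoc', eq_div_iff h3]
      linear_combination h2 + fderiv ℂ z q (0, 1) * h1)
  refine ⟨z, v, hz, hv, ?_, hz0, hzt, hzη, hvev⟩
  rw [hv0, hzt, mul_one]
  exact div_ne_zero hU0 hB

end

/-! ### Tangency points and holonomy -/

section

variable {F F₁ F₂ : FoliationGerm} {i : Fin 2} {t₀ : ℂ} {η : ℂ × ℂ → (ℂ × ℂ →L[ℂ] ℂ)}

theorem FoliationGerm.IsLocalGenerator.isFirstIntegral {f : ℂ × ℂ → ℂ}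
    (hη : F.IsLocalGenerator i t₀ η) (hf : AnalyticAt ℂ f (0, t₀))
    (hf0 : fderiv ℂ f (0, t₀) ≠ 0)
    (hw : ∀ᶠ q in 𝓝 ((0 : ℂ), t₀), wedge (fderiv ℂ f q) (η q) = 0) :
    F.IsFirstIntegral i t₀ f := by
  refine ⟨hf, (F.isLocalGenerator_iff i t₀ _).2 ⟨hf.fderiv, hf0, ?_⟩⟩
  filter_upwards [hw, ((F.isLocalGenerator_iff i t₀ η).1 hη).2.2,
    hη.1.continuousAt.eventually_ne hη.2.1] with q h1 h2 h3
  exact wedge_eq_zero_trans h3 h2 (by rw [wedge_swap, h1, neg_zero])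

/-- The restriction to the divisor of a first integral vanishing at the point is the power `ψ^(r+1)`
of a coordinate, and the holonomy is the rotation in this coordinate. Thus the holonomy records
every tangency point. -/
theorem FoliationGerm.InD.exists_isHolonomyInChart (hF : F.InD) (hη : F.IsLocalGenerator i t₀ η)
    (hB : η (0, t₀) (0, 1) = 0) : ∃ h, F.IsHolonomyInChart i t₀ h := by
  obtain ⟨f₀, hf₀, hf₀0, hf₀η⟩ := Dicritical.exists_first_integral hη.1 hη.2.1
  set f : ℂ × ℂ → ℂ := fun q => f₀ q - f₀ (0, t₀)
  have hf : AnalyticAt ℂ f (0, t₀) := hf₀.sub analyticAt_const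
  have hff : fderiv ℂ f = fderiv ℂ f₀ := by
    funext q
    exact fderiv_sub_const _
  have hfi : F.IsFirstIntegral i t₀ f :=
    hη.isFirstIntegral hf (by rwa [hff]) (by rwa [hff])
  obtain ⟨r, hr⟩ := hF.exists_hasTangencyOrder hη
  have hr' : analyticOrderAt (fun t : ℂ => fderiv ℂ f (0, t) (0, 1)) t₀ = r := by
    rw [analyticOrderAt_apply_eq_of_unit hη hfi.2, hr]
  have hr1 : 1 ≤ r := by
    rw [Nat.one_le_iff_ne_zero]
    rintro rfl
    exact ((analyticAt_restrict hη.1).analyticOrderAt_eq_zero.1 hr) hB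
  have hfr : AnalyticAt ℂ (fun t : ℂ => f (0, t)) t₀ :=
    AnalyticAt.comp (g := f) hf (analyticAt_const.prod analyticAt_id)
  -- The tangency order is the order of the derivative of the restricted first integral, hence the
  -- exponent `r + 1`.
  have hord : analyticOrderAt (fun t : ℂ => f (0, t)) t₀ = (r + 1 : ℕ) := by
    have h1 := hfr.analyticOrderAt_deriv_add_one
    have h2 : deriv (fun t : ℂ => f (0, t)) =ᶠ[𝓝 t₀] fun t => fderiv ℂ f (0, t) (0, 1) := by
      filter_upwards [(tendsto_zero_prodMk t₀).eventually hf.eventually_analyticAt] with t ht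
      exact (hasDerivAt_restrict ht).deriv
    rw [analyticOrderAt_congr h2, hr'] at h1
    have h3 : f (0, t₀) = 0 := sub_self _
    simp only [h3, sub_zero] at h1
    rw [← h1]
    rfl
  obtain ⟨ψ, hψ, hψ0, hψd, hψf⟩ := exists_eq_pow_of_analyticOrderAt hfr (Nat.succ_ne_zero r) hord
  obtain ⟨σ, hσ, hσ0, -, hσr⟩ := exists_local_inverse_of_deriv_ne_zero hψ hψd
  rw [hψ0] at hσ hσ0 hσr
  set ζ := Complex.exp (2 * Real.pi * Complex.I / ((r : ℂ) + 1))
  have hζa : AnalyticAt ℂ (fun t => ζ * ψ t) t₀ := analyticAt_const.mul hψ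
  have hζ0 : ζ * ψ t₀ = 0 := by rw [hψ0, mul_zero]
  have hζt : Tendsto (fun t => ζ * ψ t) (𝓝 t₀) (𝓝 0) := by
    have := hζa.continuousAt.tendsto
    rwa [hζ0] at this
  -- Only the germ matters: the representative is the identity outside the chart.
  refine ⟨Function.extend (pt i) (fun t => pt i (σ (ζ * ψ t))) id, r, f, ψ, fun t => σ (ζ * ψ t),
    hr1, ⟨_, hη, hr⟩, hfi, hψ, hψ0, hψd, hψf, AnalyticAt.comp (g := σ) (by rwa [hζ0]) hζa,
    by simp only [hζ0, hσ0], hζt.eventually hσr, .of_forall fun t => ?_⟩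
  exact (pt_injective i).extend_apply _ _ t

theorem FoliationGerm.IsHolonomyInChart.apply_eq_zero {h : ExcDiv → ExcDiv}
    (hh : F.IsHolonomyInChart i t₀ h) (hη : F.IsLocalGenerator i t₀ η) :
    η (0, t₀) (0, 1) = 0 := by
  obtain ⟨r, f, ψ, g, hr, ⟨η', hη', hord⟩, -⟩ := hh
  rw [analyticOrderAt_apply_eq_of_unit hη hη'] at hord
  by_contra h0
  rw [(analyticAt_restrict hη.1).analyticOrderAt_eq_zero.2 h0] at hord
  have : r = 0 := by exact_mod_cast hord.symm
  omega

end

section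

variable {F₁ F₂ : FoliationGerm} {i j : Fin 2} {t₀ s₀ : ℂ}

theorem IsPrimitiveRoot.exp_two_pi_div (r : ℕ) : IsPrimitiveRoot
    (Complex.exp (2 * Real.pi * Complex.I / ((r : ℂ) + 1))) (r + 1) := by
  have := Complex.isPrimitiveRoot_exp (r + 1) (Nat.succ_ne_zero r)
  rwa [Nat.cast_succ] at this

/-- The multiplier of the holonomy germ. -/
theorem deriv_eq_of_semiconj {ψ g : ℂ → ℂ} {ζ : ℂ} (hψ : AnalyticAt ℂ ψ t₀) (hd : deriv ψ t₀ ≠ 0)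
    (hg : AnalyticAt ℂ g t₀) (hg0 : g t₀ = t₀) (h : ∀ᶠ t in 𝓝 t₀, ψ (g t) = ζ * ψ t) :
    deriv g t₀ = ζ := by
  have h1 : HasDerivAt ψ (deriv ψ t₀) (g t₀) := by
    rw [hg0]; exact hψ.differentiableAt.hasDerivAt
  have h2 := h1.comp t₀ hg.differentiableAt.hasDerivAt
  have h3 := (hψ.differentiableAt.hasDerivAt.const_mul ζ).congr_of_eventuallyEq h
  have h4 := h2.unique h3
  exact mul_left_cancel₀ hd (by rw [h4, mul_comm])

/-- If two foliations have the same holonomy germ at a tangency point, then they have first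
integrals with the same restriction to the exceptional divisor. -/
theorem FoliationGerm.IsHolonomyInChart.exists_first_integrals {h : ExcDiv → ExcDiv}
    (hh₁ : F₁.IsHolonomyInChart i t₀ h) (hh₂ : F₂.IsHolonomyInChart i t₀ h) :
    ∃ f₁ f₂, F₁.IsFirstIntegral i t₀ f₁ ∧ F₂.IsFirstIntegral i t₀ f₂ ∧
      ∀ᶠ t in 𝓝 t₀, f₁ (0, t) = f₂ (0, t) := by
  obtain ⟨r, f₁, ψ₁, g, -, -, hf₁, hψ₁, hψ₁0, hψ₁d, hfψ₁, hg, hg0, hψg₁, hhg⟩ := hh₁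
  obtain ⟨r', f₂, ψ₂, g', -, -, hf₂, hψ₂, hψ₂0, hψ₂d, hfψ₂, hg', hg0', hψg₂, hhg'⟩ := hh₂
  have hgg : ∀ᶠ t in 𝓝 t₀, g' t = g t := by
    filter_upwards [hhg, hhg'] with t h1 h2
    exact pt_injective i (h2.symm.trans h1)
  -- The multiplier of the common germ is a primitive root of unity of order `r + 1`, so the germ
  -- determines the tangency order.
  have hr : r' = r := by
    have h1 := deriv_eq_of_semiconj hψ₁ hψ₁d hg hg0 hψg₁
    have h2 := deriv_eq_of_semiconj hψ₂ hψ₂d hg' hg0' hψg₂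
    rw [Filter.EventuallyEq.deriv_eq hgg, h1] at h2
    have h3 := IsPrimitiveRoot.exp_two_pi_div r'
    rw [← h2] at h3
    exact Nat.succ_injective (h3.unique (IsPrimitiveRoot.exp_two_pi_div r))
  subst hr
  set ζ := Complex.exp (2 * Real.pi * Complex.I / ((r' : ℂ) + 1))
  have hζ : IsPrimitiveRoot ζ (r' + 1) := IsPrimitiveRoot.exp_two_pi_div r'
  have hm : r' + 1 ≠ 0 := Nat.succ_ne_zero r'
  have hgt : Tendsto g (𝓝 t₀) (𝓝 t₀) := by
    have := hg.continuousAt.tendsto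
    rwa [hg0] at this
  obtain ⟨σ, hσ, hσ0, hσl, hσr⟩ := exists_local_inverse_of_deriv_ne_zero hψ₁ hψ₁d
  rw [hψ₁0] at hσ hσ0 hσr
  have hσt : Tendsto σ (𝓝 0) (𝓝 t₀) := by
    have := hσ.continuousAt.tendsto
    rwa [hσ0] at this
  have hθ : AnalyticAt ℂ (fun s => ψ₂ (σ s)) 0 := AnalyticAt.comp (g := ψ₂) (by rwa [hσ0]) hσ
  have hθ0 : ψ₂ (σ 0) = 0 := by rw [hσ0, hψ₂0]
  -- `ψ₂ ∘ ψ₁⁻¹` commutes with the rotation, so its `(r' + 1)`-th power is invariant and factors as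
  -- `V (s ^ (r' + 1))`. On the divisor this says `f₂ = V ∘ f₁`.
  have hinv : ∀ᶠ s in 𝓝 (0 : ℂ), ψ₂ (σ (ζ * s)) ^ (r' + 1) = ψ₂ (σ s) ^ (r' + 1) := by
    filter_upwards [hσr, hσt.eventually hψg₁, (hgt.comp hσt).eventually hσl, hσt.eventually hgg,
      hσt.eventually hψg₂] with s h1 h2 h3 h4 h5
    simp only [Function.comp_apply] at h3
    rw [h2, h1] at h3
    rw [h4] at h5
    rw [h3, h5, mul_pow, hζ.pow_eq_one, one_mul]
  obtain ⟨V, hV, hVh⟩ := exists_comp_pow_of_invariant (hθ.fun_pow (r' + 1)) hm hζ hinv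
  have hV0 : V 0 = 0 := by
    have := hVh.self_of_nhds
    rwa [zero_pow hm, hθ0, zero_pow hm] at this
  -- Comparison of orders: if `V` vanished to order at least two, `V (s ^ (r' + 1))` would have
  -- order at least `2 (r' + 1)`. Since `V` is a local biholomorphism, `V ∘ f₁` is still a primitive
  -- first integral.
  have hVd : deriv V 0 ≠ 0 := by
    have hθd : analyticOrderAt (fun s => ψ₂ (σ s)) 0 = 1 := by
      have h1 : analyticOrderAt ψ₂ t₀ = 1 := by
        have := hψ₂.analyticOrderAt_sub_eq_one_of_deriv_ne_zero hψ₂d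
        simpa [hψ₂0] using this
      have h2 : HasDerivAt ψ₁ (deriv ψ₁ t₀) (σ 0) := by
        rw [hσ0]; exact hψ₁.differentiableAt.hasDerivAt
      have h3 : deriv σ 0 ≠ 0 := by
        intro h0
        have h4 := (h2.comp 0 hσ.differentiableAt.hasDerivAt).unique
          ((hasDerivAt_id (0 : ℂ)).congr_of_eventuallyEq hσr)
        rw [h0, mul_zero] at h4
        exact zero_ne_one h4
      have h4 := analyticOrderAt_comp_of_deriv_ne_zero (f := ψ₂) hσ h3
      rw [hσ0, h1] at h4
      exact h4
    have h1 : analyticOrderAt (V ∘ fun s : ℂ => s ^ (r' + 1)) 0 = (r' + 1 : ℕ) := by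
      rw [analyticOrderAt_congr (f := V ∘ fun s : ℂ => s ^ (r' + 1))
        (g := (fun s => ψ₂ (σ s)) ^ (r' + 1)) hVh, analyticOrderAt_pow hθ, hθd, nsmul_one]
    have hp : AnalyticAt ℂ (fun s : ℂ => s ^ (r' + 1)) 0 := analyticAt_id.fun_pow _
    have h2 : analyticOrderAt (fun s : ℂ => s ^ (r' + 1) - (fun s : ℂ => s ^ (r' + 1)) 0) 0
        = (r' + 1 : ℕ) := by
      have h3 : (fun s : ℂ => s ^ (r' + 1) - (fun s : ℂ => s ^ (r' + 1)) 0) = id ^ (r' + 1) := by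
        funext s
        simp
      rw [h3, analyticOrderAt_pow analyticAt_id]
      have h4 : analyticOrderAt (id : ℂ → ℂ) 0 = 1 := by
        have := (analyticAt_id (𝕜 := ℂ) (z := (0 : ℂ))).analyticOrderAt_sub_eq_one_of_deriv_ne_zero
          (by simp)
        simp only [id, sub_zero] at this
        exact this
      rw [h4, nsmul_one]
    have hz : (0 : ℂ) ^ (r' + 1) = 0 := zero_pow hm
    have h3 := AnalyticAt.analyticOrderAt_comp (f := V) (g := fun s : ℂ => s ^ (r' + 1)) (z₀ := 0)
      (by rwa [hz]) hp
    rw [h1, h2, hz] at h3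
    have h4 := hV.analyticOrderAt_deriv_add_one
    simp only [hV0, sub_zero] at h4
    rw [← h4] at h3
    intro h0
    have h5 : analyticOrderAt (deriv V) 0 ≠ 0 := fun h6 =>
      (hV.deriv.analyticOrderAt_eq_zero.1 h6) h0
    have h6 : (2 : ℕ∞) ≤ analyticOrderAt (deriv V) 0 + 1 := by
      have : (1 : ℕ∞) ≤ analyticOrderAt (deriv V) 0 := Order.one_le_iff_pos.2 (pos_iff_ne_zero.2 h5)
      calc (2 : ℕ∞) = 1 + 1 := by norm_num
        _ ≤ _ := by gcongr
    have h7 : ((2 * (r' + 1) : ℕ) : ℕ∞) ≤ (r' + 1 : ℕ) := by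
      rw [h3]
      push_cast
      gcongr
    have h8 : 2 * (r' + 1) ≤ r' + 1 := by exact_mod_cast h7
    omega
  have hf₁0 : f₁ (0, t₀) = 0 := by
    rw [hfψ₁.self_of_nhds, hψ₁0, zero_pow hm]
  have hfd : ∀ᶠ q in 𝓝 ((0 : ℂ), t₀),
      fderiv ℂ (fun q => V (f₁ q)) q = deriv V (f₁ q) • fderiv ℂ f₁ q := by
    have ht : Tendsto f₁ (𝓝 (0, t₀)) (𝓝 0) := by
      have := hf₁.1.continuousAt.tendsto
      rwa [hf₁0] at this
    filter_upwards [hf₁.1.eventually_analyticAt, ht.eventually hV.eventually_analyticAt]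
      with q h1 h2
    exact (h2.differentiableAt.hasDerivAt.comp_hasFDerivAt q
      h1.differentiableAt.hasFDerivAt).fderiv
  refine ⟨fun q => V (f₁ q), f₂, hf₁.2.isFirstIntegral
    (AnalyticAt.comp (g := V) (by rwa [hf₁0]) hf₁.1) ?_ ?_, hf₂, ?_⟩
  · rw [hfd.self_of_nhds, hf₁0]
    exact smul_ne_zero hVd hf₁.2.2.1
  · filter_upwards [hfd] with q hq
    rw [hq, wedge_smul_left, wedge_self, mul_zero]
  · have ht : Tendsto ψ₁ (𝓝 t₀) (𝓝 0) := by
      have := hψ₁.continuousAt.tendsto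
      rwa [hψ₁0] at this
    filter_upwards [hfψ₁, hfψ₂, ht.eventually hVh, hσl] with t h1 h2 h3 h4
    rw [h1, h3, h4, h2]

/-! ### Radial conjugacies in the blow-up -/

/-- The homothety of ratio `ℓ` along the lines through the origin, in the blow-up. -/
def fiberMap (ℓ : ℂ × ℂ → ℂ) (q : ℂ × ℂ) : ℂ × ℂ := (q.1 * ℓ q, q.2)

theorem analyticAt_fiberMap {ℓ : ℂ × ℂ → ℂ} {q : ℂ × ℂ} (hℓ : AnalyticAt ℂ ℓ q) :
    AnalyticAt ℂ (fiberMap ℓ) q :=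
  (analyticAt_fst.mul hℓ).prod analyticAt_snd

theorem fiberMap_zero (ℓ : ℂ × ℂ → ℂ) (t : ℂ) : fiberMap ℓ (0, t) = (0, t) := by
  simp [fiberMap]

theorem tendsto_fiberMap {ℓ : ℂ × ℂ → ℂ} (hℓ : AnalyticAt ℂ ℓ (0, t₀)) :
    Tendsto (fiberMap ℓ) (𝓝 (0, t₀)) (𝓝 (0, t₀)) := by
  have := (analyticAt_fiberMap hℓ).continuousAt.tendsto
  rwa [fiberMap_zero] at this

theorem blowDown_fiberMap (i : Fin 2) (ℓ : ℂ × ℂ → ℂ) (q : ℂ × ℂ) :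
    blowDown i (fiberMap ℓ q) = ℓ q • blowDown i q := by
  unfold blowDown fiberMap
  rw [smul_smul, mul_comm]

/-- `F₁` and `F₂` are conjugated by a radial map near the points `(0, t)` of the chart `i`. -/
theorem exists_fiberMap_wedge_eq_zero {X₁ X₂ : RadialField} {D : ExcDiv →₀ ℕ}
    (hF₁ : F₁.InD) (hF₂ : F₂.InD) (h₁ : F₁.IsHomogeneousWrt X₁) (h₂ : F₂.IsHomogeneousWrt X₂)
    (hX₁ : ∀ᶠ p in 𝓝 (0 : ℂ × ℂ), X₁.toFun p = p) (hX₂ : ∀ᶠ p in 𝓝 (0 : ℂ × ℂ), X₂.toFun p = p)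
    (hD₁ : F₁.IsTangRestrict X₁ D) (hD₂ : F₂.IsTangRestrict X₂ D)
    (hH : F₁.holonomy = F₂.holonomy) (i : Fin 2) (t₀ : ℂ) :
    ∃ ℓ : ℂ × ℂ → ℂ, AnalyticAt ℂ ℓ (0, t₀) ∧ ℓ (0, t₀) ≠ 0 ∧
      ∀ᶠ q in 𝓝 ((0 : ℂ), t₀),
        wedge ((F₂.pullback i (fiberMap ℓ q)).comp (fderiv ℂ (fiberMap ℓ) q))
          (F₁.pullback i q) = 0 := by
  obtain ⟨η₁, hη₁⟩ := hF₁ i t₀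
  obtain ⟨η₂, hη₂⟩ := hF₂ i t₀
  obtain ⟨f₁, f₂, v₁, v₂, k, hf₁, hf₂, hv₁, hv₂, hv₁0, hv₂0, hff, hfv₁, hfv₂⟩ :
      ∃ (f₁ f₂ v₁ v₂ : ℂ × ℂ → ℂ) (k : ℕ), F₁.IsFirstIntegral i t₀ f₁ ∧
        F₂.IsFirstIntegral i t₀ f₂ ∧ AnalyticAt ℂ v₁ (0, t₀) ∧ AnalyticAt ℂ v₂ (0, t₀) ∧
        v₁ (0, t₀) ≠ 0 ∧ v₂ (0, t₀) ≠ 0 ∧ (∀ᶠ t in 𝓝 t₀, f₁ (0, t) = f₂ (0, t)) ∧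
        (∀ᶠ q in 𝓝 ((0 : ℂ), t₀), f₁ q = f₁ (0, q.2) + q.1 * (q.2 - t₀) ^ k * v₁ q) ∧
        ∀ᶠ q in 𝓝 ((0 : ℂ), t₀), f₂ q = f₂ (0, q.2) + q.1 * (q.2 - t₀) ^ k * v₂ q := by
    -- A common holonomy germ exists exactly at the tangency points with the divisor. There `∂_t f`
    -- vanishes at the point, hence `∂_x f` does not, and the contact exponent is `k = 0`.
    by_cases htan : ∃ h, F₁.IsHolonomyInChart i t₀ h ∧ F₂.IsHolonomyInChart i t₀ h
    · obtain ⟨h, hh₁, hh₂⟩ := htan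
      obtain ⟨f₁, f₂, hf₁, hf₂, hff⟩ := hh₁.exists_first_integrals hh₂
      have key {F : FoliationGerm} {f : ℂ × ℂ → ℂ} (hh : F.IsHolonomyInChart i t₀ h)
          (hf : F.IsFirstIntegral i t₀ f) : ∃ v : ℂ × ℂ → ℂ, AnalyticAt ℂ v (0, t₀) ∧
          v (0, t₀) ≠ 0 ∧
          ∀ᶠ q in 𝓝 ((0 : ℂ), t₀), f q = f (0, q.2) + q.1 * (q.2 - t₀) ^ 0 * v q := by
        obtain ⟨v, hv, hv0, hfv⟩ := exists_eq_add_mul_of_fderiv_eq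
          (P := fun t => (t - t₀) ^ 0) (W := fun q => fderiv ℂ f q (1, 0)) hf.1
          (analyticAt_covector_apply hf.1.fderiv _) (.of_forall fun q => by simp)
        refine ⟨v, hv, fun h0 => hf.2.2.1 (covector_ext ?_ (hh.apply_eq_zero hf.2)), hfv⟩
        rw [← hv0, h0]
        rfl
      obtain ⟨v₁, hv₁, hv₁0, hfv₁⟩ := key hh₁ hf₁
      obtain ⟨v₂, hv₂, hv₂0, hfv₂⟩ := key hh₂ hf₂
      exact ⟨f₁, f₂, v₁, v₂, 0, hf₁, hf₂, hv₁, hv₂, hv₁0, hv₂0, hff, hfv₁, hfv₂⟩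
    -- If one foliation were tangent to the divisor here, its holonomy germ would belong to both
    -- holonomies. So both are transverse, and the contact exponent is the coefficient of `D` at the
    -- point.
    · have hB₁ : η₁ (0, t₀) (0, 1) ≠ 0 := fun h0 => by
        obtain ⟨h, hh⟩ := hF₁.exists_isHolonomyInChart hη₁ h0
        have : (pt i t₀, h) ∈ F₂.holonomy := hH ▸ hh.isHolonomyAt
        exact htan ⟨h, hh, FoliationGerm.IsHolonomyAt.isHolonomyInChart this⟩
      have hB₂ : η₂ (0, t₀) (0, 1) ≠ 0 := fun h0 => by
        obtain ⟨h, hh⟩ := hF₂.exists_isHolonomyInChart hη₂ h0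
        have : (pt i t₀, h) ∈ F₁.holonomy := hH ▸ hh.isHolonomyAt
        exact htan ⟨h, FoliationGerm.IsHolonomyAt.isHolonomyInChart this, hh⟩
      have key {F : FoliationGerm} {X : RadialField} {η : ℂ × ℂ → (ℂ × ℂ →L[ℂ] ℂ)}
          (h : F.IsHomogeneousWrt X) (hX : ∀ᶠ p in 𝓝 (0 : ℂ × ℂ), X.toFun p = p)
          (hD : F.IsTangRestrict X D) (hη : F.IsLocalGenerator i t₀ η)
          (hB : η (0, t₀) (0, 1) ≠ 0) : ∃ z v : ℂ × ℂ → ℂ, F.IsFirstIntegral i t₀ z ∧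
          AnalyticAt ℂ v (0, t₀) ∧ v (0, t₀) ≠ 0 ∧ (∀ᶠ t in 𝓝 t₀, z (0, t) = t) ∧
          ∀ᶠ q in 𝓝 ((0 : ℂ), t₀), z q = z (0, q.2) + q.1 * (q.2 - t₀) ^ (D (pt i t₀)) * v q := by
        obtain ⟨z, v, hz, hv, hv0, hz0, hzt, hzη, hzv⟩ :=
          h.exists_first_integral hX hη (hD.analyticOrderAt_eq hX hη) hB
        refine ⟨z, v, hη.isFirstIntegral hz (fun h0 => ?_) hzη, hv, hv0, hz0, hzv⟩
        rw [h0] at hzt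
        exact zero_ne_one hzt
      obtain ⟨f₁, v₁, hf₁, hv₁, hv₁0, hz₁, hfv₁⟩ := key h₁ hX₁ hD₁ hη₁ hB₁
      obtain ⟨f₂, v₂, hf₂, hv₂, hv₂0, hz₂, hfv₂⟩ := key h₂ hX₂ hD₂ hη₂ hB₂
      refine ⟨f₁, f₂, v₁, v₂, _, hf₁, hf₂, hv₁, hv₂, hv₁0, hv₂0, ?_, hfv₁, hfv₂⟩
      filter_upwards [hz₁, hz₂] with t e1 e2
      rw [e1, e2]
  obtain ⟨ℓ, hℓ, hℓ0, hev⟩ := exists_fibered_conjugacy k hv₁ hv₂ hv₁0 hv₂0 hff hfv₁ hfv₂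
  refine ⟨ℓ, hℓ, hℓ0, ?_⟩
  have hS := tendsto_fiberMap hℓ
  filter_upwards [hev.eventually_nhds, hS.eventually hf₂.1.eventually_analyticAt,
    hℓ.eventually_analyticAt, ((F₁.isLocalGenerator_iff i t₀ _).1 hf₁.2).2.2,
    hS.eventually ((F₂.isLocalGenerator_iff i t₀ _).1 hf₂.2).2.2,
    hf₁.1.fderiv.continuousAt.eventually_ne hf₁.2.2.1] with q e1 e2 e3 e4 e5 e6
  have e7 : fderiv ℂ f₁ q = (fderiv ℂ f₂ (fiberMap ℓ q)).comp (fderiv ℂ (fiberMap ℓ) q) := by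
    rw [← fderiv_comp q e2.differentiableAt (analyticAt_fiberMap e3).differentiableAt]
    exact (Filter.EventuallyEq.fderiv_eq e1).symm
  have e8 := wedge_comp (F₂.pullback i (fiberMap ℓ q)) (fderiv ℂ f₂ (fiberMap ℓ q))
    (fderiv ℂ (fiberMap ℓ) q)
  rw [e5, zero_mul, ← e7] at e8
  exact wedge_eq_zero_trans e6 e8 (by rw [wedge_swap, e4, neg_zero])

theorem eventually_det_fiberMap_ne_zero {m : ℂ × ℂ → ℂ} (hm : AnalyticAt ℂ m (0, t₀))
    (hm0 : m (0, t₀) ≠ 0) : ∀ᶠ q in 𝓝 ((0 : ℂ), t₀),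
      (fderiv ℂ (fiberMap m) q (1, 0)).1 * (fderiv ℂ (fiberMap m) q (0, 1)).2
      - (fderiv ℂ (fiberMap m) q (0, 1)).1 * (fderiv ℂ (fiberMap m) q (1, 0)).2 ≠ 0 := by
  have hD (v : ℂ × ℂ) : AnalyticAt ℂ (fun q => fderiv ℂ (fiberMap m) q v) (0, t₀) :=
    analyticAt_clm_apply (analyticAt_fiberMap hm).fderiv analyticAt_const
  have ha := ((analyticAt_fst.comp (hD (1, 0))).mul (analyticAt_snd.comp (hD (0, 1)))).sub
      ((analyticAt_fst.comp (hD (0, 1))).mul (analyticAt_snd.comp (hD (1, 0))))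
  refine ha.continuousAt.eventually_ne ?_
  have h1 : HasFDerivAt (fiberMap m) _ ((0 : ℂ), t₀) :=
    (hasFDerivAt_fst.mul hm.differentiableAt.hasFDerivAt).prodMk hasFDerivAt_snd
  simp [h1.fderiv, hm0]

/-- Uniqueness of radial conjugacies. -/
theorem eventually_eq_of_fiberMap_wedge_eq_zero (hF₁ : F₁.InD) (hF₂ : F₂.InD)
    (hA₂ : ∀ i t η, F₂.IsLocalGenerator i t η →
      analyticOrderAt (fun t : ℂ => η (0, t) (1, 0)) t ≠ ⊤)
    {ℓ ℓ' : ℂ × ℂ → ℂ} (hℓ : AnalyticAt ℂ ℓ (0, t₀)) (hℓ' : AnalyticAt ℂ ℓ' (0, t₀))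
    (hℓ0 : ℓ (0, t₀) ≠ 0) (hℓ0' : ℓ' (0, t₀) ≠ 0)
    (hw : ∀ᶠ q in 𝓝 ((0 : ℂ), t₀), q.1 ≠ 0 →
        wedge ((F₂.pullback i (fiberMap ℓ q)).comp (fderiv ℂ (fiberMap ℓ) q))
          (F₁.pullback i q) = 0)
    (hw' : ∀ᶠ q in 𝓝 ((0 : ℂ), t₀), q.1 ≠ 0 →
        wedge ((F₂.pullback i (fiberMap ℓ' q)).comp (fderiv ℂ (fiberMap ℓ') q))
          (F₁.pullback i q) = 0) :
    ∀ᶠ q in 𝓝 ((0 : ℂ), t₀), ℓ q = ℓ' q := by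
  obtain ⟨η, hη⟩ := hF₂ i t₀
  obtain ⟨R, hR, hball⟩ := Metric.eventually_nhds_iff_ball.1
    (hℓ.eventually_analyticAt.and hℓ'.eventually_analyticAt)
  have hAne := (analyticAt_restrict (v := (1, 0)) hη.1).eventually_eq_zero_or_eventually_ne_zero
    |>.resolve_left fun h => hA₂ i t₀ η hη (analyticOrderAt_eq_top.2 h)
  have hBne := (analyticAt_restrict (v := (0, 1)) hη.1).eventually_eq_zero_or_eventually_ne_zero
    |>.resolve_left fun h => hF₂.not_isInvariantAt i t₀ ⟨η, hη, analyticOrderAt_eq_top.2 h⟩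
  have hnear : ∀ᶠ t in 𝓝[≠] t₀, ((0 : ℂ), t) ∈ Metric.ball ((0 : ℂ), t₀) R :=
    nhdsWithin_le_nhds ((tendsto_zero_prodMk t₀).eventually (Metric.ball_mem_nhds _ hR))
  -- A nearby point of the divisor where `F₂` is transverse both to the divisor and to the fibres.
  obtain ⟨t₁, hA, hB, hb, hη₁, ⟨hw₁, hw₁'⟩, hne, hne'⟩ := (hAne.and (hBne.and (hnear.and
    (nhdsWithin_le_nhds (hη.eventually.and ((tendsto_zero_prodMk t₀).eventually
      ((hw.eventually_nhds.and hw'.eventually_nhds).and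
      ((hℓ.continuousAt.eventually_ne hℓ0).and
        (hℓ'.continuousAt.eventually_ne hℓ0'))))))))).exists
  obtain ⟨hℓ₁, hℓ₁'⟩ := hball _ hb
  obtain ⟨z, hz, hz0, hzη⟩ := exists_first_integral_of_transverse hη₁.1 hB
  obtain ⟨η₁, hgen₁⟩ := hF₁ i t₁
  have hzt : fderiv ℂ z (0, t₁) (0, 1) = 1 :=
    (hasDerivAt_restrict hz).unique ((hasDerivAt_id t₁).congr_of_eventuallyEq hz0)
  have hzx : fderiv ℂ z (0, t₁) (1, 0) ≠ 0 := by
    intro h0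
    have := hzη.self_of_nhds
    unfold wedge at this
    rw [h0, hzt, zero_mul, zero_sub, one_mul, neg_eq_zero] at this
    exact hA this
  have hd0 : fderiv ℂ z (0, t₁) ≠ 0 := fun h0 => by
    rw [h0] at hzx
    exact hzx rfl
  have hzF := hη₁.isFirstIntegral hz hd0 hzη
  -- For either solution `m`, the function `z ∘ fiberMap m` is a first integral of `F₁` equal to `t`
  -- on the divisor. Such a function is unique, and since `(z, t)` are coordinates it determines
  -- `fiberMap m`.
  have key {m : ℂ × ℂ → ℂ} (hm : AnalyticAt ℂ m (0, t₁)) (hm0 : m (0, t₁) ≠ 0)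
      (hwm : ∀ᶠ q in 𝓝 ((0 : ℂ), t₁), q.1 ≠ 0 →
        wedge ((F₂.pullback i (fiberMap m q)).comp (fderiv ℂ (fiberMap m) q))
          (F₁.pullback i q) = 0) :
      AnalyticAt ℂ (fun q => z (fiberMap m q)) (0, t₁) ∧
      (∀ᶠ t in 𝓝 t₁, z (fiberMap m (0, t)) = t) ∧
      fderiv ℂ (fun q => z (fiberMap m q)) (0, t₁) (0, 1) ≠ 0 ∧
      ∀ᶠ q in 𝓝 ((0 : ℂ), t₁), wedge (fderiv ℂ (fun q => z (fiberMap m q)) q) (η₁ q) = 0 := by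
    have ha : AnalyticAt ℂ (fun q => z (fiberMap m q)) (0, t₁) :=
      AnalyticAt.comp (g := z) (by rwa [fiberMap_zero]) (analyticAt_fiberMap hm)
    have h0 : ∀ᶠ t in 𝓝 t₁, z (fiberMap m (0, t)) = t := by
      filter_upwards [hz0] with t ht
      rw [fiberMap_zero, ht]
    refine ⟨ha, h0, ?_, ?_⟩
    · rw [(hasDerivAt_restrict ha).unique ((hasDerivAt_id t₁).congr_of_eventuallyEq h0)]
      exact one_ne_zero
    · refine hgen₁.wedge_eq_zero ha.fderiv ?_
      have hS := tendsto_fiberMap hm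
      filter_upwards [hwm, hS.eventually ((F₂.isLocalGenerator_iff i t₁ _).1 hzF.2).2.2,
        hS.eventually hz.eventually_analyticAt, hm.eventually_analyticAt,
        hS.eventually (F₂.pullback_ne_zero i t₁), hm.continuousAt.eventually_ne hm0,
        eventually_det_fiberMap_ne_zero hm hm0] with q e1 e2 e3 e4 e5 e6 e7 e8
      have e9 : fderiv ℂ (fun q => z (fiberMap m q)) q
          = (fderiv ℂ z (fiberMap m q)).comp (fderiv ℂ (fiberMap m) q) :=
        fderiv_comp q e3.differentiableAt (analyticAt_fiberMap e4).differentiableAt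
      have e10 := wedge_comp (F₂.pullback i (fiberMap m q)) (fderiv ℂ z (fiberMap m q))
        (fderiv ℂ (fiberMap m) q)
      rw [e2, zero_mul, ← e9] at e10
      refine wedge_eq_zero_trans (comp_ne_zero_of_det_ne_zero (e5 ?_) e7)
        (by rw [wedge_swap, e10, neg_zero]) (e1 e8)
      exact mul_ne_zero e8 e6
  obtain ⟨ha, h0, hd, hwz⟩ := key hℓ₁ hne hw₁
  obtain ⟨ha', h0', -, hwz'⟩ := key hℓ₁' hne' hw₁'
  have heq := eq_of_wedge_eq_zero_of_eq ha ha' hd (by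
    filter_upwards [hwz, hwz', hgen₁.1.continuousAt.eventually_ne hgen₁.2.1] with q e1 e2 e3
    exact wedge_eq_zero_trans e3 e2 (by rw [wedge_swap, e1, neg_zero])) (by
    filter_upwards [h0, h0'] with t e1 e2
    rw [e1, e2])
  have hχ : AnalyticAt ℂ (fun q => (z q, q.2)) (0, t₁) := hz.prod analyticAt_snd
  obtain ⟨ζ, -, -, hζ, -⟩ := exists_local_inverse_of_det_ne_zero hχ (by
    have h1 : HasFDerivAt (fun q => (z q, q.2)) _ ((0 : ℂ), t₁) :=
      hz.differentiableAt.hasFDerivAt.prodMk hasFDerivAt_snd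
    simpa [h1.fderiv] using hzx)
  have hloc : ∀ᶠ q in 𝓝 ((0 : ℂ), t₁), ℓ q = ℓ' q := by
    refine eventually_eq_of_fst_ne_zero (AnalyticAt.eventually_continuousAt hℓ₁)
      (AnalyticAt.eventually_continuousAt hℓ₁') ?_
    filter_upwards [(tendsto_fiberMap hℓ₁).eventually hζ, (tendsto_fiberMap hℓ₁').eventually hζ,
      heq] with q e1 e2 e3 e4
    have e5 : fiberMap ℓ q = fiberMap ℓ' q := by
      rw [← e1, ← e2, e3]
      rfl
    exact mul_left_cancel₀ e4 (congrArg Prod.fst e5)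
  -- The identity theorem on a ball containing both points brings the equality near `(0, t₁)` back
  -- to a neighbourhood of `(0, t₀)`.
  have := AnalyticOnNhd.eqOn_of_preconnected_of_eventuallyEq (fun q hq => (hball q hq).1)
    (fun q hq => (hball q hq).2) (convex_ball ((0 : ℂ), t₀) R).isPreconnected hb hloc
  filter_upwards [Metric.ball_mem_nhds _ hR] with q hq using this hq

end

/-! ### Gluing radial conjugacies -/

/-- The radial map `p ↦ Λ p • p` conjugates `F₁` to `F₂` at `p`. -/
def RadialConjAt (F₁ F₂ : FoliationGerm) (Λ : ℂ × ℂ → ℂ) (p : ℂ × ℂ) : Prop :=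
  wedge ((F₂.form (Λ p • p)).comp (fderiv ℂ (fun p => Λ p • p) p)) (F₁.form p) = 0

/-- The function `Λ` is a radial conjugacy near the point `(0, t₀)` of the chart `i`, where it is
given by the unit `ℓ`. -/
structure IsLocalSolution (F₁ F₂ : FoliationGerm) (i : Fin 2) (t₀ : ℂ) (Λ ℓ : ℂ × ℂ → ℂ) :
    Prop where
  analyticAt : AnalyticAt ℂ ℓ (0, t₀)
  ne_zero : ℓ (0, t₀) ≠ 0
  eq : ∀ᶠ q in 𝓝 ((0 : ℂ), t₀), q.1 ≠ 0 → Λ (blowDown i q) = ℓ q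
  conj : ∀ᶠ q in 𝓝 ((0 : ℂ), t₀), q.1 ≠ 0 → RadialConjAt F₁ F₂ Λ (blowDown i q)

theorem analyticAt_blowUp {i : Fin 2} {p : ℂ × ℂ} (hp : mainCoord i p ≠ 0) :
    AnalyticAt ℂ (blowUp i) p :=
  (analyticAt_mainCoord_comp i analyticAt_id).prod
    ((analyticAt_sideCoord_comp i analyticAt_id).div (analyticAt_mainCoord_comp i analyticAt_id) hp)

theorem eventually_nhds_blowDown {i : Fin 2} {q : ℂ × ℂ} (hq : q.1 ≠ 0) {P : ℂ × ℂ → Prop}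
    (h : ∀ᶠ q' in 𝓝 q, P q') : ∀ᶠ p in 𝓝 (blowDown i q), P (blowUp i p) ∧
      blowDown i (blowUp i p) = p := by
  have hm : mainCoord i (blowDown i q) ≠ 0 := by rwa [mainCoord_blowDown]
  have h1 := (analyticAt_blowUp hm).continuousAt.tendsto
  rw [blowUp_blowDown i hq] at h1
  have h2 : ∀ᶠ p in 𝓝 (blowDown i q), mainCoord i p ≠ 0 :=
    (analyticAt_mainCoord_comp i analyticAt_id).continuousAt.eventually_ne hm
  filter_upwards [h1.eventually h, h2] with p h3 h4
  exact ⟨h3, blowDown_blowUp h4⟩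

theorem RadialConjAt.congr {F₁ F₂ : FoliationGerm} {Λ Λ' : ℂ × ℂ → ℂ} {p : ℂ × ℂ}
    (h : RadialConjAt F₁ F₂ Λ p) (hΛ : ∀ᶠ p' in 𝓝 p, Λ p' = Λ' p') : RadialConjAt F₁ F₂ Λ' p := by
  unfold RadialConjAt at *
  have h1 : (fun p => Λ p • p) =ᶠ[𝓝 p] fun p => Λ' p • p := by
    filter_upwards [hΛ] with p' h
    rw [h]
  rwa [h1.fderiv_eq, hΛ.self_of_nhds] at h

section

variable {F₁ F₂ : FoliationGerm} {i j : Fin 2} {t₀ s₀ : ℂ} {Λ ℓ : ℂ × ℂ → ℂ}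

/-- Off the divisor the blow-down map is a local biholomorphism conjugating `fiberMap ℓ` to `p ↦ Λ p
• p`, so the two wedges differ by a nonzero determinant. -/
theorem radialConjAt_blowDown_iff {q : ℂ × ℂ} (hq : q.1 ≠ 0) (hℓ : AnalyticAt ℂ ℓ q)
    (hΛ : ∀ᶠ q' in 𝓝 q, Λ (blowDown i q') = ℓ q') :
    RadialConjAt F₁ F₂ Λ (blowDown i q) ↔
      wedge ((F₂.pullback i (fiberMap ℓ q)).comp (fderiv ℂ (fiberMap ℓ) q))
        (F₁.pullback i q) = 0 := by
  have hm : mainCoord i (blowDown i q) ≠ 0 := by rwa [mainCoord_blowDown]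
  have hΛa : AnalyticAt ℂ Λ (blowDown i q) := by
    have h1 : AnalyticAt ℂ (fun p => ℓ (blowUp i p)) (blowDown i q) :=
      AnalyticAt.comp (g := ℓ) (by rwa [blowUp_blowDown i hq]) (analyticAt_blowUp hm)
    refine h1.congr ?_
    filter_upwards [eventually_nhds_blowDown hq hΛ] with p hp
    rw [← hp.1, hp.2]
  have hd : (fderiv ℂ (fun p => Λ p • p) (blowDown i q)).comp (fderiv ℂ (blowDown i) q)
      = (fderiv ℂ (blowDown i) (fiberMap ℓ q)).comp (fderiv ℂ (fiberMap ℓ) q) := by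
    rw [← fderiv_comp q (analyticAt_blowDown i _).differentiableAt
      (analyticAt_fiberMap hℓ).differentiableAt,
      ← fderiv_comp (g := fun p => Λ p • p) q (hΛa.smul analyticAt_id).differentiableAt
        (analyticAt_blowDown i _).differentiableAt]
    refine Filter.EventuallyEq.fderiv_eq ?_
    filter_upwards [hΛ] with q' h
    rw [Function.comp_apply, Function.comp_apply, blowDown_fiberMap, h]
  unfold RadialConjAt FoliationGerm.pullback
  rw [ContinuousLinearMap.comp_assoc, ← hd, blowDown_fiberMap, ← hΛ.self_of_nhds,
    ← ContinuousLinearMap.comp_assoc, wedge_comp]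
  constructor
  · intro h
    rw [h, zero_mul]
  · intro h
    exact (mul_eq_zero.1 h).resolve_right (det_fderiv_blowDown_ne_zero i hq)

theorem eventually_nhds_of_fst_ne_zero {P : ℂ × ℂ → Prop} {a : ℂ × ℂ}
    (h : ∀ᶠ q in 𝓝 a, q.1 ≠ 0 → P q) : ∀ᶠ q in 𝓝 a, q.1 ≠ 0 → ∀ᶠ q' in 𝓝 q, P q' := by
  filter_upwards [h.eventually_nhds] with q h1 h2
  filter_upwards [h1, continuous_fst.continuousAt.eventually_ne h2] with q' h3 h4 using h3 h4

theorem IsLocalSolution.fiberMap_wedge_eq_zero (h : IsLocalSolution F₁ F₂ i t₀ Λ ℓ) :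
    ∀ᶠ q in 𝓝 ((0 : ℂ), t₀), q.1 ≠ 0 →
      wedge ((F₂.pullback i (fiberMap ℓ q)).comp (fderiv ℂ (fiberMap ℓ) q))
        (F₁.pullback i q) = 0 := by
  filter_upwards [eventually_nhds_of_fst_ne_zero h.eq, h.conj, h.analyticAt.eventually_analyticAt]
    with q h1 h2 h3 h4
  exact (radialConjAt_blowDown_iff h4 h3 (h1 h4)).1 (h2 h4)

theorem IsLocalSolution.of_fiberMap (hℓ : AnalyticAt ℂ ℓ (0, t₀)) (h0 : ℓ (0, t₀) ≠ 0)
    (h : ∀ᶠ q in 𝓝 ((0 : ℂ), t₀),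
      wedge ((F₂.pullback i (fiberMap ℓ q)).comp (fderiv ℂ (fiberMap ℓ) q))
        (F₁.pullback i q) = 0) :
    IsLocalSolution F₁ F₂ i t₀ (fun p => ℓ (blowUp i p)) ℓ := by
  have heq : ∀ᶠ q in 𝓝 ((0 : ℂ), t₀), q.1 ≠ 0 → ℓ (blowUp i (blowDown i q)) = ℓ q :=
    .of_forall fun q hq => by rw [blowUp_blowDown i hq]
  refine ⟨hℓ, h0, heq, ?_⟩
  filter_upwards [h, eventually_nhds_of_fst_ne_zero heq, hℓ.eventually_analyticAt]
    with q h1 h2 h3 h4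
  exact (radialConjAt_blowDown_iff h4 h3 (h2 h4)).2 h1

theorem IsLocalSolution.eventually (h : IsLocalSolution F₁ F₂ i t₀ Λ ℓ) :
    ∀ᶠ q in 𝓝 ((0 : ℂ), t₀), IsLocalSolution F₁ F₂ i q.2 Λ ℓ := by
  have h1 : Tendsto (fun q : ℂ × ℂ => ((0 : ℂ), q.2)) (𝓝 (0, t₀)) (𝓝 (0, t₀)) :=
    (tendsto_zero_prodMk t₀).comp (continuous_snd.tendsto ((0 : ℂ), t₀))
  filter_upwards [h1.eventually h.analyticAt.eventually_analyticAt,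
    h1.eventually (h.analyticAt.continuousAt.eventually_ne h.ne_zero),
    h1.eventually h.eq.eventually_nhds, h1.eventually h.conj.eventually_nhds] with q e1 e2 e3 e4
  exact ⟨e1, e2, e3, e4⟩

theorem IsLocalSolution.chart_change (h : IsLocalSolution F₁ F₂ i t₀ Λ ℓ) {T : ℂ × ℂ → ℂ × ℂ}
    (hT : BiholGerm.one.IsLift j s₀ i t₀ T) :
    IsLocalSolution F₁ F₂ j s₀ Λ fun q => ℓ (T q) := by
  have hT' : ∀ᶠ q in 𝓝 ((0 : ℂ), s₀), blowDown i (T q) = blowDown j q := hT.comm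
  refine ⟨hT.analyticAt_comp h.analyticAt, by simpa only [hT.base] using h.ne_zero, ?_, ?_⟩
  · filter_upwards [hT', hT.tendsto.eventually h.eq] with q h1 h2 h3
    rw [← h1]
    refine h2 fun h4 => h3 ?_
    rwa [← blowDown_eq_zero (i := i), h1, blowDown_eq_zero] at h4
  · filter_upwards [hT', hT.tendsto.eventually h.conj] with q h1 h2 h3
    rw [← h1]
    refine h2 fun h4 => h3 ?_
    rwa [← blowDown_eq_zero (i := i), h1, blowDown_eq_zero] at h4

/-- Local radial conjugacies glue to a radial conjugacy near the whole exceptional divisor. -/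
theorem exists_global_solution (hF₁ : F₁.InD) (hF₂ : F₂.InD)
    (hA₂ : ∀ i t η, F₂.IsLocalGenerator i t η →
      analyticOrderAt (fun t : ℂ => η (0, t) (1, 0)) t ≠ ⊤)
    (hex : ∀ i t₀, ∃ Λ ℓ, IsLocalSolution F₁ F₂ i t₀ Λ ℓ) :
    ∃ Λ, ∀ i t₀, ∃ ℓ, IsLocalSolution F₁ F₂ i t₀ Λ ℓ := by
  choose ci ct hct using exists_eq_pt
  choose Λ₀ ℓ₀ hsol using hex
  let e : ℂ × ℂ → ExcDiv := fun p => if h : p = 0 then pt 0 0 else Projectivization.mk ℂ p h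
  -- `a p` is the solution chosen at the point of the divisor below `p`, evaluated at `c p`. Only
  -- its germ at `c = 0` is meaningful, as `p` may lie outside the domain of that solution.
  let a : ℂ × ℂ → ℂ → ℂ := fun p c =>
    ℓ₀ (ci (e p)) (ct (e p)) (c * mainCoord (ci (e p)) p, ct (e p))
  -- The sum at `c = 1` of the Taylor series of `a p` at `c = 0`: it continues the germ of solution
  -- along the line from the divisor up to `p`. Uniqueness makes the germ independent of choices, so
  -- `Λ` coincides with every local solution near its base point.
  let Λ : ℂ × ℂ → ℂ := fun p =>
    ∑' n : ℕ, (n.factorial : ℂ)⁻¹ • ((1 : ℂ) - 0) ^ n • iteratedDeriv n (a p) 0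
  have key : ∀ i t₀, ∀ᶠ q in 𝓝 ((0 : ℂ), t₀), q.1 ≠ 0 → Λ (blowDown i q) = ℓ₀ i t₀ q := by
    intro j s₀
    have hs := hsol j s₀
    obtain ⟨R, hR, hball⟩ := Metric.eventually_nhds_iff_ball.1 hs.analyticAt.eventually_analyticAt
    filter_upwards [hs.eventually, Metric.ball_mem_nhds _ hR] with q hq hqR hq0
    set p := blowDown j q
    have hp0 : p ≠ 0 := fun h => hq0 (blowDown_eq_zero.1 h)
    have he : e p = Projectivization.mk ℂ p hp0 := dif_neg hp0
    have he1 : e p = pt j q.2 := by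
      rw [he, mk_eq_pt_iff, mainCoord_blowDown, sideCoord_blowDown]
      exact ⟨hq0, mul_div_cancel_left₀ _ hq0⟩
    set k := ci (e p)
    set s := ct (e p)
    have he2 : e p = pt k s := hct (e p)
    obtain ⟨hm, hside⟩ := (mk_eq_pt_iff hp0).1 (he.symm.trans he2)
    have hpk : p = mainCoord k p • dir k s := by
      rw [← hside]
      exact eq_smul_dir hm
    obtain ⟨T, hT⟩ := exists_chart_change (he1.symm.trans he2)
    have hs' := (hsol k s).chart_change hT
    have huniq := eventually_eq_of_fiberMap_wedge_eq_zero hF₁ hF₂ hA₂ hq.analyticAt hs'.analyticAt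
      hq.ne_zero hs'.ne_zero hq.fiberMap_wedge_eq_zero hs'.fiberMap_wedge_eq_zero
    have ht1 : Tendsto (fun c : ℂ => (c * q.1, q.2)) (𝓝 0) (𝓝 (0, q.2)) := by
      have : Continuous fun c : ℂ => (c * q.1, q.2) := by fun_prop
      simpa using this.tendsto 0
    have ht2 : Tendsto (fun c : ℂ => (c * mainCoord k p, s)) (𝓝 0) (𝓝 (0, s)) := by
      have : Continuous fun c : ℂ => (c * mainCoord k p, s) := by fun_prop
      simpa using this.tendsto 0
    have hne : ∀ᶠ c in 𝓝[≠] (0 : ℂ), a p c = ℓ₀ j s₀ (c * q.1, q.2) := by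
      filter_upwards [nhdsWithin_le_nhds (ht1.eventually huniq),
        nhdsWithin_le_nhds (ht1.eventually hs'.eq),
        nhdsWithin_le_nhds (ht2.eventually (hsol k s).eq), self_mem_nhdsWithin] with c e1 e2 e3 hc
      have e4 : blowDown j (c * q.1, q.2) = blowDown k (c * mainCoord k p, s) := by
        have e5 : blowDown j (c * q.1, q.2) = c • p := by
          simp only [p, blowDown, smul_smul]
        rw [e5]
        conv_lhs => rw [hpk]
        simp only [blowDown, smul_smul]
      change ℓ₀ k s (c * mainCoord k p, s) = _
      rw [e1, ← e2 (mul_ne_zero hc hq0), e4, e3 (mul_ne_zero hc hm)]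
    have hca : AnalyticAt ℂ (a p) 0 := by
      refine AnalyticAt.comp (g := ℓ₀ k s) ?_ ((analyticAt_id.mul analyticAt_const).prod
        analyticAt_const)
      simpa using (hsol k s).analyticAt
    have hcl : AnalyticAt ℂ (fun c => ℓ₀ j s₀ (c * q.1, q.2)) 0 := by
      refine AnalyticAt.comp (g := ℓ₀ j s₀) ?_ ((analyticAt_id.mul analyticAt_const).prod
        analyticAt_const)
      simpa using hq.analyticAt
    have hev : a p =ᶠ[𝓝 0] fun c => ℓ₀ j s₀ (c * q.1, q.2) :=
      (hca.continuousAt.eventuallyEq_nhds_iff_eventuallyEq_nhdsNE hcl.continuousAt).1 hne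
    have hqn : ‖q.1‖ < R ∧ dist q.2 s₀ < R := by
      rw [Metric.mem_ball, Prod.dist_eq, max_lt_iff, dist_zero_right] at hqR
      exact hqR
    have hqpos : 0 < ‖q.1‖ := norm_pos_iff.2 hq0
    have hdiff : DifferentiableOn ℂ (fun c => ℓ₀ j s₀ (c * q.1, q.2))
        (Metric.ball 0 (R / ‖q.1‖)) := by
      intro c hc
      have h1 : (c * q.1, q.2) ∈ Metric.ball ((0 : ℂ), s₀) R := by
        rw [Metric.mem_ball, Prod.dist_eq, max_lt_iff, dist_zero_right]
        refine ⟨?_, hqn.2⟩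
        rw [mem_ball_zero_iff, lt_div_iff₀ hqpos] at hc
        rwa [norm_mul]
      have h2 : DifferentiableAt ℂ (fun c : ℂ => (c * q.1, q.2)) c := by fun_prop
      exact ((hball _ h1).differentiableAt.comp c h2).differentiableWithinAt
    -- The local solution at `(j, s₀)` is analytic for `|c x| < R`, and `|x| < R` puts `c = 1`
    -- inside this disc, where the Taylor series sums to its value at `q`.
    have htay := Complex.taylorSeries_eq_on_ball hdiff (z := 1) (by
      rw [mem_ball_zero_iff, norm_one, one_lt_div hqpos]
      exact hqn.1)
    simp only [one_mul] at htay
    rw [← htay]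
    exact tsum_congr fun n => by rw [hev.iteratedDeriv_eq n]
  refine ⟨Λ, fun i t₀ => ⟨ℓ₀ i t₀, (hsol i t₀).analyticAt, (hsol i t₀).ne_zero, key i t₀, ?_⟩⟩
  filter_upwards [(hsol i t₀).conj, eventually_nhds_of_fst_ne_zero (key i t₀),
    eventually_nhds_of_fst_ne_zero (hsol i t₀).eq] with q h1 h2 h3 h4
  refine (h1 h4).congr ?_
  filter_upwards [eventually_nhds_blowDown (i := i) h4 ((h2 h4).and (h3 h4))] with p hp
  obtain ⟨⟨e1, e2⟩, e3⟩ := hp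
  rw [← e3, e1, e2]

end

/-! ### Extension of units and of conjugacies across the origin -/

/-- Both `f` and its inverse extend across the origin, and the product of the extensions is `1`
there by continuity. -/
theorem exists_unit_extension {f : ℂ × ℂ → ℂ}
    (hf : ∀ᶠ p in 𝓝[≠] (0 : ℂ × ℂ), AnalyticAt ℂ f p ∧ f p ≠ 0) :
    ∃ g : ℂ × ℂ → ℂ, AnalyticAt ℂ g 0 ∧ g 0 ≠ 0 ∧ ∀ᶠ p in 𝓝[≠] (0 : ℂ × ℂ), g p = f p := by
  obtain ⟨g, hg, hgf⟩ := exists_analytic_extension (hf.mono fun _ h => h.1)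
  obtain ⟨g', hg', hgf'⟩ := exists_analytic_extension (f := fun p => (f p)⁻¹)
    (hf.mono fun _ h => h.1.inv h.2)
  refine ⟨g, hg, fun h0 => ?_, hgf⟩
  have h1 : (fun q => g q * g' q) =ᶠ[𝓝[≠] 0] fun _ => 1 := by
    filter_upwards [hf, hgf, hgf'] with q h1 h2 h3
    rw [h2, h3, mul_inv_cancel₀ h1.2]
  have h2 : Tendsto (fun q => g q * g' q) (𝓝[≠] 0) (𝓝 (g 0 * g' 0)) :=
    (hg.continuousAt.mul hg'.continuousAt).tendsto.mono_left nhdsWithin_le_nhds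
  have h3 := tendsto_nhds_unique h2 (tendsto_const_nhds.congr' h1.symm)
  rw [h0, zero_mul] at h3
  exact zero_ne_one h3

/-- Forms with isolated zeros defining the same foliation off the origin differ by a unit. -/
theorem FoliationGerm.exists_unit_of_wedge_eq_zero (F₁ F₂ : FoliationGerm)
    (h : ∀ᶠ p in 𝓝[≠] (0 : ℂ × ℂ), wedge (F₂.form p) (F₁.form p) = 0) :
    ∃ u : ℂ × ℂ → ℂ, AnalyticAt ℂ u 0 ∧ u 0 ≠ 0 ∧
      ∀ᶠ p in 𝓝 (0 : ℂ × ℂ), F₂.form p = u p • F₁.form p := by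
  classical
  let u : ℂ × ℂ → ℂ := fun p =>
    if hp : ∃ c : ℂ, F₂.form p = c • F₁.form p then hp.choose else 0
  have hu (p : ℂ × ℂ) (hp : ∃ c : ℂ, F₂.form p = c • F₁.form p) : F₂.form p = u p • F₁.form p := by
    simp only [u, dif_pos hp]
    exact hp.choose_spec
  have hnhds {P : ℂ × ℂ → Prop} (hP : ∀ᶠ p in 𝓝[≠] (0 : ℂ × ℂ), P p) :
      ∀ᶠ p in 𝓝[≠] (0 : ℂ × ℂ), ∀ᶠ p' in 𝓝 p, P p' := by
    rw [eventually_nhdsWithin_iff] at hP ⊢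
    filter_upwards [hP.eventually_nhds] with p h1 h2
    filter_upwards [h1, isOpen_ne.mem_nhds h2] with p' h3 h4 using h3 h4
  obtain ⟨g, hg, hg0, hgu⟩ := exists_unit_extension (f := u) (by
    filter_upwards [hnhds h, hnhds F₁.saturated, F₂.saturated,
      nhdsWithin_le_nhds F₁.analyticAt.eventually_analyticAt,
      nhdsWithin_le_nhds F₂.analyticAt.eventually_analyticAt] with p h1 h2 h3 h4 h5
    obtain ⟨v, hv, hvp⟩ := exists_eq_smul_of_wedge_eq_zero h5 h4 h2.self_of_nhds h1
    constructor
    · refine hv.congr ?_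
      filter_upwards [hvp, h2] with p' e1 e2
      have e3 := hu p' ⟨_, e1⟩
      rw [e1] at e3
      exact smul_left_injective ℂ e2 e3
    · intro h0
      have e3 := hu p ⟨_, hvp.self_of_nhds⟩
      rw [h0] at e3
      exact h3 (e3.trans (zero_smul ℂ (F₁.form p))))
  refine ⟨g, hg, hg0, ?_⟩
  have hne : F₂.form =ᶠ[𝓝[≠] 0] fun p => g p • F₁.form p := by
    filter_upwards [h, F₁.saturated, hgu] with p e1 e2 e3
    rw [e3]
    exact hu p ((wedge_eq_zero_iff e2).1 e1)
  exact (F₂.analyticAt.continuousAt.eventuallyEq_nhds_iff_eventuallyEq_nhdsNE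
    (hg.smul F₁.analyticAt).continuousAt).1 hne

/-- Two foliations which are homogeneous with respect to the standard radial field, with the same
holonomy and the same tangency divisor, are conjugated by a radial map. -/
theorem exists_biholGerm_of_homogeneous {F₁ F₂ : FoliationGerm} {X₁ X₂ : RadialField}
    {D : ExcDiv →₀ ℕ} (hF₁ : F₁.InD) (hF₂ : F₂.InD) (h₁ : F₁.IsHomogeneousWrt X₁)
    (h₂ : F₂.IsHomogeneousWrt X₂)
    (hX₁ : ∀ᶠ p in 𝓝 (0 : ℂ × ℂ), X₁.toFun p = p) (hX₂ : ∀ᶠ p in 𝓝 (0 : ℂ × ℂ), X₂.toFun p = p)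
    (hD₁ : F₁.IsTangRestrict X₁ D) (hD₂ : F₂.IsTangRestrict X₂ D)
    (hH : F₁.holonomy = F₂.holonomy) :
    ∃ Φ : BiholGerm, Φ.MapsTo F₁ F₂ ∧ ∀ p, Φ.onE p = p := by
  obtain ⟨Λ, hΛ⟩ := exists_global_solution (F₁ := F₁) (F₂ := F₂) hF₁ hF₂
    (fun i t η hη => by
      rw [hD₂.analyticOrderAt_eq hX₂ hη]
      exact ENat.natCast_ne_top _)
    (fun i t => by
      obtain ⟨ℓ, hℓ, hℓ0, hw⟩ :=
        exists_fiberMap_wedge_eq_zero hF₁ hF₂ h₁ h₂ hX₁ hX₂ hD₁ hD₂ hH i t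
      exact ⟨_, ℓ, IsLocalSolution.of_fiberMap hℓ hℓ0 hw⟩)
  obtain ⟨g, hg, hg0, hgΛ⟩ := exists_unit_extension (f := Λ)
    (eventually_nhdsNE_of_sectors fun i t₀ => by
      obtain ⟨ℓ, hℓ⟩ := hΛ i t₀
      filter_upwards [eventually_nhds_of_fst_ne_zero hℓ.eq, hℓ.analyticAt.eventually_analyticAt,
        hℓ.analyticAt.continuousAt.eventually_ne hℓ.ne_zero] with q e1 e2 e3 e4
      have hm : mainCoord i (blowDown i q) ≠ 0 := by rwa [mainCoord_blowDown]
      constructor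
      · have e5 : AnalyticAt ℂ (fun p => ℓ (blowUp i p)) (blowDown i q) :=
          AnalyticAt.comp (g := ℓ) (by rwa [blowUp_blowDown i e4]) (analyticAt_blowUp hm)
        refine e5.congr ?_
        filter_upwards [eventually_nhds_blowDown e4 (e1 e4)] with p hp
        rw [← hp.1, hp.2]
      · rw [(e1 e4).self_of_nhds]
        exact e3)
  obtain ⟨Δ, hΔ⟩ := BiholGerm.exists_linear (a := g 0) (b := 0) (c := 0) (d := g 0)
    (by simpa using hg0)
  have hΔs (v : ℂ × ℂ) : Δ.linearPart v = g 0 • v := by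
    rw [hΔ]
    ext <;> simp
  -- The radial map `p ↦ g(p) p` has differential `g(0)` times the identity at the origin, hence it
  -- is a biholomorphism inducing the identity on the divisor.
  let Φ : BiholGerm :=
    { toFun := fun p => g p • p
      analyticAt := hg.smul analyticAt_id
      map_zero := smul_zero _
      linearPart := Δ.linearPart
      hasFDerivAt := by
        have := hg.differentiableAt.hasFDerivAt.smul (hasFDerivAt_id (𝕜 := ℂ) (0 : ℂ × ℂ))
        refine this.congr_fderiv ?_
        ext <;> simp [hΔ] }
  have hconj : ∀ᶠ p in 𝓝[≠] (0 : ℂ × ℂ), RadialConjAt F₁ F₂ Λ p :=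
    eventually_nhdsNE_of_sectors fun i t₀ => (hΛ i t₀).choose_spec.conj
  have hw : ∀ᶠ p in 𝓝[≠] (0 : ℂ × ℂ), wedge ((F₂.pullbackGerm Φ).form p) (F₁.form p) = 0 := by
    have h3 : ∀ᶠ p in 𝓝[≠] (0 : ℂ × ℂ), ∀ᶠ p' in 𝓝 p, g p' = Λ p' := by
      rw [eventually_nhdsWithin_iff] at hgΛ ⊢
      filter_upwards [hgΛ.eventually_nhds] with p e1 e2
      filter_upwards [e1, isOpen_ne.mem_nhds e2] with p' e3 e4 using e3 e4
    filter_upwards [hconj, h3] with p e1 e2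
    exact e1.congr (e2.mono fun _ h => h.symm)
  obtain ⟨u, hu, hu0, hev⟩ := F₁.exists_unit_of_wedge_eq_zero (F₂.pullbackGerm Φ) hw
  refine ⟨Φ, ⟨u, hu, hu0, hev⟩, fun p => ?_⟩
  induction p using Projectivization.ind with
  | h v hv =>
    change Projectivization.mk ℂ (Δ.linearPart v) _ = _
    rw [Projectivization.mk_eq_mk_iff']
    exact ⟨g 0, (hΔs v).symm⟩

/-! ### The tangency divisor with the standard radial foliation -/

section

variable {F : FoliationGerm} {i j : Fin 2} {t₀ s₀ : ℂ} {T T' : ℂ × ℂ → ℂ × ℂ}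

/-- The changes of charts preserve the fibration by the lines through the origin. -/
theorem BiholGerm.IsLift.fderiv_one_zero (hT : BiholGerm.one.IsLift i t₀ j s₀ T) :
    ∀ᶠ q in 𝓝 ((0 : ℂ), t₀), (fderiv ℂ T q (1, 0)).2 = 0 := by
  have ha : AnalyticAt ℂ (fun q => (fderiv ℂ T q (1, 0)).2) (0, t₀) :=
    (_root_.analyticAt_snd (𝕜 := ℂ)).comp
      (analyticAt_clm_apply hT.analyticAt.fderiv analyticAt_const)
  refine eventually_eq_of_fst_ne_zero (AnalyticAt.eventually_continuousAt ha)
    (.of_forall fun _ => continuousAt_const) ?_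
  filter_upwards [hT.fderiv_comm, hT.comm] with q h1 h2 h3
  have h4 := DFunLike.congr_fun h1 ((1 : ℂ), (0 : ℂ))
  change blowDown j (T q) = blowDown i q at h2
  change fderiv ℂ (blowDown j) (T q) (fderiv ℂ T q (1, 0))
    = fderiv ℂ id (blowDown i q) (fderiv ℂ (blowDown i) q (1, 0)) at h4
  set v := fderiv ℂ T q (1, 0)
  rw [fderiv_id, fderiv_blowDown_apply, fderiv_blowDown_apply] at h4
  simp only [ContinuousLinearMap.id_apply, one_smul, mul_zero, zero_smul, add_zero] at h4
  have h5 : (T q).1 ≠ 0 := fun h => h3 (blowDown_eq_zero.1 (h2 ▸ blowDown_eq_zero.2 h))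
  unfold blowDown at h2
  rw [← h4] at h2
  obtain rfl | rfl := eq_zero_or_eq_one j
  · have e1 := congrArg Prod.fst h2
    have e2 := congrArg Prod.snd h2
    simp [dir, fibDir] at e1 e2
    rw [e1] at e2
    have e3 : q.1 * ((T q).1 * v.2) = 0 := by
      rw [e1]
      linear_combination -e2
    simpa [h3, h5] using e3
  · have e1 := congrArg Prod.fst h2
    have e2 := congrArg Prod.snd h2
    simp [dir, fibDir] at e1 e2
    rw [e2] at e1
    have e3 : q.1 * ((T q).1 * v.2) = 0 := by
      rw [e2]
      linear_combination -e1
    simpa [h3, h5] using e3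

theorem BiholGerm.IsLift.fderiv_one_zero_ne_zero (hT : BiholGerm.one.IsLift i t₀ j s₀ T)
    (hT' : BiholGerm.one.IsLift j s₀ i t₀ T') : (fderiv ℂ T (0, t₀) (1, 0)).1 ≠ 0 := by
  intro h0
  have h2 := DFunLike.congr_fun (hT.fderiv_comp hT' BiholGerm.one_isInverse).self_of_nhds
    ((1 : ℂ), (0 : ℂ))
  rw [ContinuousLinearMap.comp_apply,
    show fderiv ℂ T (0, t₀) (1, 0) = 0 from Prod.ext h0 hT.fderiv_one_zero.self_of_nhds,
    _root_.map_zero] at h2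
  simpa using congrArg Prod.fst h2

theorem FoliationGerm.IsLocalGenerator.analyticOrderAt_comp_chart_change
    {η : ℂ × ℂ → (ℂ × ℂ →L[ℂ] ℂ)} (hη : F.IsLocalGenerator j s₀ η)
    (hT : BiholGerm.one.IsLift i t₀ j s₀ T) (hT' : BiholGerm.one.IsLift j s₀ i t₀ T') :
    analyticOrderAt (fun t : ℂ => ((η (T (0, t))).comp (fderiv ℂ T (0, t))) (1, 0)) t₀
      = analyticOrderAt (fun t : ℂ => η (0, t) (1, 0)) s₀ := by
  have hd := hT.deriv_snd_ne_zero hT' BiholGerm.one_isInverse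
  have hτ := hT.analyticAt_snd
  set c : ℂ → ℂ := fun t => (fderiv ℂ T (0, t) (1, 0)).1
  have hc : AnalyticAt ℂ c t₀ :=
    analyticAt_fst.comp (analyticAt_clm_apply (AnalyticAt.comp (g := fderiv ℂ T)
      hT.analyticAt.fderiv (analyticAt_const.prod analyticAt_id)) analyticAt_const)
  have hev : ∀ᶠ t in 𝓝 t₀, ((η (T (0, t))).comp (fderiv ℂ T (0, t))) (1, 0)
      = c t * η (0, (T (0, t)).2) (1, 0) := by
    filter_upwards [(tendsto_zero_prodMk t₀).eventually hT.fderiv_one_zero, hT.eq_prod]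
      with t h1 h2
    rw [ContinuousLinearMap.comp_apply, covector_apply, h1, ← h2]
    ring
  have hb : (T (0, t₀)).2 = s₀ := by rw [hT.base]
  have ha : AnalyticAt ℂ (fun s : ℂ => η (0, s) (1, 0)) (T (0, t₀)).2 := by
    rw [hb]
    exact analyticAt_restrict hη.1
  rw [analyticOrderAt_congr hev]
  change analyticOrderAt (c * ((fun s : ℂ => η (0, s) (1, 0)) ∘ fun t => (T (0, t)).2)) t₀ = _
  rw [analyticOrderAt_mul hc (AnalyticAt.comp (f := fun t => (T (0, t)).2) ha hτ),
    hc.analyticOrderAt_eq_zero.2 (hT.fderiv_one_zero_ne_zero hT'), zero_add,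
    analyticOrderAt_comp_of_deriv_ne_zero hτ hd, hb]

/-- The order of tangency with the fibration by the lines through the origin does not depend on
the chart. -/
theorem FoliationGerm.IsLocalGenerator.analyticOrderAt_eq_of_pt_eq
    {η η' : ℂ × ℂ → (ℂ × ℂ →L[ℂ] ℂ)} (hη : F.IsLocalGenerator i t₀ η)
    (hη' : F.IsLocalGenerator j s₀ η') (hp : pt i t₀ = pt j s₀) :
    analyticOrderAt (fun t : ℂ => η (0, t) (1, 0)) t₀
      = analyticOrderAt (fun t : ℂ => η' (0, t) (1, 0)) s₀ := by
  obtain ⟨T, hT⟩ := exists_chart_change hp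
  obtain ⟨T', hT'⟩ := exists_chart_change hp.symm
  rw [← hη'.analyticOrderAt_comp_chart_change hT hT']
  exact (analyticOrderAt_apply_eq_of_unit hη (hη'.comp_lift (BiholGerm.one_mapsTo F)
    BiholGerm.one_isInverse hT hT')).symm

theorem exists_eq_pt_norm_le (p : ExcDiv) : ∃ i t, ‖t‖ ≤ 1 ∧ p = pt i t := by
  induction p using Projectivization.ind with
  | h v hv =>
    have key (i : Fin 2) (h : ‖sideCoord i v‖ ≤ ‖mainCoord i v‖) :
        ∃ i t, ‖t‖ ≤ 1 ∧ Projectivization.mk ℂ v hv = pt i t := by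
      refine ⟨i, sideCoord i v / mainCoord i v, ?_, (mk_eq_pt_iff hv).2 ⟨fun h0 => ?_, rfl⟩⟩
      · rw [norm_div]
        exact div_le_one_of_le₀ h (norm_nonneg _)
      · rw [h0, norm_zero, norm_le_zero_iff] at h
        obtain rfl | rfl := eq_zero_or_eq_one i
        · exact hv (Prod.ext h0 h)
        · exact hv (Prod.ext h h0)
    rcases le_total ‖v.2‖ ‖v.1‖ with h | h
    · exact key 0 h
    · exact key 1 h

/-- The divisor is covered by the closed unit discs of the two charts; an infinite support would
accumulate in one of them. -/
theorem finite_support_of_isolated {m : ExcDiv → ℕ}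
    (h : ∀ (i : Fin 2) (t₀ : ℂ), ∀ᶠ t in 𝓝[≠] t₀, m (pt i t) = 0) :
    (Function.support m).Finite := by
  have hfin (i : Fin 2) : {t | t ∈ Metric.closedBall (0 : ℂ) 1 ∧ m (pt i t) ≠ 0}.Finite := by
    by_contra hinf
    obtain ⟨t₀, -, ht₀⟩ := Set.Infinite.exists_accPt_of_subset_isCompact hinf
      (isCompact_closedBall (0 : ℂ) 1) (fun t ht => ht.1)
    exact accPt_iff_frequently_nhdsNE.1 ht₀ ((h i t₀).mono fun t ht h' => h'.2 ht)
  refine (Set.finite_iUnion fun i => (hfin i).image (pt i)).subset fun p hp => ?_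
  obtain ⟨i, t, ht, rfl⟩ := exists_eq_pt_norm_le p
  exact Set.mem_iUnion.2 ⟨i, t, ⟨by simpa using ht, hp⟩, rfl⟩

/-- By the identity principle the coefficient `η (1, 0)` vanishes identically nowhere on the divisor
as soon as this holds at one point. Its orders, which do not depend on the chart, form a finite
divisor by compactness. -/
theorem FoliationGerm.InD.exists_isTangRestrict {X : RadialField} (hF : F.InD)
    (hX : ∀ᶠ p in 𝓝 (0 : ℂ × ℂ), X.toFun p = p) {η : ℂ × ℂ → (ℂ × ℂ →L[ℂ] ℂ)}
    (hη : F.IsLocalGenerator i t₀ η)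
    (hA : analyticOrderAt (fun t : ℂ => η (0, t) (1, 0)) t₀ ≠ ⊤) :
    ∃ D, F.IsTangRestrict X D := by
  have hfin (j : Fin 2) (s : ℂ) (η' : ℂ × ℂ → (ℂ × ℂ →L[ℂ] ℂ)) (hη' : F.IsLocalGenerator j s η') :
      analyticOrderAt (fun t : ℂ => η' (0, t) (1, 0)) s ≠ ⊤ := by
    intro htop
    obtain ⟨η₁, hη₁, h1⟩ := hF.order_eq_top (v := (1, 0)) (fun i j t s hp ⟨η₂, hη₂, h2⟩ => by
      obtain ⟨η₃, hη₃⟩ := hF i t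
      exact ⟨η₃, hη₃, (hη₃.analyticOrderAt_eq_of_pt_eq hη₂ hp).trans h2⟩) ⟨η', hη', htop⟩ i t₀
    exact hA ((analyticOrderAt_apply_eq_of_unit hη₁ hη).trans h1)
  have hex (p : ExcDiv) : ∃ m : ℕ, ∀ (j : Fin 2) (s : ℂ) (η' : ℂ × ℂ → (ℂ × ℂ →L[ℂ] ℂ)),
      F.IsLocalGenerator j s η' → p = pt j s →
        analyticOrderAt (fun t : ℂ => η' (0, t) (1, 0)) s = m := by
    obtain ⟨j, s, hp⟩ := exists_eq_pt p
    obtain ⟨η', hη'⟩ := hF j s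
    refine ⟨(analyticOrderAt (fun t : ℂ => η' (0, t) (1, 0)) s).toNat, fun k r η₂ hη₂ hp' => ?_⟩
    rw [hη₂.analyticOrderAt_eq_of_pt_eq hη' (hp'.symm.trans hp)]
    exact (ENat.natCast_toNat (hfin j s η' hη')).symm
  choose m hm using hex
  have hiso (j : Fin 2) (s : ℂ) : ∀ᶠ t in 𝓝[≠] s, m (pt j t) = 0 := by
    obtain ⟨η', hη'⟩ := hF j s
    rcases (analyticAt_restrict (v := (1, 0)) hη'.1).eventually_eq_zero_or_eventually_ne_zero
      with h | h
    · exact absurd (analyticOrderAt_eq_top.2 h) (hfin j s η' hη')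
    · filter_upwards [h, nhdsWithin_le_nhds hη'.eventually] with t h1 h2
      have h3 := hm _ j t η' h2 rfl
      rw [(analyticAt_restrict h2.1).analyticOrderAt_eq_zero.2 h1] at h3
      exact_mod_cast h3.symm
  refine ⟨Finsupp.ofSupportFinite m (finite_support_of_isolated hiso), fun j s => ?_⟩
  obtain ⟨η', hη'⟩ := hF j s
  refine ⟨η', fun _ => (1, 0), hη', ⟨analyticAt_const, by simp, fun q => q.1, analyticAt_fst, ?_⟩,
    hm _ j s η' hη' rfl⟩
  filter_upwards [(tendsto_blowDown j s).eventually hX] with q hq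
  rw [hq, fderiv_blowDown_apply]
  simp [blowDown]

end

/-! ### Functions vanishing only on the exceptional divisor -/

theorem frequently_eq_zero_of_eq_zero_at {g : ℂ × ℂ → ℂ} {a : ℂ × ℂ} (hg : AnalyticAt ℂ g a)
    (h0 : g a = 0) : ∃ᶠ q in 𝓝[≠] a, g q = 0 := by
  have hg' : AnalyticAt ℂ (fun p => g (p + a)) 0 :=
    AnalyticAt.comp (g := g) (by rwa [zero_add]) (analyticAt_id.add analyticAt_const)
  have ht : Tendsto (fun p : ℂ × ℂ => p + a) (𝓝[≠] 0) (𝓝[≠] a) := by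
    refine tendsto_nhdsWithin_of_tendsto_nhds_of_eventually_within _ ?_ ?_
    · refine Tendsto.mono_left ?_ nhdsWithin_le_nhds
      have h : Continuous fun p : ℂ × ℂ => p + a := by fun_prop
      simpa using h.tendsto 0
    · filter_upwards [self_mem_nhdsWithin] with p hp h
      exact hp (by simpa using h)
  exact ht.frequently (frequently_eq_zero_of_eq_zero hg' (by rwa [zero_add]))

/-- If `f` vanishes at the point, its zeros there are not isolated, and they lie on `{x = 0}`; so
`f` vanishes on this whole axis and `x` divides it. The order along the line `t = t₀` drops at each
division, which ends the induction. -/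
theorem exists_eq_fst_pow_mul_unit {f : ℂ × ℂ → ℂ} {t₀ : ℂ} (hf : AnalyticAt ℂ f (0, t₀))
    (h : ∀ᶠ q in 𝓝 ((0 : ℂ), t₀), q.1 ≠ 0 → f q ≠ 0) :
    ∃ (l : ℕ) (U : ℂ × ℂ → ℂ), AnalyticAt ℂ U (0, t₀) ∧ U (0, t₀) ≠ 0 ∧
      ∀ᶠ q in 𝓝 ((0 : ℂ), t₀), f q = q.1 ^ l * U q := by
  have hline : Tendsto (fun x : ℂ => (x, t₀)) (𝓝 0) (𝓝 (0, t₀)) :=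
    (Continuous.prodMk_left t₀).tendsto 0
  have hres {f : ℂ × ℂ → ℂ} (hf : AnalyticAt ℂ f (0, t₀)) :
      AnalyticAt ℂ (fun x : ℂ => f (x, t₀)) 0 :=
    AnalyticAt.comp (g := f) hf (analyticAt_id.prod analyticAt_const)
  have hN : ∃ N : ℕ, analyticOrderAt (fun x : ℂ => f (x, t₀)) 0 = N := by
    have : analyticOrderAt (fun x : ℂ => f (x, t₀)) 0 ≠ ⊤ := by
      intro htop
      have h1 : ∀ᶠ x in 𝓝[≠] (0 : ℂ), f (x, t₀) = 0 :=
        nhdsWithin_le_nhds (analyticOrderAt_eq_top.1 htop)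
      have h2 : ∀ᶠ x in 𝓝[≠] (0 : ℂ), x ≠ 0 → f (x, t₀) ≠ 0 :=
        nhdsWithin_le_nhds (hline.eventually h)
      obtain ⟨x, ⟨h3, h4⟩, h5⟩ := ((h1.and h2).and self_mem_nhdsWithin).exists
      exact h4 h5 h3
    exact ⟨_, (ENat.natCast_toNat this).symm⟩
  obtain ⟨N, hN⟩ := hN
  induction N generalizing f with
  | zero =>
    refine ⟨0, f, hf, ?_, .of_forall fun q => by simp⟩
    exact (hres hf).analyticOrderAt_eq_zero.1 hN
  | succ N ih =>
    have h0 : f (0, t₀) = 0 := by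
      by_contra h0
      rw [(hres hf).analyticOrderAt_eq_zero.2 h0] at hN
      exact absurd hN (by exact_mod_cast (Nat.succ_ne_zero N).symm)
    have h1 : ∀ᶠ t in 𝓝 t₀, f (0, t) = 0 := by
      have hr : AnalyticAt ℂ (fun t : ℂ => f (0, t)) t₀ :=
        AnalyticAt.comp (g := f) hf (analyticAt_const.prod analyticAt_id)
      refine hr.eventually_eq_zero_or_eventually_ne_zero.resolve_right fun hne => ?_
      refine frequently_eq_zero_of_eq_zero_at hf h0 (eventually_nhdsWithin_iff.2 ?_)
      filter_upwards [h, (continuous_snd.tendsto ((0 : ℂ), t₀)).eventually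
        (eventually_nhdsWithin_iff.1 hne)] with q h2 h3 h4
      by_cases h5 : q.1 = 0
      · have h6 := h3 fun h6 => h4 (Prod.ext h5 h6)
        rwa [show ((0 : ℂ), q.2) = q from Prod.ext h5.symm rfl] at h6
      · exact h2 h5
    obtain ⟨f₁, hf₁, hff, -⟩ := exists_eq_smul_of_eq_zero hf h1
    have hN₁ : analyticOrderAt (fun x : ℂ => f₁ (x, t₀)) 0 = N := by
      have e : (fun x : ℂ => f (x, t₀)) =ᶠ[𝓝 0] id * fun x : ℂ => f₁ (x, t₀) := by
        filter_upwards [hline.eventually hff] with x hx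
        simp [hx]
      rw [analyticOrderAt_congr e, analyticOrderAt_mul analyticAt_id (hres hf₁),
        analyticOrderAt_id, add_comm, Nat.cast_succ] at hN
      exact (ENat.add_left_injective_of_ne_top ENat.one_ne_top) hN
    obtain ⟨l, U, hU, hU0, hev⟩ := ih hf₁ (by
      filter_upwards [h, hff] with q h2 h3 h4 h5
      exact h2 h4 (by rw [h3, h5, smul_zero])) hN₁
    refine ⟨l + 1, U, hU, hU0, ?_⟩
    filter_upwards [hff, hev] with q h2 h3
    rw [h2, h3, smul_eq_mul]
    ring

theorem eq_of_pow_mul_eq_pow_mul {m n : ℕ} {u v : ℂ → ℂ} (hu : ContinuousAt u 0)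
    (hv : ContinuousAt v 0) (hu0 : u 0 ≠ 0) (hv0 : v 0 ≠ 0)
    (h : ∀ᶠ x in 𝓝 (0 : ℂ), x ^ m * u x = x ^ n * v x) : m = n ∧ u 0 = v 0 := by
  have key {m n : ℕ} {u v : ℂ → ℂ} (hu : ContinuousAt u 0) (hv : ContinuousAt v 0) (hmn : m ≤ n)
      (h : ∀ᶠ x in 𝓝 (0 : ℂ), x ^ m * u x = x ^ n * v x) : u 0 = 0 ^ (n - m) * v 0 := by
    have hw : ContinuousAt (fun x => x ^ (n - m) * v x) (0 : ℂ) :=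
      (continuousAt_id.pow _).mul hv
    refine tendsto_nhds_unique_of_eventuallyEq (hu.tendsto.mono_left nhdsWithin_le_nhds)
      (hw.tendsto.mono_left (nhdsWithin_le_nhds (s := {0}ᶜ))) ?_
    filter_upwards [nhdsWithin_le_nhds h, self_mem_nhdsWithin] with x h1 h2
    refine mul_left_cancel₀ (pow_ne_zero m h2) ?_
    rw [h1, ← mul_assoc, ← pow_add, Nat.add_sub_cancel' hmn]
  rcases le_total m n with hmn | hmn
  · have h1 := key hu hv hmn h
    have h2 : n - m = 0 := by
      by_contra h2
      exact hu0 (by rw [h1, zero_pow h2, zero_mul])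
    rw [h2, pow_zero, one_mul] at h1
    exact ⟨by omega, h1⟩
  · have h1 := key hv hu hmn (h.mono fun _ h => h.symm)
    have h2 : m - n = 0 := by
      by_contra h2
      exact hv0 (by rw [h1, zero_pow h2, zero_mul])
    rw [h2, pow_zero, one_mul] at h1
    exact ⟨by omega, h1.symm⟩

/-! ### Foliations transverse to the exceptional divisor -/

/-- The pull-back gives `x` times the value of the form on `fibDir i` as `k` times the unit `η (0,
1)`, so this value has no zero off the divisor and is a power of `x` times a unit. `C` is the
quotient of the two coefficients of `η`. -/
theorem FoliationGerm.IsLocalGenerator.exists_form_eq_of_transverse {F : FoliationGerm} {i : Fin 2}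
    {t₀ : ℂ} {η : ℂ × ℂ → (ℂ × ℂ →L[ℂ] ℂ)} (hη : F.IsLocalGenerator i t₀ η)
    (hB : η (0, t₀) (0, 1) ≠ 0) :
    ∃ (l : ℕ) (U C : ℂ × ℂ → ℂ), AnalyticAt ℂ U (0, t₀) ∧ U (0, t₀) ≠ 0 ∧
      AnalyticAt ℂ C (0, t₀) ∧
      (∀ᶠ q in 𝓝 ((0 : ℂ), t₀), F.form (blowDown i q) (fibDir i) = q.1 ^ l * U q) ∧
      ∀ᶠ q in 𝓝 ((0 : ℂ), t₀),
        F.form (blowDown i q) (dir i q.2) = q.1 * (q.1 ^ l * U q) * C q := by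
  have hηa := hη.1
  obtain ⟨-, -, k, hk, hkη⟩ := hη
  have hfa : AnalyticAt ℂ (fun q => F.form (blowDown i q) (fibDir i)) (0, t₀) :=
    analyticAt_covector_apply (AnalyticAt.comp (g := F.form)
      (by rw [blowDown_eq_zero.2 rfl]; exact F.analyticAt) (analyticAt_blowDown i _)) _
  have hBa := analyticAt_covector_apply hηa (0, 1)
  have hAa := analyticAt_covector_apply hηa (1, 0)
  have e1 : ∀ᶠ q in 𝓝 ((0 : ℂ), t₀),
      q.1 * F.form (blowDown i q) (fibDir i) = k q * η q (0, 1) := by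
    filter_upwards [hkη] with q hq
    have := DFunLike.congr_fun hq ((0 : ℂ), (1 : ℂ))
    rw [ContinuousLinearMap.comp_apply, fderiv_blowDown_apply] at this
    simpa using this
  have e2 : ∀ᶠ q in 𝓝 ((0 : ℂ), t₀), F.form (blowDown i q) (dir i q.2) = k q * η q (1, 0) := by
    filter_upwards [hkη] with q hq
    have := DFunLike.congr_fun hq ((1 : ℂ), (0 : ℂ))
    rw [ContinuousLinearMap.comp_apply, fderiv_blowDown_apply] at this
    simpa using this
  obtain ⟨l, U, hU, hU0, hev⟩ := exists_eq_fst_pow_mul_unit hfa (by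
    filter_upwards [e1, e2, F.pullback_ne_zero i t₀, hkη, hBa.continuousAt.eventually_ne hB]
      with q h1 h2 h3 h4 h5 h6 h7
    rw [h7, mul_zero] at h1
    have h8 : k q = 0 := (mul_eq_zero.1 h1.symm).resolve_right h5
    refine h3 h6 ?_
    change F.pullback i q = _ at h4
    rw [h4, h8]
    exact zero_smul ℂ (η q))
  refine ⟨l, U, fun q => η q (1, 0) / η q (0, 1), hU, hU0, hAa.div hBa hB, hev, ?_⟩
  filter_upwards [e1, e2, hev, hBa.continuousAt.eventually_ne hB] with q h1 h2 h3 h4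
  rw [h2, ← h3, h1]
  field_simp

theorem fderiv_apply_eq_of_eq_mul {g : ℂ × ℂ → ℂ} {v : ℂ × ℂ} {w : ℂ → ℂ}
    (hg : DifferentiableAt ℂ g 0) (hw : DifferentiableAt ℂ w 0)
    (h : ∀ᶠ x in 𝓝 (0 : ℂ), g (x • v) = x * w x) : fderiv ℂ g 0 v = w 0 := by
  have h1 : HasDerivAt (fun x : ℂ => x • v) v 0 := by
    simpa using (hasDerivAt_id (0 : ℂ)).smul_const v
  have h2 : HasDerivAt (fun x : ℂ => g (x • v)) (fderiv ℂ g 0 v) 0 := by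
    refine HasFDerivAt.comp_hasDerivAt (l := g) 0 ?_ h1
    rw [zero_smul]
    exact hg.hasFDerivAt
  have h3 : HasDerivAt (fun x : ℂ => x * w x) (1 * w 0 + 0 * deriv w 0) 0 :=
    (hasDerivAt_id (0 : ℂ)).mul hw.hasDerivAt
  have := h2.unique (h3.congr_of_eventuallyEq h)
  rw [this]
  ring

/-- A foliation whose blow-up is everywhere transverse to the exceptional divisor has a radial
linear part. -/
theorem FoliationGerm.exists_fderiv_eq_of_transverse {F : FoliationGerm}
    (hF : ∀ (i : Fin 2) (t : ℂ), ∃ η, F.IsLocalGenerator i t η ∧ η (0, t) (0, 1) ≠ 0) :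
    F.form 0 = 0 ∧ ∃ c : ℂ, c ≠ 0 ∧ ∀ v : ℂ × ℂ,
      fderiv ℂ (fun p => F.form p (0, 1)) 0 v = c * v.1 ∧
      fderiv ℂ (fun p => F.form p (1, 0)) 0 v = -(c * v.2) := by
  have hex (i : Fin 2) (t : ℂ) : ∃ (l : ℕ) (U C : ℂ × ℂ → ℂ), AnalyticAt ℂ U (0, t) ∧
      U (0, t) ≠ 0 ∧ AnalyticAt ℂ C (0, t) ∧
      (∀ᶠ q in 𝓝 ((0 : ℂ), t), F.form (blowDown i q) (fibDir i) = q.1 ^ l * U q) ∧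
      ∀ᶠ q in 𝓝 ((0 : ℂ), t),
        F.form (blowDown i q) (dir i q.2) = q.1 * (q.1 ^ l * U q) * C q := by
    obtain ⟨η, hη, hB⟩ := hF i t
    exact hη.exists_form_eq_of_transverse hB
  choose l U C hU hU0 hC hfib hdir using hex
  have hline (t : ℂ) : Tendsto (fun x : ℂ => (x, t)) (𝓝 0) (𝓝 (0, t)) :=
    (Continuous.prodMk_left t).tendsto 0
  have hres {f : ℂ × ℂ → ℂ} {t : ℂ} (hf : AnalyticAt ℂ f (0, t)) :
      AnalyticAt ℂ (fun x : ℂ => f (x, t)) 0 :=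
    AnalyticAt.comp (g := f) hf (analyticAt_id.prod analyticAt_const)
  -- The exponent `l` and the leading coefficient `β i t` on the line of direction `dir i t` are
  -- intrinsic. So `l` is constant in each chart and `β i` is an entire function without zeros.
  have hloc (i : Fin 2) (t₀ : ℂ) :
      ∀ᶠ t in 𝓝 t₀, l i t = l i t₀ ∧ U i t (0, t) = U i t₀ (0, t) := by
    filter_upwards [(tendsto_zero_prodMk t₀).eventually (hU i t₀).eventually_analyticAt,
      (tendsto_zero_prodMk t₀).eventually ((hU i t₀).continuousAt.eventually_ne (hU0 i t₀)),
      (tendsto_zero_prodMk t₀).eventually (hfib i t₀).eventually_nhds] with t h1 h2 h3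
    refine eq_of_pow_mul_eq_pow_mul (hres (hU i t)).continuousAt (hres h1).continuousAt
      (hU0 i t) h2 ?_
    filter_upwards [(hline t).eventually (hfib i t), (hline t).eventually h3] with x h4 h5
    exact h4.symm.trans h5
  have hconst (i : Fin 2) (t : ℂ) : l i t = l i 0 :=
    ((IsLocallyConstant.iff_eventually_eq (l i)).2 fun t => (hloc i t).mono fun _ h => h.1)
      |>.apply_eq_of_preconnectedSpace _ _
  set β : Fin 2 → ℂ → ℂ := fun i t => U i t (0, t)
  have hβ (i : Fin 2) (t : ℂ) : AnalyticAt ℂ (β i) t := by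
    have h1 : AnalyticAt ℂ (fun s : ℂ => U i t (0, s)) t :=
      AnalyticAt.comp (g := U i t) (hU i t) (analyticAt_const.prod analyticAt_id)
    exact h1.congr ((hloc i t).mono fun _ h => h.2.symm)
  -- The same point seen in both charts, where `fibDir 1 = dir 0 t - t • fibDir 0`. Comparing
  -- leading terms in `x` relates `β 1 (1/t)` to `β 0 t`.
  have hchart (t : ℂ) (ht : t ≠ 0) : l 1 0 = l 0 0 ∧ t ^ l 0 0 * β 1 t⁻¹ = -(t * β 0 t) := by
    have hT : Tendsto (fun x : ℂ => (x * t, t⁻¹)) (𝓝 0) (𝓝 (0, t⁻¹)) := by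
      have : Continuous fun x : ℂ => (x * t, t⁻¹) := by fun_prop
      simpa using this.tendsto 0
    have hu : ContinuousAt (fun x : ℂ => t ^ l 1 0 * U 1 t⁻¹ (x * t, t⁻¹)) 0 := by
      refine continuousAt_const.mul (ContinuousAt.comp (f := fun x : ℂ => (x * t, t⁻¹)) ?_ ?_)
      · rw [zero_mul]
        exact (hU 1 t⁻¹).continuousAt
      · have : Continuous fun x : ℂ => (x * t, t⁻¹) := by fun_prop
        exact this.continuousAt
    have hv : ContinuousAt (fun x : ℂ => U 0 t (x, t) * (x * C 0 t (x, t) - t)) 0 :=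
      ((hres (hU 0 t)).mul ((analyticAt_id.mul (hres (hC 0 t))).sub
        analyticAt_const)).continuousAt
    have := eq_of_pow_mul_eq_pow_mul (m := l 1 0) (n := l 0 0) hu hv
      (by
        rw [zero_mul]
        exact mul_ne_zero (pow_ne_zero _ ht) (hU0 1 t⁻¹))
      (by
        rw [zero_mul, zero_sub]
        exact mul_ne_zero (hU0 0 t) (neg_ne_zero.2 ht)) (by
      filter_upwards [hT.eventually (hfib 1 t⁻¹), (hline t).eventually (hfib 0 t),
        (hline t).eventually (hdir 0 t)] with x h1 h2 h3
      rw [hconst] at h1 h2 h3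
      have e1 : blowDown 1 (x * t, t⁻¹) = blowDown 0 (x, t) := by
        simp [blowDown, dir, ht]
      have e2 : fibDir 1 = dir 0 t - t • fibDir 0 := by simp [fibDir, dir]
      rw [e1, e2, map_sub, map_smul, h2, h3, smul_eq_mul, mul_pow] at h1
      linear_combination -h1)
    refine ⟨this.1, ?_⟩
    have h2 := this.2
    rw [this.1, zero_mul, zero_mul, zero_sub] at h2
    change t ^ l 0 0 * β 1 t⁻¹ = β 0 t * -t at h2
    rw [h2]
    ring
  have hform : F.form 0 = 0 := by
    have h1 (t : ℂ) : F.form 0 (dir 0 t) = 0 := by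
      have := (hdir 0 t).self_of_nhds
      rw [blowDown_eq_zero.2 rfl] at this
      simpa using this
    have h2 : F.form 0 (1, 0) = 0 := by simpa [dir] using h1 0
    refine covector_ext h2 ?_
    have h3 := h1 1
    rw [covector_apply] at h3
    simpa [dir, h2] using h3
  have hl0 : l 0 0 ≠ 0 := by
    intro h0
    have := (hfib 0 0).self_of_nhds
    rw [blowDown_eq_zero.2 rfl, hform, h0] at this
    exact hU0 0 0 (by simpa using this.symm)
  -- If `l ≥ 2`, the chart relation shows that the entire function `1 / β 0` tends to `0` at
  -- infinity, so it would vanish by Liouville's theorem.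
  have hl1 : l 0 0 = 1 := by
    by_contra hl
    have hd : Differentiable ℂ fun t => (β 0 t)⁻¹ := fun t =>
      ((hβ 0 t).inv (hU0 0 t)).differentiableAt
    have hlim : Tendsto (fun t => (β 0 t)⁻¹) (cocompact ℂ) (𝓝 0) := by
      rw [← Metric.cobounded_eq_cocompact]
      have h1 : Tendsto (fun t : ℂ => t⁻¹) (Bornology.cobounded ℂ) (𝓝 0) :=
        tendsto_inv₀_cobounded
      have h2 : Tendsto (fun s : ℂ => -(s ^ (l 0 0 - 1) * (β 1 s)⁻¹)) (𝓝 0) (𝓝 0) := by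
        have h3 : ContinuousAt (fun s : ℂ => -(s ^ (l 0 0 - 1) * (β 1 s)⁻¹)) 0 :=
          ((continuousAt_id.pow _).mul ((hβ 1 0).inv (hU0 1 0)).continuousAt).neg
        have h4 := h3.tendsto
        rwa [zero_pow (by omega), zero_mul, neg_zero] at h4
      refine (h2.comp h1).congr' ?_
      filter_upwards [Bornology.eventually_ne_cobounded (0 : ℂ)] with t ht
      have h5 := (hchart t ht).2
      have h6 : β 1 t⁻¹ ≠ 0 := hU0 1 t⁻¹
      have h7 : β 0 t ≠ 0 := hU0 0 t
      obtain ⟨m, hm⟩ : ∃ m, l 0 0 = m + 1 := ⟨l 0 0 - 1, by omega⟩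
      rw [hm, pow_succ'] at h5
      have h8 : t ^ m * β 1 t⁻¹ = -β 0 t := mul_left_cancel₀ ht (by linear_combination h5)
      simp only [Function.comp_apply, hm, Nat.add_sub_cancel]
      rw [inv_pow, ← mul_inv, h8, inv_neg, neg_neg]
    exact inv_ne_zero (hU0 0 0) (hd.apply_eq_of_tendsto_cocompact 0 hlim)
  have hda (v : ℂ × ℂ) : DifferentiableAt ℂ (fun p => F.form p v) 0 :=
    (analyticAt_covector_apply F.analyticAt v).differentiableAt
  have hb (t : ℂ) : fderiv ℂ (fun p => F.form p (0, 1)) 0 (1, t) = β 0 t := by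
    refine fderiv_apply_eq_of_eq_mul (w := fun x => U 0 t (x, t)) (hda _)
      (hres (hU 0 t)).differentiableAt ?_
    filter_upwards [(hline t).eventually (hfib 0 t)] with x h1
    rw [hconst, hl1, pow_one] at h1
    exact h1
  have ha (t : ℂ) : fderiv ℂ (fun p => F.form p (1, 0)) 0 (1, t) = -(t * β 0 t) := by
    have := fderiv_apply_eq_of_eq_mul (v := (1, t))
      (w := fun x => U 0 t (x, t) * (x * C 0 t (x, t) - t)) (hda (1, 0))
      ((hres (hU 0 t)).mul ((analyticAt_id.mul (hres (hC 0 t))).sub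
        analyticAt_const)).differentiableAt (by
      filter_upwards [(hline t).eventually (hfib 0 t), (hline t).eventually (hdir 0 t)] with x h1 h2
      rw [hconst, hl1, pow_one] at h1 h2
      have e1 : x • ((1 : ℂ), t) = blowDown 0 (x, t) := by simp [blowDown, dir]
      have e2 : ((1 : ℂ), (0 : ℂ)) = dir 0 t - t • fibDir 0 := by simp [fibDir, dir]
      rw [e1, e2, map_sub, map_smul, h1, h2, smul_eq_mul]
      ring)
    rw [this]
    simp only [β]
    ring
  refine ⟨hform, β 0 0, hU0 0 0, fun v => ?_⟩
  have hb' := fun t : ℂ => (covector_apply (fderiv ℂ (fun p => F.form p (0, 1)) 0) (1, t)).symm.trans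
    (hb t)
  have ha' := fun t : ℂ => (covector_apply (fderiv ℂ (fun p => F.form p (1, 0)) 0) (1, t)).symm.trans
    (ha t)
  rw [covector_apply _ v, covector_apply (fderiv ℂ (fun p => F.form p (1, 0)) 0) v]
  set b₁ := fderiv ℂ (fun p => F.form p (0, 1)) 0 (1, 0)
  set b₂ := fderiv ℂ (fun p => F.form p (0, 1)) 0 (0, 1)
  set a₁ := fderiv ℂ (fun p => F.form p (1, 0)) 0 (1, 0)
  set a₂ := fderiv ℂ (fun p => F.form p (1, 0)) 0 (0, 1)
  simp only [one_mul] at ha' hb'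
  have h1 : a₁ = 0 := by simpa using ha' 0
  have h2 : b₁ = β 0 0 := by simpa using hb' 0
  -- Both `β 0 t = b₁ + t b₂` and `-t β 0 t = a₁ + t a₂` are affine in `t`, so the coefficient of
  -- `t²` must vanish; it is extracted at `t = 1` and `t = -1`.
  have h3 : b₂ = 0 := by
    linear_combination (1 / 2) * (ha' 1 + ha' (-1)) - h1 + (1 / 2) * (hb' 1 - hb' (-1))
  have h4 : a₂ = -b₁ := by linear_combination ha' 1 + hb' 1 - h1 - h3
  rw [h1, h3, h4, h2]
  constructor <;> ring

/-! ### Radial foliations -/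

theorem RadialField.exists_biholGerm (X : RadialField) : ∃ Θ : BiholGerm,
    (∀ p, Θ.onE p = p) ∧ ∀ᶠ p in 𝓝 0, fderiv ℂ Θ.toFun p p = X.toFun (Θ.toFun p) := by
  obtain ⟨χ, h1, h2, h3, h4⟩ := X.exists_linearization
  refine ⟨⟨χ, h1, h2, ContinuousLinearEquiv.refl ℂ (ℂ × ℂ), h3⟩, fun p => ?_, h4⟩
  induction p using Projectivization.ind with
  | h v hv => rfl

/-- The linear part of the tangent field is a nonzero multiple of the identity; dividing by the
factor gives a radial field defining the foliation. -/
theorem FoliationGerm.exists_radialField_of_transverse {F : FoliationGerm}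
    (hF : ∀ (i : Fin 2) (t : ℂ), ∃ η, F.IsLocalGenerator i t η ∧ η (0, t) (0, 1) ≠ 0) :
    ∃ X : RadialField, ∀ p, F.form p (X.toFun p) = 0 := by
  obtain ⟨h0, c, hc, hd⟩ := F.exists_fderiv_eq_of_transverse hF
  have ha (v : ℂ × ℂ) : AnalyticAt ℂ (fun p => F.form p v) 0 :=
    analyticAt_covector_apply F.analyticAt v
  have hT : AnalyticAt ℂ F.tangentField 0 := (ha (0, 1)).prod (ha (1, 0)).neg
  refine ⟨⟨fun p => c⁻¹ • F.tangentField p, hT.const_smul (c := c⁻¹), ?_, ?_⟩, fun p => ?_⟩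
  · simp [FoliationGerm.tangentField, h0]
  · have h1 : HasFDerivAt F.tangentField ((fderiv ℂ (fun p => F.form p (0, 1)) 0).prod
        (-fderiv ℂ (fun p => F.form p (1, 0)) 0)) 0 :=
      (ha (0, 1)).differentiableAt.hasFDerivAt.prodMk (ha (1, 0)).differentiableAt.hasFDerivAt.neg
    refine (h1.const_smul c⁻¹).congr_fderiv (ContinuousLinearMap.ext fun v => ?_)
    simp [hd, hc]
  · change F.form p (c⁻¹ • F.tangentField p) = 0
    rw [map_smul, F.apply_tangentField, wedge_self, smul_zero]

/-- The standard radial foliation is homogeneous with respect to `x ∂_x + (y - x y) ∂_y`. -/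
theorem FoliationGerm.divh_nonempty_of_apply_self {F : FoliationGerm}
    (hF : ∀ᶠ p in 𝓝 (0 : ℂ × ℂ), F.form p p = 0) : F.divh.Nonempty := by
  have haa (v : ℂ × ℂ) : AnalyticAt ℂ (fun p => F.form p v) 0 :=
    analyticAt_covector_apply F.analyticAt v
  -- Contraction with the Euler field vanishes, so the form is `w (x dy - y dx)`; its zeros being
  -- isolated, `w` is a unit.
  obtain ⟨w, hw, hbw, -⟩ := exists_eq_smul_of_eq_zero (haa (0, 1)) (by
    have h1 : ∀ᶠ y in 𝓝 (0 : ℂ), y ≠ 0 → F.form (0, y) (0, 1) = 0 := by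
      filter_upwards [(tendsto_zero_prodMk 0).eventually hF] with y h1 h2
      rw [covector_apply] at h1
      simpa [h2] using h1
    have h2 : AnalyticAt ℂ (fun y : ℂ => F.form (0, y) (0, 1)) 0 :=
      AnalyticAt.comp (g := fun p => F.form p (0, 1)) (haa (0, 1))
        (analyticAt_const.prod analyticAt_id)
    have h3 := h2.frequently_zero_iff_eventually_zero.1
      (Filter.Eventually.frequently (f := 𝓝[≠] (0 : ℂ)) (eventually_nhdsWithin_iff.2 h1))
    exact h3)
  have haw : ∀ᶠ p in 𝓝 (0 : ℂ × ℂ), F.form p (1, 0) = -(p.2 * w p) := by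
    refine eventually_eq_of_fst_ne_zero (AnalyticAt.eventually_continuousAt (haa (1, 0)))
      (AnalyticAt.eventually_continuousAt (analyticAt_snd.mul hw).neg) ?_
    filter_upwards [hF, hbw] with p h1 h2 h3
    rw [covector_apply, h2, smul_eq_mul] at h1
    exact mul_left_cancel₀ h3 (by linear_combination h1)
  have hbw' : ∀ᶠ p in 𝓝 (0 : ℂ × ℂ), F.form p (0, 1) = p.1 * w p := hbw
  have hw0 : w 0 ≠ 0 := by
    intro h0
    refine frequently_eq_zero_of_eq_zero hw h0 ?_
    filter_upwards [F.saturated, nhdsWithin_le_nhds haw, nhdsWithin_le_nhds hbw']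
      with p h1 h2 h3 h4
    rw [h4, mul_zero] at h2 h3
    exact h1 (covector_ext (by simpa using h2) (by simpa using h3))
  have hXa : AnalyticAt ℂ (fun p : ℂ × ℂ => (p.1, p.2 - p.1 * p.2)) 0 :=
    analyticAt_fst.prod (analyticAt_snd.sub (analyticAt_fst.mul analyticAt_snd))
  have hXd : HasFDerivAt (fun p : ℂ × ℂ => (p.1, p.2 - p.1 * p.2))
      (ContinuousLinearMap.id ℂ (ℂ × ℂ)) 0 := by
    have h1 : HasFDerivAt (fun p : ℂ × ℂ => p.1 * p.2) _ (0 : ℂ × ℂ) :=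
      (hasFDerivAt_fst (𝕜 := ℂ)).mul (hasFDerivAt_snd (𝕜 := ℂ))
    have h2 : HasFDerivAt (fun p : ℂ × ℂ => (p.1, p.2 - p.1 * p.2)) _ (0 : ℂ × ℂ) :=
      (hasFDerivAt_fst (𝕜 := ℂ)).prodMk ((hasFDerivAt_snd (𝕜 := ℂ)).sub h1)
    refine h2.congr_fderiv (ContinuousLinearMap.ext fun v => ?_)
    simp
  let X : RadialField := ⟨fun p => (p.1, p.2 - p.1 * p.2), hXa, by simp, hXd⟩
  have htang : ∀ᶠ p in 𝓝 (0 : ℂ × ℂ), F.tang X p = -(p.1 ^ 2 * p.2 * w p) := by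
    filter_upwards [haw, hbw'] with p h1 h2
    unfold FoliationGerm.tang
    rw [covector_apply, h1, h2]
    ring
  have hhom : F.IsHomogeneousWrt X := by
    constructor
    · intro h
      have h1 : ∀ᶠ p in 𝓝 (0 : ℂ × ℂ), p.1 ^ 2 * p.2 = 0 := by
        filter_upwards [h, htang, hw.continuousAt.eventually_ne hw0] with p h2 h3 h4
        rw [h2] at h3
        exact (mul_eq_zero.1 (neg_eq_zero.1 h3.symm)).resolve_right h4
      have h2 : Tendsto (fun z : ℂ => (z, z)) (𝓝 0) (𝓝 (0, 0)) :=
        (continuous_id.prodMk continuous_id).tendsto 0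
      have h3 : ∀ᶠ z in 𝓝[≠] (0 : ℂ), z ^ 2 * z = 0 := nhdsWithin_le_nhds (h2.eventually h1)
      obtain ⟨z, hz, hz0⟩ := (h3.and self_mem_nhdsWithin).exists
      exact mul_ne_zero (pow_ne_zero 2 hz0) hz0 hz
    -- The tangency equation is `-x² y w`, a cubic times a unit, and the tangent field is `w` times
    -- the Euler field. Euler's identity accounts for the factor `3`.
    · refine ⟨fun p => 3 * w p + fderiv ℂ w p p,
        (analyticAt_const.mul hw).add (analyticAt_clm_apply hw.fderiv analyticAt_id), ?_⟩
      filter_upwards [htang.eventually_nhds, haw, hbw', hw.eventually_analyticAt] with p h1 h2 h3 h4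
      have e1 : HasFDerivAt (fun p : ℂ × ℂ => p.1 ^ 2 * p.2) _ p :=
        ((hasFDerivAt_fst (𝕜 := ℂ)).pow 2).mul (hasFDerivAt_snd (𝕜 := ℂ))
      have e2 : HasFDerivAt (fun p : ℂ × ℂ => -(p.1 ^ 2 * p.2 * w p)) _ p :=
        (e1.mul h4.differentiableAt.hasFDerivAt).neg
      have e3 : F.tangentField p = w p • p := by
        unfold FoliationGerm.tangentField
        rw [h2, h3]
        ext <;> simp [mul_comm]
      rw [(e2.congr_of_eventuallyEq h1).fderiv, e3, h1.self_of_nhds, map_smul]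
      simp
      ring
  have hpb (i : Fin 2) (t₀ : ℂ) : F.IsLocalGenerator i t₀ fun _ => ContinuousLinearMap.snd ℂ ℂ ℂ := by
    refine (F.isLocalGenerator_iff i t₀ _).2 ⟨analyticAt_const, fun h => ?_, ?_⟩
    · simpa using DFunLike.congr_fun h ((0 : ℂ), (1 : ℂ))
    · refine eventually_eq_of_fst_ne_zero (AnalyticAt.eventually_continuousAt
        (analyticAt_wedge (F.analyticAt_pullback i t₀) analyticAt_const))
        (.of_forall fun _ => continuousAt_const) ?_
      filter_upwards [(tendsto_blowDown i t₀).eventually hF] with q h1 h2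
      rw [pullback_apply_one_zero] at h1
      simpa [wedge, h2] using h1
  have hord (m : ℕ) (ε : ℂ) (hε : ε ≠ 0) (hm : m ≠ 0) (t₀ : ℂ) :
      analyticOrderAt (fun t : ℂ => ε * t ^ m) t₀ = ((if t₀ = 0 then m else 0 : ℕ) : ℕ∞) := by
    have ha : AnalyticAt ℂ (fun t : ℂ => ε * t ^ m) t₀ :=
      analyticAt_const.mul (analyticAt_id.pow m)
    split_ifs with h
    · refine ha.analyticOrderAt_eq_natCast.2 ⟨fun _ => ε, analyticAt_const, hε, ?_⟩
      refine .of_forall fun t => ?_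
      rw [h, sub_zero, smul_eq_mul, mul_comm]
    · exact ha.analyticOrderAt_eq_zero.2 (mul_ne_zero hε (pow_ne_zero m h))
  -- The saturated foliation is generated by `dt`, while the blown-up field has `∂_t`-component `-t`
  -- in chart `0` and `t²` in chart `1`.
  refine ⟨Finsupp.single (pt 0 0) 1 + Finsupp.single (pt 1 0) 2, X, hhom, fun i t₀ => ?_⟩
  obtain rfl | rfl := eq_zero_or_eq_one i
  · refine ⟨_, fun q => (1, -q.2), hpb 0 t₀, ⟨analyticAt_const.prod analyticAt_snd.neg, by simp,
      fun q => q.1, analyticAt_fst, .of_forall fun q => ?_⟩, ?_⟩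
    · rw [fderiv_blowDown_apply]
      change _ = ((blowDown 0 q).1, (blowDown 0 q).2 - (blowDown 0 q).1 * (blowDown 0 q).2)
      ext <;> simp [blowDown, dir, fibDir]
      ring
    · have := hord 1 (-1) (by simp) one_ne_zero t₀
      simp only [pow_one, neg_one_mul] at this
      refine this.trans ?_
      have h1 : pt 1 0 ≠ pt 0 t₀ := fun h => by simpa using pt_zero_eq_pt_one_iff.1 h.symm
      by_cases h : t₀ = 0
      · subst h
        simp [h1]
      · have h2 : pt 0 0 ≠ pt 0 t₀ := fun e => h (pt_injective 0 e).symm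
        simp [h, h1.symm, h2.symm]
  · refine ⟨_, fun q => (1 - q.2 * q.1, q.2 ^ 2), hpb 1 t₀,
      ⟨(analyticAt_const.sub (analyticAt_snd.mul analyticAt_fst)).prod (analyticAt_snd.pow 2),
      by simp, fun q => q.1, analyticAt_fst, .of_forall fun q => ?_⟩, ?_⟩
    · rw [fderiv_blowDown_apply]
      change _ = ((blowDown 1 q).1, (blowDown 1 q).2 - (blowDown 1 q).1 * (blowDown 1 q).2)
      ext <;> simp [blowDown, dir, fibDir] <;> ring
    · have := hord 2 1 one_ne_zero two_ne_zero t₀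
      simp only [one_mul] at this
      refine this.trans ?_
      have h1 : pt 0 0 ≠ pt 1 t₀ := fun h => by simpa using pt_zero_eq_pt_one_iff.1 h
      by_cases h : t₀ = 0
      · subst h
        simp [h1]
      · have h2 : pt 1 0 ≠ pt 1 t₀ := fun e => h (pt_injective 1 e).symm
        simp [h, h1.symm, h2.symm]

/-! ### Normal forms -/

/-- Homogeneity and tangency divisors are transported by `Θ`; when `Θ` linearizes `X`, the
transported field is the Euler field. -/
theorem FoliationGerm.IsHomogeneousWrt.exists_normalForm {F : FoliationGerm} {X : RadialField}
    (h : F.IsHomogeneousWrt X) {Θ : BiholGerm}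
    (hΘ : ∀ᶠ p in 𝓝 0, fderiv ℂ Θ.toFun p p = X.toFun (Θ.toFun p)) :
    ∃ X' : RadialField, (∀ᶠ p in 𝓝 (0 : ℂ × ℂ), X'.toFun p = p) ∧
      (F.pullbackGerm Θ).IsHomogeneousWrt X' ∧
      ∀ D D' : ExcDiv →₀ ℕ, F.IsTangRestrict X D → (∀ p, D' p = D (Θ.onE p)) →
        (F.pullbackGerm Θ).IsTangRestrict X' D' := by
  obtain ⟨Ψ, hΨ⟩ := Θ.exists_inverse
  obtain ⟨X', hX'⟩ := X.exists_pullback hΨ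
  refine ⟨X', ?_, h.comp (F.mapsTo_pullbackGerm Θ) hΨ hX', fun D D' hD hD' =>
    hD.comp (F.mapsTo_pullbackGerm Θ) hΨ hX' hD'⟩
  filter_upwards [hΘ, hΨ.fderiv_comp] with p h1 h2
  rw [hX', ← h1, ← ContinuousLinearMap.comp_apply, h2]
  rfl

/-- In normal form, either the coefficient `η (1, 0)` is not identically zero on the divisor, and
its orders form the required divisor, or the tangency divisor contains the exceptional one and
another radial field has to be found. -/
theorem FoliationGerm.InD.divh_nonempty {F : FoliationGerm} {X : RadialField} (hF : F.InD)
    (h : F.IsHomogeneousWrt X) : F.divh.Nonempty := by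
  have hpull (F : FoliationGerm) (Θ : BiholGerm) (h : (F.pullbackGerm Θ).divh.Nonempty) :
      F.divh.Nonempty := by
    obtain ⟨D, hD⟩ := h
    obtain ⟨φ, hφ⟩ := Θ.exists_autE
    exact ⟨_, (F.mapsTo_pullbackGerm Θ).push_mem_divh hφ hD⟩
  obtain ⟨Θ, -, hΘ⟩ := X.exists_biholGerm
  refine hpull F Θ ?_
  obtain ⟨X', hX', h', -⟩ := h.exists_normalForm hΘ
  have hF' := (F.mapsTo_pullbackGerm Θ).inD hF
  generalize F.pullbackGerm Θ = G at h' hF'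
  by_cases hA : ∃ i t η, G.IsLocalGenerator i t η ∧
      analyticOrderAt (fun t : ℂ => η (0, t) (1, 0)) t ≠ ⊤
  · obtain ⟨i, t, η, hη, hne⟩ := hA
    obtain ⟨D, hD⟩ := hF'.exists_isTangRestrict hX' hη hne
    exact ⟨D, X', h', hD⟩
  -- Here `η (1, 0)` vanishes on the whole divisor, so the foliation is transverse to it everywhere.
  -- It is then defined by a radial field, whose linearization makes it the pencil of lines through
  -- the origin.
  · push Not at hA
    obtain ⟨Y, hY⟩ := G.exists_radialField_of_transverse fun i t => by
      obtain ⟨η, hη⟩ := hF' i t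
      refine ⟨η, hη, fun hB => hη.2.1 (covector_ext ?_ hB)⟩
      exact (analyticOrderAt_eq_top.1 (hA i t η hη)).self_of_nhds
    obtain ⟨Ξ, -, hΞ⟩ := Y.exists_biholGerm
    refine hpull G Ξ (FoliationGerm.divh_nonempty_of_apply_self ?_)
    filter_upwards [hΞ] with p hp
    change G.form (Ξ.toFun p) (fderiv ℂ Ξ.toFun p p) = 0
    rw [hp, hY]

theorem AutE.exists_linear_biholGerm (φ : AutE) : ∃ Λ : BiholGerm, Λ.onE = φ.toEquiv ∧
    Λ.toFun = Λ.linearPart := by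
  obtain ⟨Λ, hΛ⟩ := φ.exists_biholGerm
  exact ⟨⟨Λ.linearPart, Λ.linearPart.analyticAt 0, map_zero _, Λ.linearPart,
    Λ.linearPart.hasFDerivAt⟩, hΛ, rfl⟩

theorem AutE.conj_injective (φ : AutE) : Function.Injective φ.conj := by
  refine Set.image_injective.2 fun a b h => ?_
  have h1 := congrArg Prod.fst h
  have h2 := congrArg Prod.snd h
  refine Prod.ext (φ.toEquiv.injective h1) ?_
  funext p
  have h3 := congrFun h2 (φ.toEquiv p)
  simpa using h3

/-- Two homogeneous dicritical foliations are conjugated by a germ inducing a given automorphism of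
the exceptional divisor as soon as it conjugates their holonomies and their tangency divisors. -/
theorem exists_biholGerm_of_holonomy_eq {F₁ F₂ : FoliationGerm} (hF₁ : F₁.InD) (hF₂ : F₂.InD)
    {φ : AutE} (hH : F₂.holonomy = φ.conj F₁.holonomy) {D : ExcDiv →₀ ℕ} (hD₁ : D ∈ F₁.divh)
    (hD₂ : φ.push D ∈ F₂.divh) : ∃ Φ : BiholGerm, Φ.MapsTo F₁ F₂ ∧ Φ.onE = φ.toEquiv := by
  obtain ⟨X₁, h₁, hD₁⟩ := hD₁
  obtain ⟨X₂, h₂, hD₂⟩ := hD₂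
  obtain ⟨Θ₁, hΘ₁E, hΘ₁⟩ := X₁.exists_biholGerm
  obtain ⟨Ξ, hΞE, hΞ⟩ := X₂.exists_biholGerm
  obtain ⟨Λ, hΛE, hΛ⟩ := φ.exists_linear_biholGerm
  have hΘ₂E : (Ξ.comp Λ).onE = φ.toEquiv := by
    funext p
    rw [BiholGerm.onE_comp, hΞE, hΛE]
  have hΘ₂ : ∀ᶠ p in 𝓝 0, fderiv ℂ (Ξ.comp Λ).toFun p p = X₂.toFun ((Ξ.comp Λ).toFun p) := by
    filter_upwards [Ξ.fderiv_comp Λ, Λ.tendsto.eventually hΞ] with p e1 e2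
    rw [e1, ContinuousLinearMap.comp_apply]
    have e3 : fderiv ℂ Λ.toFun p p = Λ.toFun p := by
      rw [hΛ, ContinuousLinearEquiv.fderiv]
      rfl
    rw [e3, e2]
    rfl
  obtain ⟨X₁', hX₁', h₁', ht₁⟩ := h₁.exists_normalForm hΘ₁
  obtain ⟨X₂', hX₂', h₂', ht₂⟩ := h₂.exists_normalForm hΘ₂
  have hm₁ := F₁.mapsTo_pullbackGerm Θ₁
  have hm₂ := F₂.mapsTo_pullbackGerm (Ξ.comp Λ)
  obtain ⟨Ψ₁, hΨ₁⟩ := Θ₁.exists_inverse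
  have hpush (p : ExcDiv) : D p = φ.push D ((Ξ.comp Λ).onE p) := by
    rw [hΘ₂E]
    exact (Finsupp.mapDomain_apply φ.toEquiv.injective D p).symm
  -- `Θ₁` induces the identity on the divisor, hence does not change the holonomy; both sides are
  -- the conjugate by the identity automorphism `ι`.
  have hol₁ : (F₁.pullbackGerm Θ₁).holonomy = F₁.holonomy := by
    obtain ⟨ι, hι⟩ := BiholGerm.one.exists_autE
    have e1 : Θ₁.onE = ι.toEquiv := by
      rw [← hι]
      funext p
      rw [hΘ₁E, BiholGerm.one_onE]
    have e2 := (BiholGerm.one_mapsTo (F₁.pullbackGerm Θ₁)).holonomy_eq hι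
    rw [hm₁.holonomy_eq e1, ← e2]
  have hol₂ : (F₁.pullbackGerm Θ₁).holonomy = (F₂.pullbackGerm (Ξ.comp Λ)).holonomy := by
    refine φ.conj_injective ?_
    rw [hol₁, ← hH, hm₂.holonomy_eq hΘ₂E]
  obtain ⟨Φ, hΦ, hΦE⟩ := exists_biholGerm_of_homogeneous (hm₁.inD hF₁) (hm₂.inD hF₂) h₁' h₂'
    hX₁' hX₂' (ht₁ D D hD₁ fun p => by rw [hΘ₁E]) (ht₂ _ D hD₂ hpush) hol₂
  refine ⟨((Ξ.comp Λ).comp Φ).comp Ψ₁, (hm₂.comp hΦ).comp (hm₁.symm hΨ₁), ?_⟩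
  funext p
  rw [BiholGerm.onE_comp, BiholGerm.onE_comp, hΘ₂E, hΦE]
  congr 1
  conv_rhs => rw [← hΨ₁.symm.onE_onE p, hΘ₁E]

end Dicritical

end

theorem theoremt (n : ℕ) (F₁ F₂ : Dicritical.FoliationGerm) (hF₁ : F₁.InDhn n) :
    ((∃ Φ : Dicritical.BiholGerm, Φ.MapsTo F₁ F₂) ↔
      F₂.InDn n ∧ ∃ φ : Dicritical.AutE,
        F₂.holonomy = φ.conj F₁.holonomy ∧ ∃ D ∈ F₁.divh, φ.push D ∈ F₂.divh) ∧
    ∀ φ : Dicritical.AutE,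
      ((∃ Φ : Dicritical.BiholGerm, Φ.MapsTo F₁ F₂ ∧ Φ.onE = φ.toEquiv) ↔
        F₂.InDn n ∧ F₂.holonomy = φ.conj F₁.holonomy ∧
          ∃ D ∈ F₁.divh, φ.push D ∈ F₂.divh) ∧
      (F₂.InDn n → F₂.holonomy = φ.conj F₁.holonomy →
        (∃ D ∈ F₁.divh, φ.push D ∈ F₂.divh) → ∀ D ∈ F₁.divh, φ.push D ∈ F₂.divh) := by
  obtain ⟨hn, X, hX⟩ := hF₁
  have hnec (φ : Dicritical.AutE) (Φ : Dicritical.BiholGerm) (hΦ : Φ.MapsTo F₁ F₂)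
      (hφ : Φ.onE = φ.toEquiv) : F₂.InDn n ∧ F₂.holonomy = φ.conj F₁.holonomy ∧
        ∃ D ∈ F₁.divh, φ.push D ∈ F₂.divh := by
    obtain ⟨Ψ, hΨ⟩ := Φ.exists_inverse
    obtain ⟨D, hD⟩ := hn.1.divh_nonempty hX
    exact ⟨(hΦ.symm hΨ).inDn hn, hΦ.holonomy_eq hφ, D, hD, hΦ.push_mem_divh hφ hD⟩
  have hsuff (φ : Dicritical.AutE) (h2 : F₂.InDn n) (hH : F₂.holonomy = φ.conj F₁.holonomy)
      (hD : ∃ D ∈ F₁.divh, φ.push D ∈ F₂.divh) :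
      ∃ Φ : Dicritical.BiholGerm, Φ.MapsTo F₁ F₂ ∧ Φ.onE = φ.toEquiv := by
    obtain ⟨D, hD1, hD2⟩ := hD
    exact Dicritical.exists_biholGerm_of_holonomy_eq hn.1 h2.1 hH hD1 hD2
  refine ⟨⟨?_, ?_⟩, fun φ => ⟨⟨?_, ?_⟩, ?_⟩⟩
  · rintro ⟨Φ, hΦ⟩
    obtain ⟨φ, hφ⟩ := Φ.exists_autE
    obtain ⟨h1, h2⟩ := hnec φ Φ hΦ hφ
    exact ⟨h1, φ, h2⟩
  · rintro ⟨h1, φ, h2, h3⟩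
    obtain ⟨Φ, hΦ, -⟩ := hsuff φ h1 h2 h3
    exact ⟨Φ, hΦ⟩
  · rintro ⟨Φ, hΦ, hφ⟩
    exact hnec φ Φ hΦ hφ
  · rintro ⟨h1, h2, h3⟩
    exact hsuff φ h1 h2 h3
  · intro h1 h2 h3 D hD
    -- A single matching divisor already produces a conjugacy inducing `φ`, and this conjugacy
    -- carries all the other divisors.
    obtain ⟨Φ, hΦ, hφ⟩ := hsuff φ h1 h2 h3
    exact hΦ.push_mem_divh hφ hD
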